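/- Let $B$ and $M$ be smooth manifolds (Hausdorff, second countable, finite dimensional, without boundary) and $f\colon B\to M$ a smooth map. **Definitions.** A *Lie algebroid* over $M$ is a vector bundle $A\to M$ with a bundle map $\rho\colon A\to TM$ (the anchor) and a Lie bracket on the smooth sections $\Gamma(A)$ such that $[a,ga']=\rho(a)(g)\,a'+g[a,a']$ for $a,a'\in\Gamma(A)$, $g\in C^\infty(M)$. An isomorphism of Lie algebroids covering the identity is an isomorphism of smooth vector bundles over the identity which intertwines anchors and brackets. A *Dirac structure* on $M$ is a subbundle $L\subset TM\oplus T^*M$ that is maximal isotropic for the pairing $\langle (X,\xi),(X',\xi')\rangle=\xi'(X)+\xi(X')$ and whose sections are closed under the Courant bracket $[(X,\xi),(X',\xi')]=([X,X'],\mathcal L_X\xi'-\iota_{X'}d\xi)$. Its underlying Lie algebroid is $L$ with anchor $\rho=\mathrm{pr}_{TM}$ and the restricted Courant bracket. $L$ is *transverse to $f$* if $\mathrm{pr}_{TM}(L_{f(x)})+f_*(T_xB)=T_{f(x)}M$ for all $x\in B$. The *backward pullback* of $L$ is $$\mathfrak B L=\{(X,f^*\eta) : X\in T_xB,\ \eta\in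 T^*_{f(x)}M,\ (f_*X,\eta)\in L_{f(x)}\}\subset TB\oplus T^*B .$$ For a Lie algebroid $A$ over $M$ with anchor $\rho$, let $f^!A=\{(a,X): a\in A_{f(x)},\ X\in T_xB,\ \rho(a)=f_*X\}\subset f^*A\oplus TB$. When it is a smooth subbundle, the *Lie algebroid pullback* of $A$ is $f^!A$ with anchor $(a,X)\mapsto X$ and the Lie algebroid bracket given, for $h_i,h'_j\in C^\infty(B)$ and $a_i,a'_j\in\Gamma(A)$ (finitely many), by $$\Big[\big(\textstyle\sum_i h_ia_i,X\big),\big(\sum_j h'_ja'_j,X'\big)\Big]=\Big(\sum_{i,j}h_ih'_j[a_i,a'_j]+\sum_jX(h'_j)a'_j-\sum_iX'(h_i)a_i,\ [X,X']\Big),$$ where $a_i,a_j'$ and $[a_i,a'_j]$ on the right and left are composed with $f$. **Statement.** Let $L$ be a Dirac structure on $M$ that is transverse to $f$. Then: 1. The anchor $\mathrm{pr}_{TM}$ and the restricted Courant bracket make $L$ a Lie algebroid over $M$; the backward pullback $\mathfrak BL$ is a Dirac structure on $B$, hence likewise a Lie algebroid over $B$. 2. The Lie algebroid pullback $f^!L$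 exists: $f^!L$ is a smooth subbundle of $f^*L\oplus TB$, and there is exactly one Lie algebroid structure on it with anchor $(\ell,X)\mapsto X$ and with the bracket displayed above. 3. The map $$f^!L\to\mathfrak BL,\qquad ((f_*X,\eta),X)\mapsto (X,f^*\eta)$$ is an isomorphism of Lie algebroids covering $\mathrm{id}_B$. -/

import Mathlib

open Bundle Topology
open scoped Manifold ContDiff

noncomputable section

/-! ## Subbundles of smooth vector bundles, their sections and their bundle maps

All manifolds are smooth, modelled on a finite dimensional real vector space `E`, without
boundary. A vector bundle is presented as a smooth subbundle `S` of an ambient smooth vector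
bundle `V` (the choice `S = ⊤` gives `V` itself). -/

section Subbundle

variable {E : Type*} [NormedAddCommGroup E] [NormedSpace ℝ E]
  {M : Type*} [TopologicalSpace M] [ChartedSpace E M]
  {F : Type*} [NormedAddCommGroup F] [NormedSpace ℝ F]
  {V : M → Type*} [TopologicalSpace (TotalSpace F V)]
  [∀ x, AddCommGroup (V x)] [∀ x, Module ℝ (V x)] [∀ x, TopologicalSpace (V x)]
  [FiberBundle F V] [VectorBundle ℝ F V]
  {F' : Type*} [NormedAddCommGroup F'] [NormedSpace ℝ F']
  {V' : M → Type*} [TopologicalSpace (TotalSpace F' V')]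
  [∀ x, AddCommGroup (V' x)] [∀ x, Module ℝ (V' x)] [∀ x, TopologicalSpace (V' x)]
  [FiberBundle F' V'] [VectorBundle ℝ F' V']

variable (E F) in
/-- The family of subspaces `S x ⊆ V x` is a smooth subbundle of rank `k`: near every point it
is spanned by `k` linearly independent smooth local sections of `V`. -/
def IsSmoothSubbundle (k : ℕ) (S : ∀ x, Submodule ℝ (V x)) : Prop :=
  ∀ x₀ : M, ∃ U : Set M, IsOpen U ∧ x₀ ∈ U ∧ ∃ s : Fin k → ∀ x, V x,
    (∀ i, ContMDiffOn 𝓘(ℝ, E) (𝓘(ℝ, E).prod 𝓘(ℝ, F)) ∞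
      (fun x => TotalSpace.mk' F x (s i x)) U) ∧
    ∀ x ∈ U, LinearIndependent ℝ (fun i => s i x) ∧
      Submodule.span ℝ (Set.range fun i => s i x) = S x

variable (E F) in
/-- The space `Γ(S)` of global smooth sections of the ambient bundle with values in `S`. -/
def SubbundleSection (S : ∀ x, Submodule ℝ (V x)) :
    Submodule ℝ Cₛ^∞⟮𝓘(ℝ, E); F, V⟯ where
  carrier := {σ | ∀ x, σ x ∈ S x}
  add_mem' hσ hτ x := (S x).add_mem (hσ x) (hτ x)
  zero_mem' x := (S x).zero_mem
  smul_mem' c _ hσ x := (S x).smul_mem c (hσ x)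

/-- The product `g σ` of a smooth function `g` and a section `σ` of `S`. -/
def SubbundleSection.funSmul {S : ∀ x, Submodule ℝ (V x)}
    (g : C^∞⟮𝓘(ℝ, E), M; 𝓘(ℝ, ℝ), ℝ⟯) (σ : SubbundleSection E F S) :
    SubbundleSection E F S :=
  ⟨⟨fun x => g x • σ.1 x, g.contMDiff.smul_section σ.1.contMDiff⟩,
    fun x => (S x).smul_mem (g x) (σ.2 x)⟩

variable (E F F') in
/-- Smoothness of a vector bundle map `φ : S → V'` over the identity: it takes smooth local
sections of `S` over open sets to smooth local sections of `V'`. (The values of `σ` outside `U`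
play no role.) -/
def IsSmoothBundleMap {S : ∀ x, Submodule ℝ (V x)} (φ : ∀ x, S x →ₗ[ℝ] V' x) : Prop :=
  ∀ (U : Set M) (σ : ∀ x, S x), IsOpen U →
    ContMDiffOn 𝓘(ℝ, E) (𝓘(ℝ, E).prod 𝓘(ℝ, F)) ∞
      (fun x => TotalSpace.mk' F x (σ x : V x)) U →
    ContMDiffOn 𝓘(ℝ, E) (𝓘(ℝ, E).prod 𝓘(ℝ, F')) ∞
      (fun x => TotalSpace.mk' F' x (φ x (σ x))) U

/-! ## Lie algebroids -/

/-- The differential of a real function, `df_x : T_x M → ℝ`, so that `X(f) = df(X)`. -/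
def funDifferential (g : M → ℝ) (x : M) : TangentSpace 𝓘(ℝ, E) x →L[ℝ] ℝ :=
  mfderiv 𝓘(ℝ, E) 𝓘(ℝ, ℝ) g x

variable [IsManifold 𝓘(ℝ, E) ∞ M]

variable (E F) in
/-- A Lie algebroid whose underlying vector bundle is `S ⊆ V` and whose anchor is
`ρ : S → TM`. -/
@[ext]
structure LieAlgebroid (S : ∀ x, Submodule ℝ (V x))
    (ρ : ∀ x, S x →ₗ[ℝ] TangentSpace 𝓘(ℝ, E) x) where
  /-- `S` is a vector bundle. -/
  isSubbundle : ∃ k, IsSmoothSubbundle E F k S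
  /-- The anchor is a smooth bundle map. -/
  anchor_smooth : IsSmoothBundleMap (V' := fun x : M => TangentSpace 𝓘(ℝ, E) x) E F E ρ
  /-- The real bilinear bracket on smooth sections. -/
  bracket : SubbundleSection E F S →ₗ[ℝ] SubbundleSection E F S →ₗ[ℝ] SubbundleSection E F S
  bracket_self : ∀ a, bracket a a = 0
  jacobi : ∀ a b c,
    bracket a (bracket b c) = bracket (bracket a b) c + bracket b (bracket a c)
  /-- `[a, g b] = ρ(a)(g) b + g [a, b]`. -/
  leibniz : ∀ (g : C^∞⟮𝓘(ℝ, E), M; 𝓘(ℝ, ℝ), ℝ⟯) (a b : SubbundleSection E F S) (x : M),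
    (bracket a (SubbundleSection.funSmul g b)).1 x =
      funDifferential g x (ρ x ⟨a.1 x, a.2 x⟩) • b.1 x +
        g x • (bracket a b).1 x

/-- The bundle map `φ : S → S'` over the identity is an isomorphism of Lie algebroids from `A`
to `A'`: it is an isomorphism of smooth vector bundles, and it intertwines the anchors and the
brackets. -/
structure IsLieAlgebroidIso {S : ∀ x, Submodule ℝ (V x)} {S' : ∀ x, Submodule ℝ (V' x)}
    {ρ : ∀ x, S x →ₗ[ℝ] TangentSpace 𝓘(ℝ, E) x} {ρ' : ∀ x, S' x →ₗ[ℝ] TangentSpace 𝓘(ℝ, E) x}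
    (A : LieAlgebroid E F S ρ) (A' : LieAlgebroid E F' S' ρ')
    (φ : ∀ x, S x →ₗ[ℝ] S' x) : Prop where
  smooth : IsSmoothBundleMap E F F' (fun x => (S' x).subtype ∘ₗ φ x)
  exists_inverse : ∃ ψ : ∀ x, S' x →ₗ[ℝ] S x,
    IsSmoothBundleMap E F' F (fun x => (S x).subtype ∘ₗ ψ x) ∧
      ∀ x, ψ x ∘ₗ φ x = LinearMap.id ∧ φ x ∘ₗ ψ x = LinearMap.id
  anchor : ∀ x, ρ' x ∘ₗ φ x = ρ x
  /-- If `σ' = φ σ` and `τ' = φ τ` then `[σ', τ'] = φ [σ, τ]`. -/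
  bracket : ∀ (σ τ : SubbundleSection E F S) (σ' τ' : SubbundleSection E F' S'),
    (∀ x, σ'.1 x = φ x ⟨σ.1 x, σ.2 x⟩) → (∀ x, τ'.1 x = φ x ⟨τ.1 x, τ.2 x⟩) →
      ∀ x, (A'.bracket σ' τ').1 x = φ x ⟨(A.bracket σ τ).1 x, (A.bracket σ τ).2 x⟩

end Subbundle

/-! ## The pullback of a Lie algebroid -/

/-- Fibres of a pullback bundle are additive groups. -/
instance Bundle.Pullback.instAddCommGroupFiber {B M : Type*} (f : B → M) (V : M → Type*)
    [∀ y, AddCommGroup (V y)] (x : B) : AddCommGroup ((f *ᵖ V) x) :=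
  inferInstanceAs (AddCommGroup (V (f x)))

section Pullback

variable {EB : Type*} [NormedAddCommGroup EB] [NormedSpace ℝ EB]
  {B : Type*} [TopologicalSpace B] [ChartedSpace EB B] [IsManifold 𝓘(ℝ, EB) ∞ B]
  {EM : Type*} [NormedAddCommGroup EM] [NormedSpace ℝ EM]
  {M : Type*} [TopologicalSpace M] [ChartedSpace EM M] [IsManifold 𝓘(ℝ, EM) ∞ M]
  {F : Type*} [NormedAddCommGroup F] [NormedSpace ℝ F]
  {V : M → Type*} [TopologicalSpace (TotalSpace F V)]
  [∀ x, AddCommGroup (V x)] [∀ x, Module ℝ (V x)] [∀ x, TopologicalSpace (V x)]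
  [FiberBundle F V] [VectorBundle ℝ F V]

/-- The anchored bundle `(S, ρ)` is transverse to `f`:
`ρ(S_{f(x)}) + f_*(T_x B) = T_{f(x)} M` for all `x`. -/
def IsTransverse (f : C^∞⟮𝓘(ℝ, EB), B; 𝓘(ℝ, EM), M⟯) {S : ∀ y, Submodule ℝ (V y)}
    (ρ : ∀ y, S y →ₗ[ℝ] TangentSpace 𝓘(ℝ, EM) y) : Prop :=
  ∀ x, LinearMap.range (ρ (f x)) ⊔
    LinearMap.range (mfderiv 𝓘(ℝ, EB) 𝓘(ℝ, EM) f x).toLinearMap = ⊤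

/-- The ambient vector bundle `f^*V ⊕ TB` of the Lie algebroid pullback. -/
abbrev PullbackAmbient (f : C^∞⟮𝓘(ℝ, EB), B; 𝓘(ℝ, EM), M⟯) (V : M → Type*) : B → Type _ :=
  fun x => ((f : B → M) *ᵖ V) x × TangentSpace 𝓘(ℝ, EB) x

/-- The fibre product `f^!S = f^*S ×_{TM} TB ⊆ f^*V ⊕ TB`, with fibre
`{(a, X) | a ∈ S_{f(x)}, X ∈ T_x B, ρ(a) = f_* X}`. -/
def pullbackFiber (f : C^∞⟮𝓘(ℝ, EB), B; 𝓘(ℝ, EM), M⟯) {S : ∀ y, Submodule ℝ (V y)}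
    (ρ : ∀ y, S y →ₗ[ℝ] TangentSpace 𝓘(ℝ, EM) y) (x : B) :
    Submodule ℝ (PullbackAmbient f V x) where
  carrier := {p | ∃ h : p.1 ∈ S (f x),
    ρ (f x) ⟨p.1, h⟩ = mfderiv 𝓘(ℝ, EB) 𝓘(ℝ, EM) f x p.2}
  add_mem' := by
    rintro p q ⟨hp, hp'⟩ ⟨hq, hq'⟩
    refine ⟨(S (f x)).add_mem hp hq, ?_⟩
    have := (ρ (f x)).map_add ⟨p.1, hp⟩ ⟨q.1, hq⟩
    rw [hp', hq'] at this
    exact this.trans ((mfderiv 𝓘(ℝ, EB) 𝓘(ℝ, EM) f x).map_add p.2 q.2).symm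
  zero_mem' := ⟨(S (f x)).zero_mem, (ρ (f x)).map_zero.trans
    (mfderiv 𝓘(ℝ, EB) 𝓘(ℝ, EM) f x).map_zero.symm⟩
  smul_mem' := by
    rintro c p ⟨hp, hp'⟩
    refine ⟨(S (f x)).smul_mem c hp, ?_⟩
    have := (ρ (f x)).map_smul c ⟨p.1, hp⟩
    rw [hp'] at this
    exact this.trans ((mfderiv 𝓘(ℝ, EB) 𝓘(ℝ, EM) f x).map_smul c p.2).symm

/-- The anchor of `f^!S`: the second projection `(a, X) ↦ X`. -/
def pullbackAnchor (f : C^∞⟮𝓘(ℝ, EB), B; 𝓘(ℝ, EM), M⟯) {S : ∀ y, Submodule ℝ (V y)}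
    (ρ : ∀ y, S y →ₗ[ℝ] TangentSpace 𝓘(ℝ, EM) y) (x : B) :
    pullbackFiber f ρ x →ₗ[ℝ] TangentSpace 𝓘(ℝ, EB) x where
  toFun p := p.1.2
  map_add' _ _ := rfl
  map_smul' _ _ := rfl

/-- The Lie algebroid `P` on `f^!S` is the pullback of the Lie algebroid `A`: for all sections
`(∑ i, h i • a i, X)` and `(∑ j, h' j • a' j, X')` of `f^!S`, with `a i, a' j ∈ Γ(A)` and
`h i, h' j ∈ C^∞(B)`, the bracket is
`(∑ i j, h i h' j [a i, a' j] + ∑ j, X(h' j) a' j - ∑ i, X'(h i) a i, [X, X'])`. -/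
def LieAlgebroid.IsPullback (f : C^∞⟮𝓘(ℝ, EB), B; 𝓘(ℝ, EM), M⟯)
    {S : ∀ y, Submodule ℝ (V y)} {ρ : ∀ y, S y →ₗ[ℝ] TangentSpace 𝓘(ℝ, EM) y}
    (A : LieAlgebroid EM F S ρ)
    (P : LieAlgebroid EB (F × EB) (pullbackFiber f ρ) (pullbackAnchor f ρ)) : Prop :=
  ∀ (m n : ℕ) (h : Fin m → C^∞⟮𝓘(ℝ, EB), B; 𝓘(ℝ, ℝ), ℝ⟯)
    (h' : Fin n → C^∞⟮𝓘(ℝ, EB), B; 𝓘(ℝ, ℝ), ℝ⟯)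
    (a : Fin m → SubbundleSection EM F S) (a' : Fin n → SubbundleSection EM F S)
    (σ τ : SubbundleSection EB (F × EB) (pullbackFiber f ρ)),
    (∀ x, (σ.1 x).1 = ∑ i, h i x • ((a i).1 (f x) : V (f x))) →
    (∀ x, (τ.1 x).1 = ∑ j, h' j x • ((a' j).1 (f x) : V (f x))) →
    ∀ x,
      ((P.bracket σ τ).1 x).1 =
        (∑ i, ∑ j, (h i x * h' j x) • ((A.bracket (a i) (a' j)).1 (f x) : V (f x))) +
        (∑ j, funDifferential (h' j) x (σ.1 x).2 •
          ((a' j).1 (f x) : V (f x))) -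
        (∑ i, funDifferential (h i) x (τ.1 x).2 •
          ((a i).1 (f x) : V (f x))) ∧
      ((P.bracket σ τ).1 x).2 =
        VectorField.mlieBracket 𝓘(ℝ, EB) (fun y => (σ.1 y).2) (fun y => (τ.1 y).2) x

end Pullback

/-! ## The Courant bracket and Dirac structures -/

section Dirac

variable {E : Type*} [NormedAddCommGroup E] [NormedSpace ℝ E]
  {M : Type*} [TopologicalSpace M] [ChartedSpace E M]

variable (E) in
/-- The fibre `T_x^* M`. -/
abbrev CotangentFiber (x : M) : Type _ :=
  TangentSpace 𝓘(ℝ, E) x →L[ℝ] Bundle.Trivial M ℝ x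

variable (E) in
/-- The fibre of `TM ⊕ T^*M` at `x`. -/
abbrev GenTangent (x : M) : Type _ :=
  TangentSpace 𝓘(ℝ, E) x × CotangentFiber E x

/-- The exterior derivative of a `1`-form, computed in the preferred chart at `x`:
`dξ (u, v) = (D_u ξ)(v) - (D_v ξ)(u)`. -/
def extDerivOneForm (ξ : ∀ x : M, CotangentFiber E x) (x : M) :
    TangentSpace 𝓘(ℝ, E) x →L[ℝ] CotangentFiber E x :=
  let c := extChartAt 𝓘(ℝ, E) x
  -- the form in the chart
  let η : E → E →L[ℝ] ℝ := fun y => (ξ (c.symm y)).comp (mfderiv 𝓘(ℝ, E) 𝓘(ℝ, E) c.symm y)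
  let D : E →L[ℝ] E →L[ℝ] ℝ := fderiv ℝ η (c x)
  let T : E →L[ℝ] E := mfderiv 𝓘(ℝ, E) 𝓘(ℝ, E) c x
  show E →L[ℝ] E →L[ℝ] ℝ from (D - D.flip).bilinearComp T T

/-- The Lie derivative of a `1`-form, `L_X ξ = ι_X dξ + d(ξ(X))`. -/
def lieDerivOneForm (X : ∀ x : M, TangentSpace 𝓘(ℝ, E) x) (ξ : ∀ x : M, CotangentFiber E x)
    (x : M) : CotangentFiber E x :=
  extDerivOneForm ξ x (X x) + funDifferential (fun y => ξ y (X y)) x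

/-- The Courant bracket `[(X, ξ), (X', ξ')] = ([X, X'], L_X ξ' - ι_{X'} dξ)`. -/
def courantBracket (σ τ : ∀ x : M, GenTangent E x) (x : M) : GenTangent E x :=
  (VectorField.mlieBracket 𝓘(ℝ, E) (fun y => (σ y).1) (fun y => (τ y).1) x,
    lieDerivOneForm (fun y => (σ y).1) (fun y => (τ y).2) x -
      extDerivOneForm (fun y => (σ y).2) x (τ x).1)

/-- The canonical symmetric pairing `⟨(X, ξ), (X', ξ')⟩ = ξ'(X) + ξ(X')`. -/
def genPairing {x : M} (p q : GenTangent E x) : ℝ := q.2 p.1 + p.2 q.1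

/-- A subspace of `T_x M ⊕ T_x^* M` on which the pairing vanishes. -/
def IsIsotropic {x : M} (W : Submodule ℝ (GenTangent E x)) : Prop :=
  ∀ p ∈ W, ∀ q ∈ W, genPairing p q = 0

variable [IsManifold 𝓘(ℝ, E) ∞ M]

variable (E) in
/-- A Dirac structure on `M`: a maximal isotropic smooth subbundle of `TM ⊕ T^*M` whose sections
are closed under the Courant bracket. -/
structure IsDirac (L : ∀ x : M, Submodule ℝ (GenTangent E x)) : Prop where
  isSubbundle : ∃ k, IsSmoothSubbundle E (E × (E →L[ℝ] ℝ)) k L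
  maximal_isotropic : ∀ x, Maximal IsIsotropic (L x)
  involutive : ∀ (σ τ : SubbundleSection E (E × (E →L[ℝ] ℝ)) L) (x : M),
    courantBracket (fun y => σ.1 y) (fun y => τ.1 y) x ∈ L x

/-- The anchor `(X, ξ) ↦ X` of the Lie algebroid underlying a Dirac structure. -/
def diracAnchor (L : ∀ x : M, Submodule ℝ (GenTangent E x)) (x : M) :
    L x →ₗ[ℝ] TangentSpace 𝓘(ℝ, E) x where
  toFun p := p.1.1
  map_add' _ _ := rfl
  map_smul' _ _ := rfl

/-- The bracket of the Lie algebroid `A` on `L ⊆ TM ⊕ T^*M` is the restriction of the Courant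
bracket, i.e. `A` is the Lie algebroid underlying the Dirac structure `L`. -/
def LieAlgebroid.IsCourant {L : ∀ x : M, Submodule ℝ (GenTangent E x)}
    (A : LieAlgebroid E (E × (E →L[ℝ] ℝ)) L (diracAnchor L)) : Prop :=
  ∀ (σ τ : SubbundleSection E (E × (E →L[ℝ] ℝ)) L) (x : M),
    (A.bracket σ τ).1 x = courantBracket (fun y => σ.1 y) (fun y => τ.1 y) x

end Dirac

/-! ## The backward pullback of a Dirac structure -/

section Backward

variable {EB : Type*} [NormedAddCommGroup EB] [NormedSpace ℝ EB]
  {B : Type*} [TopologicalSpace B] [ChartedSpace EB B] [IsManifold 𝓘(ℝ, EB) ∞ B]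
  {EM : Type*} [NormedAddCommGroup EM] [NormedSpace ℝ EM]
  {M : Type*} [TopologicalSpace M] [ChartedSpace EM M] [IsManifold 𝓘(ℝ, EM) ∞ M]

/-- The pullback `f^*η ∈ T_x^* B` of `η ∈ T_{f(x)}^* M`. -/
def pullbackCovector (f : C^∞⟮𝓘(ℝ, EB), B; 𝓘(ℝ, EM), M⟯) (x : B) :
    CotangentFiber EM (f x) →ₗ[ℝ] CotangentFiber EB x where
  toFun η := η.comp (mfderiv 𝓘(ℝ, EB) 𝓘(ℝ, EM) f x)
  map_add' _ _ := rfl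
  map_smul' _ _ := rfl

/-- The backward pullback `𝔅L = {(X, f^*η) | (f_* X, η) ∈ L}`. -/
def backwardPullback (f : C^∞⟮𝓘(ℝ, EB), B; 𝓘(ℝ, EM), M⟯)
    (L : ∀ y : M, Submodule ℝ (GenTangent EM y)) (x : B) :
    Submodule ℝ (GenTangent EB x) where
  carrier := {p | ∃ η : CotangentFiber EM (f x),
    (mfderiv 𝓘(ℝ, EB) 𝓘(ℝ, EM) f x p.1, η) ∈ L (f x) ∧ p.2 = pullbackCovector f x η}
  add_mem' := by
    rintro p q ⟨η, hp, hp'⟩ ⟨θ, hq, hq'⟩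
    refine ⟨η + θ, ?_, ?_⟩
    · have := (L (f x)).add_mem hp hq
      rwa [Prod.mk_add_mk, ← map_add] at this
    · rw [Prod.snd_add, hp', hq', map_add]
  zero_mem' := by
    refine ⟨0, ?_, (map_zero _).symm⟩
    rw [Prod.fst_zero, map_zero]
    exact (L (f x)).zero_mem
  smul_mem' := by
    rintro c p ⟨η, hp, hp'⟩
    refine ⟨c • η, ?_, ?_⟩
    · have := (L (f x)).smul_mem c hp
      rwa [Prod.smul_mk, ← map_smul] at this
    · rw [Prod.smul_snd, hp', map_smul]

/-- The map `f^!L → 𝔅L`, `((f_* X, η), X) ↦ (X, f^*η)`. -/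
def pullbackToBackward (f : C^∞⟮𝓘(ℝ, EB), B; 𝓘(ℝ, EM), M⟯)
    (L : ∀ y : M, Submodule ℝ (GenTangent EM y)) (x : B) :
    pullbackFiber f (diracAnchor L) x →ₗ[ℝ] backwardPullback f L x where
  toFun p := ⟨(p.1.2, pullbackCovector f x (show GenTangent EM (f x) from p.1.1).2), by
    obtain ⟨⟨⟨Y, η⟩, X⟩, h, h'⟩ := p
    change Y = mfderiv 𝓘(ℝ, EB) 𝓘(ℝ, EM) f x X at h'
    subst h'
    exact ⟨η, h, rfl⟩⟩
  map_add' _ _ := rfl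
  map_smul' _ _ := rfl

end Backward

end

noncomputable section

set_option linter.unusedSectionVars false

/-! ### Vector fields and one-forms in a chart, and the invariant formula for the exterior
derivative. -/

section
variable {E : Type*} [NormedAddCommGroup E] [NormedSpace ℝ E]
  {M : Type*} [TopologicalSpace M] [ChartedSpace E M]

/-! On the fibre over `x` the map `((f_*X, η), X) ↦ (X, f^*η)` is onto `𝔅L` by the very definition
of `𝔅L`. If the image vanishes, then `X = 0`, `(0, η)` lies in `L`, and `η` kills `f_*(TB)`; by
isotropy `η` also kills `pr(L)`, so transversality gives `η = 0` (`pullbackToBackward_bijective`).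
Almost everything else is carried across this fibrewise isomorphism.

Transversality also says that `(a, X) ↦ ρ(a) - f_*X` is onto `TM`, so its kernel `f^!L` is a smooth
subbundle (`isSmoothSubbundle_pullbackFiber`). Images of frames are frames, hence `𝔅L` is a smooth
subbundle too, and the inverse map is smooth (`IsSmoothSubbundle.map`,
`IsSmoothSubbundle.isSmoothBundleMap_symm`). Maximal isotropy of `𝔅L` is linear algebra: a covector
is prescribed on `pr(L)` and on `f_*(TB)`, and isotropy makes the two prescriptions agree
(`maximal_isotropic_backwardPullback`).

The core is `IsDirac.courantBracket_pullbackToBackward`: for sections `(∑ h_i a_i, X)` and `(∑ h'_j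
a'_j, X')`, the displayed pullback formula gives an element of `f^!L`, and its image is the Courant
bracket of the images. The vector part is a version of naturality of the Lie bracket for `f`-related
fields; the covector part uses that `d` commutes with `f^*`, the unwanted derivatives of the
coefficients cancelling because `L` is isotropic. This yields involutivity of `𝔅L`. The bracket on
`f^!L` is then defined by transport from `𝔅L`, so that its axioms, and the independence of the
displayed formula from the chosen expansions, need no separate check. Uniqueness holds because
brackets are local and every section has the displayed form near each point.

That a Dirac structure is a Lie algebroid rests on three facts about the Courant bracket: it
satisfies the Jacobi identity in Leibniz form and the Leibniz rule in its second argument on all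
sections, and its symmetric part is the differential of the pairing, which vanishes on an isotropic
subbundle. -/

theorem funDifferential_eq_fderiv {g : M → ℝ} {x : M}
    (hg : MDifferentiableAt 𝓘(ℝ, E) 𝓘(ℝ, ℝ) g x) :
    (funDifferential (E := E) g x : E →L[ℝ] ℝ) =
      fderiv ℝ (g ∘ (extChartAt 𝓘(ℝ, E) x).symm) (extChartAt 𝓘(ℝ, E) x x) := by
  unfold funDifferential
  rw [hg.mfderiv]
  simp [writtenInExtChartAt, fderivWithin_univ]
  rfl

theorem ContMDiffAt.of_clm_apply {G W : Type*} [NormedAddCommGroup G] [NormedSpace ℝ G]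
    [NormedAddCommGroup W] [NormedSpace ℝ W] [FiniteDimensional ℝ W] {T : M → W →L[ℝ] G} {x : M}
    (h : ∀ w, ContMDiffAt 𝓘(ℝ, E) 𝓘(ℝ, G) ∞ (fun y => T y w) x) :
    ContMDiffAt 𝓘(ℝ, E) 𝓘(ℝ, W →L[ℝ] G) ∞ T x := by
  let b := Module.finBasis ℝ W
  have h1 : T = fun y => ∑ i,
      ContinuousLinearMap.smulRightL ℝ W G (b.coord i).toContinuousLinearMap (T y (b i)) := by
    funext y
    refine ContinuousLinearMap.coe_injective (b.ext fun j => ?_)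
    simp [Finsupp.single_apply]
  rw [h1]
  refine ContMDiffAt.sum fun i _ => ?_
  exact (ContinuousLinearMap.contMDiff _).contMDiffAt.comp x (h (b i))

/-- The derivative of the inverse of the preferred chart at `x`. -/
def chartSymmDeriv (x : M) (y : E) : E →L[ℝ] E :=
  mfderiv 𝓘(ℝ, E) 𝓘(ℝ, E) (extChartAt 𝓘(ℝ, E) x).symm y

/-- A vector field read in the preferred chart at `x`. -/
def chartField (x : M) (X : ∀ x : M, TangentSpace 𝓘(ℝ, E) x) (y : E) : E :=
  (chartSymmDeriv x y).inverse (X ((extChartAt 𝓘(ℝ, E) x).symm y))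

/-- A `1`-form read in the preferred chart at `x`. -/
def chartForm (x : M) (ξ : ∀ x : M, CotangentFiber E x) (y : E) : E →L[ℝ] ℝ :=
  (show E →L[ℝ] ℝ from ξ ((extChartAt 𝓘(ℝ, E) x).symm y)).comp (chartSymmDeriv x y)

theorem chartField_eq (x : M) (X : ∀ x : M, TangentSpace 𝓘(ℝ, E) x) :
   VectorField.mpullbackWithin 𝓘(ℝ, E) 𝓘(ℝ, E) (extChartAt 𝓘(ℝ, E) x).symm X
     (Set.range 𝓘(ℝ, E)) = chartField x X := by
  ext y
  rw [VectorField.mpullbackWithin_apply, modelWithCornersSelf_coe, Set.range_id, mfderivWithin_univ]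
  rfl

variable [IsManifold 𝓘(ℝ, E) ∞ M]

/-- The vector field `X` is smooth at `x`. -/
abbrev SmoothFieldAt (X : ∀ x : M, TangentSpace 𝓘(ℝ, E) x) (x : M) : Prop :=
  ContMDiffAt 𝓘(ℝ, E) (𝓘(ℝ, E).prod 𝓘(ℝ, E)) ∞ (fun y => TotalSpace.mk' E y (X y)) x

/-- The `1`-form `ξ` is smooth at `x`. -/
abbrev SmoothFormAt (ξ : ∀ x : M, CotangentFiber E x) (x : M) : Prop :=
  ContMDiffAt 𝓘(ℝ, E) (𝓘(ℝ, E).prod 𝓘(ℝ, E →L[ℝ] ℝ)) ∞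
    (fun y => TotalSpace.mk' (E →L[ℝ] ℝ) (E := fun y : M => CotangentFiber E y) y (ξ y)) x

theorem mlieBracket_eq_lieBracket (X Y : ∀ x : M, TangentSpace 𝓘(ℝ, E) x) (x : M) :
    (VectorField.mlieBracket 𝓘(ℝ, E) X Y x : E) =
      VectorField.lieBracket ℝ (chartField x X) (chartField x Y) (extChartAt 𝓘(ℝ, E) x x) := by
  rw [← VectorField.mlieBracketWithin_univ, VectorField.mlieBracketWithin_apply,
    mfderiv_extChartAt_self, chartField_eq, chartField_eq, modelWithCornersSelf_coe,
    Set.range_id, Set.preimage_univ,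
    Set.univ_inter]
  have h : ∀ v : E, (ContinuousLinearMap.id ℝ E).inverse v = v := fun v => by
    rw [ContinuousLinearMap.inverse_id, ContinuousLinearMap.id_apply]
  exact (h _).trans (congrFun (VectorField.lieBracketWithin_univ (𝕜 := ℝ)
    (V := chartField x X) (W := chartField x Y)) _)

theorem extDerivOneForm_apply (ξ : ∀ x : M, CotangentFiber E x) (x : M) (u v : E) :
    (extDerivOneForm ξ x : E →L[ℝ] E →L[ℝ] ℝ) u v =
      fderiv ℝ (chartForm x ξ) (extChartAt 𝓘(ℝ, E) x x) u v
       - fderiv ℝ (chartForm x ξ) (extChartAt 𝓘(ℝ, E) x x) v u := by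
  have h : ∀ (D : E →L[ℝ] E →L[ℝ] ℝ) (T : E →L[ℝ] E), T = ContinuousLinearMap.id ℝ E →
      (D - D.flip).bilinearComp T T u v = D u v - D v u := by
    rintro D _ rfl
    rfl
  exact h _ _ mfderiv_extChartAt_self

theorem isInvertible_chartSymmDeriv {x : M} {y : E} (hy : y ∈ (extChartAt 𝓘(ℝ, E) x).target) :
    (chartSymmDeriv x y).IsInvertible := by
  have := isInvertible_mfderivWithin_extChartAt_symm hy
  rwa [modelWithCornersSelf_coe, Set.range_id, mfderivWithin_univ] at this

theorem chartSymmDeriv_self (x : M) :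
    chartSymmDeriv x (extChartAt 𝓘(ℝ, E) x x) = ContinuousLinearMap.id ℝ E := by
  have := mfderivWithin_range_extChartAt_symm (I := 𝓘(ℝ, E)) (x := x)
  rwa [modelWithCornersSelf_coe, Set.range_id, mfderivWithin_univ] at this

theorem chartForm_chartField (ξ : ∀ x : M, CotangentFiber E x)
    (X : ∀ x : M, TangentSpace 𝓘(ℝ, E) x) {x : M} {y : E}
    (hy : y ∈ (extChartAt 𝓘(ℝ, E) x).target) :
    chartForm x ξ y (chartField x X y) =
      ξ ((extChartAt 𝓘(ℝ, E) x).symm y) (X ((extChartAt 𝓘(ℝ, E) x).symm y)) := by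
  obtain ⟨e, he⟩ := isInvertible_chartSymmDeriv hy
  simp only [chartForm, chartField]
  rw [← he, ContinuousLinearMap.inverse_equiv]
  exact congrArg _ (e.apply_symm_apply _)

theorem chartField_self (X : ∀ x : M, TangentSpace 𝓘(ℝ, E) x) (x : M) :
    chartField x X (extChartAt 𝓘(ℝ, E) x x) = X x := by
  rw [chartField, chartSymmDeriv_self, ContinuousLinearMap.inverse_id, extChartAt_to_inv x]
  rfl

theorem chartForm_self (ξ : ∀ x : M, CotangentFiber E x) (x : M) :
    chartForm x ξ (extChartAt 𝓘(ℝ, E) x x) = ξ x := by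
  rw [chartForm, chartSymmDeriv_self, extChartAt_to_inv x]
  rfl

theorem differentiableAt_chartField [CompleteSpace E] {X : ∀ x : M, TangentSpace 𝓘(ℝ, E) x} {x : M}
    (h : SmoothFieldAt X x) :
    DifferentiableAt ℝ (chartField x X) (extChartAt 𝓘(ℝ, E) x x) := by
  have : IsManifold 𝓘(ℝ, E) 2 M := inferInstance
  have := MDifferentiableWithinAt.differentiableWithinAt_mpullbackWithin_vectorField (s := Set.univ)
    (h.mdifferentiableAt (by simp)).mdifferentiableWithinAt
  rw [chartField_eq, modelWithCornersSelf_coe, Set.range_id, Set.preimage_univ,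
    Set.univ_inter] at this
  exact this.differentiableAt Filter.univ_mem

theorem mdifferentiableAt_extChartAt_symm {x : M} {y : E}
    (hy : y ∈ (extChartAt 𝓘(ℝ, E) x).target) :
    MDifferentiableAt 𝓘(ℝ, E) 𝓘(ℝ, E) (extChartAt 𝓘(ℝ, E) x).symm y := by
  have := mdifferentiableWithinAt_extChartAt_symm hy
  rwa [modelWithCornersSelf_coe, Set.range_id, mdifferentiableWithinAt_univ] at this

theorem differentiableAt_comp_extChartAt_symm {G : Type*} [NormedAddCommGroup G] [NormedSpace ℝ G]
    {g : M → G} {x : M} (hg : MDifferentiableAt 𝓘(ℝ, E) 𝓘(ℝ, G) g x) :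
    DifferentiableAt ℝ (fun y => g ((extChartAt 𝓘(ℝ, E) x).symm y)) (extChartAt 𝓘(ℝ, E) x x) := by
  rw [← mdifferentiableAt_iff_differentiableAt]
  refine MDifferentiableAt.comp (I' := 𝓘(ℝ, E)) (g := g) _ ?_
    (mdifferentiableAt_extChartAt_symm (mem_extChartAt_target x))
  rwa [extChartAt_to_inv x]

theorem differentiableAt_chartForm {ξ : ∀ x : M, CotangentFiber E x} {x : M}
    (h : SmoothFormAt ξ x) :
    DifferentiableAt ℝ (chartForm x ξ) (extChartAt 𝓘(ℝ, E) x x) := by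
  have h1 := ((contMDiffAt_hom_bundle _).1 h).2.mdifferentiableAt (by simp)
  refine (differentiableAt_comp_extChartAt_symm h1).congr_of_eventuallyEq ?_
  filter_upwards [extChartAt_target_mem_nhds x] with y hy
  have hy' : (extChartAt 𝓘(ℝ, E) x).symm y ∈ (chartAt E x).source := by
    simpa using (extChartAt 𝓘(ℝ, E) x).map_target hy
  have h3 := TangentBundle.symmL_trivializationAt (I := 𝓘(ℝ, E)) hy'
  rw [modelWithCornersSelf_coe, Set.range_id, mfderivWithin_univ,
    (extChartAt 𝓘(ℝ, E) x).right_inv hy] at h3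
  ext v
  simp only [ContinuousLinearMap.inCoordinates]
  erw [h3, Trivial.continuousLinearMapAt_trivialization]
  rfl

theorem ContMDiffAt.cotangent_apply {EB : Type*} [NormedAddCommGroup EB] [NormedSpace ℝ EB]
  {B : Type*} [TopologicalSpace B] [ChartedSpace EB B] {b : B → M}
  {ξ : ∀ x, CotangentFiber E (b x)} {X : ∀ x, TangentSpace 𝓘(ℝ, E) (b x)} {x : B}
  (hξ : ContMDiffAt 𝓘(ℝ, EB) (𝓘(ℝ, E).prod 𝓘(ℝ, E →L[ℝ] ℝ)) ∞
    (fun y => TotalSpace.mk' (E →L[ℝ] ℝ) (E := fun y : M => CotangentFiber E y) (b y) (ξ y)) x)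
  (hX : ContMDiffAt 𝓘(ℝ, EB) (𝓘(ℝ, E).prod 𝓘(ℝ, E)) ∞
    (fun y => TotalSpace.mk' E (E := fun y : M => TangentSpace 𝓘(ℝ, E) y) (b y) (X y)) x) :
  ContMDiffAt 𝓘(ℝ, EB) 𝓘(ℝ, ℝ) ∞ (fun y => ξ y (X y)) x := by
  have := hξ.clm_bundle_apply hX
  exact (contMDiffAt_totalSpace.1 this).2

theorem ContMDiffAt.mfderiv_apply_field {EB : Type*} [NormedAddCommGroup EB] [NormedSpace ℝ EB]
    {B : Type*} [TopologicalSpace B] [ChartedSpace EB B] [IsManifold 𝓘(ℝ, EB) ∞ B] {f : B → M}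
    {X : ∀ x : B, TangentSpace 𝓘(ℝ, EB) x} {x : B}
    (hf : ContMDiffAt 𝓘(ℝ, EB) 𝓘(ℝ, E) ∞ f x) (hX : SmoothFieldAt X x) :
    ContMDiffAt 𝓘(ℝ, EB) (𝓘(ℝ, E).prod 𝓘(ℝ, E)) ∞
      (fun y => TotalSpace.mk' E (E := fun y : M => TangentSpace 𝓘(ℝ, E) y) (f y)
        (mfderiv 𝓘(ℝ, EB) 𝓘(ℝ, E) f y (X y))) x :=
  (hf.mfderiv_const (m := ∞) (by simp)).clm_apply_of_inCoordinates hX hf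

theorem ContMDiffAt.funDifferential_apply {g : M → ℝ} {X : ∀ x : M, TangentSpace 𝓘(ℝ, E) x} {x : M}
    (hg : ContMDiffAt 𝓘(ℝ, E) 𝓘(ℝ, ℝ) ∞ g x) (hX : SmoothFieldAt X x) :
    ContMDiffAt 𝓘(ℝ, E) 𝓘(ℝ, ℝ) ∞ (fun y => funDifferential g y (X y)) x := by
  have := (contMDiffAt_totalSpace.1 (hg.mfderiv_apply_field hX)).2
  refine this.congr_of_eventuallyEq (.of_forall fun y => ?_)
  simp only [_root_.trivializationAt_model_space_apply]
  rfl

/-- The derivative `X(g) = dg(X)` of a function along a vector field. -/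
abbrev fieldDeriv (X : ∀ x : M, TangentSpace 𝓘(ℝ, E) x) (g : M → ℝ) (x : M) : ℝ :=
  funDifferential g x (X x)

/-- In the chart at `x` the product rule splits `X(ξ(Y))` into `(D_X ξ)(Y) + ξ(D_X Y)`.
Antisymmetrizing, the first terms form `dξ(X, Y)` and the second form `ξ([X, Y])`. No transition
maps occur, since the chart centred at `x` has identity derivative there. -/
theorem extDerivOneForm_apply_fields [CompleteSpace E] {ξ : ∀ x : M, CotangentFiber E x}
    {X Y : ∀ x : M, TangentSpace 𝓘(ℝ, E) x} {x : M} (hξ : SmoothFormAt ξ x)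
    (hX : SmoothFieldAt X x) (hY : SmoothFieldAt Y x) :
    extDerivOneForm ξ x (X x) (Y x) = fieldDeriv X (fun y => ξ y (Y y)) x -
      fieldDeriv Y (fun y => ξ y (X y)) x - ξ x (VectorField.mlieBracket 𝓘(ℝ, E) X Y x) := by
  have key : ∀ {X Y : ∀ x : M, TangentSpace 𝓘(ℝ, E) x}, SmoothFieldAt X x → SmoothFieldAt Y x →
      fieldDeriv X (fun y => ξ y (Y y)) x =
        fderiv ℝ (chartForm x ξ) (extChartAt 𝓘(ℝ, E) x x) (X x) (Y x) +
        (ξ x : E →L[ℝ] ℝ) (fderiv ℝ (chartField x Y) (extChartAt 𝓘(ℝ, E) x x) (X x)) := by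
    intro X Y hX hY
    have h : (fun y => ξ y (Y y)) ∘ (extChartAt 𝓘(ℝ, E) x).symm
        =ᶠ[𝓝 (extChartAt 𝓘(ℝ, E) x x)] fun y => chartForm x ξ y (chartField x Y y) := by
      filter_upwards [extChartAt_target_mem_nhds x] with y hy
      exact (chartForm_chartField ξ Y hy).symm
    have h1 : MDifferentiableAt 𝓘(ℝ, E) 𝓘(ℝ, ℝ) (fun y => ξ y (Y y)) x :=
      (hξ.cotangent_apply hY).mdifferentiableAt (by simp)
    refine (congrArg (· (X x)) (funDifferential_eq_fderiv h1)).trans ?_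
    rw [h.fderiv_eq, fderiv_clm_apply (differentiableAt_chartForm hξ)
      (differentiableAt_chartField hY),
      chartField_self, chartForm_self]
    exact add_comm _ _
  rw [key hX hY, key hY hX, mlieBracket_eq_lieBracket, VectorField.lieBracket,
    chartField_self, chartField_self]
  refine (extDerivOneForm_apply ξ x (X x) (Y x)).trans ?_
  have h : ∀ (φ : E →L[ℝ] ℝ) (a b : E) (p q : ℝ),
      p - q = p + φ a - (q + φ b) - φ (a - b) := by
    intro φ a b p q
    rw [map_sub]
    ring
  exact h _ _ _ _ _

/-- The coordinate fields of the trivialization at `x` are enough as test fields. They are smooth on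
the whole chart domain, so no bump function is needed. -/
theorem smoothFormAt_iff [FiniteDimensional ℝ E] {ξ : ∀ x : M, CotangentFiber E x} {x : M} :
    SmoothFormAt ξ x ↔ ∀ X : ∀ x : M, TangentSpace 𝓘(ℝ, E) x,
      ContMDiffOn 𝓘(ℝ, E) (𝓘(ℝ, E).prod 𝓘(ℝ, E)) ∞ (fun y => TotalSpace.mk' E y (X y))
        (chartAt E x).source →
      ContMDiffAt 𝓘(ℝ, E) 𝓘(ℝ, ℝ) ∞ (fun y => ξ y (X y)) x := by
  constructor
  · intro h X hX
    exact h.cotangent_apply (hX.contMDiffAt (chart_source_mem_nhds _ _))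
  intro h
  rw [SmoothFormAt, contMDiffAt_hom_bundle]
  refine ⟨contMDiffAt_id, ?_⟩
  let e := trivializationAt E (TangentSpace 𝓘(ℝ, E)) x
  have key : ∀ v : E, ContMDiffAt 𝓘(ℝ, E) 𝓘(ℝ, ℝ) ∞ (fun y => ξ y (e.symmL ℝ y v)) x := by
    intro v
    refine h (fun y => e.symmL ℝ y v) ?_
    intro y hy
    refine (e.contMDiffWithinAt_section (n := ∞) _ hy).2 ?_
    refine (contMDiffWithinAt_const (c := v)).congr_of_mem (fun z hz => ?_) hy
    have hz' : z ∈ e.baseSet := hz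
    rw [e.symmL_apply hz', e.apply_mk_symm hz']
  have := ContMDiffAt.of_clm_apply (G := ℝ) (W := E)
    (T := fun y => (show E →L[ℝ] ℝ from ξ y).comp (show E →L[ℝ] E from e.symmL ℝ y)) key
  refine this.congr_of_eventuallyEq (.of_forall fun y => ?_)
  ext v
  simp only [ContinuousLinearMap.inCoordinates]
  erw [Trivial.continuousLinearMapAt_trivialization]
  rfl

/-- The Lie derivative along `[X, Y]` is the commutator of the derivatives along `X` and `Y`. -/
theorem fieldDeriv_mlieBracket [CompleteSpace E] {g : M → ℝ}
    {X Y : ∀ x : M, TangentSpace 𝓘(ℝ, E) x} {x : M}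
    (hg : ContMDiffAt 𝓘(ℝ, E) 𝓘(ℝ, ℝ) ∞ g x)
    (hX : SmoothFieldAt X x) (hY : SmoothFieldAt Y x) :
    fieldDeriv (VectorField.mlieBracket 𝓘(ℝ, E) X Y) g x =
      fieldDeriv X (fieldDeriv Y g) x - fieldDeriv Y (fieldDeriv X g) x := by
  set c := extChartAt 𝓘(ℝ, E) x
  -- The formula in `key` is differentiated once more, so it must hold near `x`. Smoothness of order
  -- `∞` at the single point `x` gives order `1` on a neighbourhood, which suffices.
  have hg1 : ∀ᶠ y in 𝓝 x, ContMDiffAt 𝓘(ℝ, E) 𝓘(ℝ, ℝ) 1 g y :=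

    (contMDiffAt_iff_contMDiffAt_nhds (by simp)).1 (ContMDiffAt.of_le hg (by simp))
  have hg' : ContDiffAt ℝ ∞ (g ∘ c.symm) (c x) := by
    have := (contMDiffAt_iff.1 hg).2
    rwa [modelWithCornersSelf_coe, Set.range_id, contDiffWithinAt_univ] at this
  have key : ∀ {X : ∀ x : M, TangentSpace 𝓘(ℝ, E) x},
      (fieldDeriv X g) ∘ c.symm =ᶠ[𝓝 (c x)] fun y => fderiv ℝ (g ∘ c.symm) y (chartField x X y) := by
    intro X
    have hc : Filter.Tendsto c.symm (𝓝 (c x)) (𝓝 x) := by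
      have := continuousAt_extChartAt_symm (I := 𝓘(ℝ, E)) x
      rwa [ContinuousAt, extChartAt_to_inv x] at this
    filter_upwards [extChartAt_target_mem_nhds x, hc.eventually hg1] with y hy hgy
    obtain ⟨e, he⟩ := isInvertible_chartSymmDeriv hy
    have h1 : fderiv ℝ (g ∘ c.symm) y =
        (show E →L[ℝ] ℝ from funDifferential g (c.symm y)).comp (chartSymmDeriv x y) := by
      rw [← mfderiv_eq_fderiv]
      exact mfderiv_comp (I' := 𝓘(ℝ, E)) y (hgy.mdifferentiableAt (by simp))
        (mdifferentiableAt_extChartAt_symm hy)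
    rw [h1, chartField, ← he, ContinuousLinearMap.inverse_equiv]
    exact (congrArg (funDifferential g (c.symm y)) (e.apply_symm_apply _)).symm
  have key2 : ∀ {X Y : ∀ x : M, TangentSpace 𝓘(ℝ, E) x}, SmoothFieldAt Y x →
      fieldDeriv X (fieldDeriv Y g) x =
        fderiv ℝ (fun y => fderiv ℝ (g ∘ c.symm) y (chartField x Y y)) (c x) (chartField x X (c x)) := by
    intro X Y hY
    have h1 := (hg.funDifferential_apply hY).mdifferentiableAt (by simp)
    refine (congrArg (· (X x)) (funDifferential_eq_fderiv h1)).trans ?_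
    rw [chartField_self, ← key.fderiv_eq]
    rfl
  rw [key2 hX, key2 hY, ← VectorField.fderiv_apply_lieBracket hg'
    (by simpa using ENat.LEInfty.out) (differentiableAt_chartField hY)
    (differentiableAt_chartField hX), ← mlieBracket_eq_lieBracket]
  exact congrArg (· (VectorField.mlieBracket 𝓘(ℝ, E) X Y x))
    (funDifferential_eq_fderiv (hg.mdifferentiableAt (by simp)))
end

/-! ### Rules of calculus for the differential of a function. -/

section
variable {E : Type*} [NormedAddCommGroup E] [NormedSpace ℝ E]
  {M : Type*} [TopologicalSpace M] [ChartedSpace E M]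

theorem fieldDeriv_congr {X : ∀ x : M, TangentSpace 𝓘(ℝ, E) x} {g h : M → ℝ} {x : M}
    (H : g =ᶠ[𝓝 x] h) : fieldDeriv X g x = fieldDeriv X h x := by
  rw [fieldDeriv, fieldDeriv, funDifferential, funDifferential, H.mfderiv_eq]

theorem funDifferential_add {g h : M → ℝ} {x : M}
    (hg : MDifferentiableAt 𝓘(ℝ, E) 𝓘(ℝ, ℝ) g x) (hh : MDifferentiableAt 𝓘(ℝ, E) 𝓘(ℝ, ℝ) h x)
    (v : TangentSpace 𝓘(ℝ, E) x) :
    funDifferential (fun y => g y + h y) x v = funDifferential g x v + funDifferential h x v :=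
  congrArg (fun T : E →L[ℝ] ℝ => T v) (mfderiv_add hg hh)

theorem funDifferential_neg (g : M → ℝ) {x : M} (v : TangentSpace 𝓘(ℝ, E) x) :
    funDifferential (fun y => -g y) x v = -funDifferential g x v :=
  congrArg (fun T : E →L[ℝ] ℝ => T v) mfderiv_neg

theorem funDifferential_mul {g h : M → ℝ} {x : M}
    (hg : MDifferentiableAt 𝓘(ℝ, E) 𝓘(ℝ, ℝ) g x) (hh : MDifferentiableAt 𝓘(ℝ, E) 𝓘(ℝ, ℝ) h x)
    (v : TangentSpace 𝓘(ℝ, E) x) :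
    funDifferential (fun y => g y * h y) x v =
      g x * funDifferential h x v + h x * funDifferential g x v :=
  congrArg (fun T : E →L[ℝ] ℝ => T v) (hg.hasMFDerivAt.mul hh.hasMFDerivAt).mfderiv

theorem funDifferential_const (c : ℝ) {x : M} (v : TangentSpace 𝓘(ℝ, E) x) :
    funDifferential (fun _ => c) x v = 0 :=
  congrArg (fun T : E →L[ℝ] ℝ => T v) mfderiv_const

theorem funDifferential_sum {ι : Type*} (s : Finset ι) {g : ι → M → ℝ} {x : M}
    (hg : ∀ i, MDifferentiableAt 𝓘(ℝ, E) 𝓘(ℝ, ℝ) (g i) x)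
    (v : TangentSpace 𝓘(ℝ, E) x) :
    funDifferential (fun y => ∑ i ∈ s, g i y) x v = ∑ i ∈ s, funDifferential (g i) x v := by
  classical
  have key : MDifferentiableAt 𝓘(ℝ, E) 𝓘(ℝ, ℝ) (fun y => ∑ i ∈ s, g i y) x ∧
      funDifferential (fun y => ∑ i ∈ s, g i y) x v = ∑ i ∈ s, funDifferential (g i) x v := by
    induction s using Finset.induction_on with
    | empty => simpa using ⟨mdifferentiableAt_const, funDifferential_const 0 v⟩
    | insert i s hi ih =>
      simp only [Finset.sum_insert hi]
      rw [← ih.2, ← funDifferential_add (hg i) ih.1]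
      exact ⟨(hg i).add ih.1, rfl⟩
  exact key.2

theorem funDifferential_comp {EB : Type*} [NormedAddCommGroup EB] [NormedSpace ℝ EB]
    {B : Type*} [TopologicalSpace B] [ChartedSpace EB B] {f : B → M} {g : M → ℝ} {x : B}
    (hg : MDifferentiableAt 𝓘(ℝ, E) 𝓘(ℝ, ℝ) g (f x))
    (hf : MDifferentiableAt 𝓘(ℝ, EB) 𝓘(ℝ, E) f x) (v : TangentSpace 𝓘(ℝ, EB) x) :
    funDifferential (fun y => g (f y)) x v =
      funDifferential g (f x) (mfderiv 𝓘(ℝ, EB) 𝓘(ℝ, E) f x v) :=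
  congrArg (fun T : EB →L[ℝ] ℝ => T v) (mfderiv_comp x hg hf)

end

/-! ### Smooth sections of products and pullbacks, and bump functions. -/

section Product

variable {E : Type*} [NormedAddCommGroup E] [NormedSpace ℝ E]
  {M : Type*} [TopologicalSpace M] [ChartedSpace E M]
  {F : Type*} [NormedAddCommGroup F] [NormedSpace ℝ F]
  {V : M → Type*} [TopologicalSpace (TotalSpace F V)]
  [∀ x, AddCommGroup (V x)] [∀ x, Module ℝ (V x)] [∀ x, TopologicalSpace (V x)]
  [FiberBundle F V] [VectorBundle ℝ F V]
  {F' : Type*} [NormedAddCommGroup F'] [NormedSpace ℝ F']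
  {V' : M → Type*} [TopologicalSpace (TotalSpace F' V')]
  [∀ x, AddCommGroup (V' x)] [∀ x, Module ℝ (V' x)] [∀ x, TopologicalSpace (V' x)]
  [FiberBundle F' V'] [VectorBundle ℝ F' V']

theorem contMDiffAt_prod_section_iff {s : ∀ x, V x × V' x} {x : M} :
    ContMDiffAt 𝓘(ℝ, E) (𝓘(ℝ, E).prod 𝓘(ℝ, F × F')) ∞
      (fun y => TotalSpace.mk' (F × F') (E := fun y => V y × V' y) y (s y)) x ↔
    ContMDiffAt 𝓘(ℝ, E) (𝓘(ℝ, E).prod 𝓘(ℝ, F)) ∞ (fun y => TotalSpace.mk' F y (s y).1) x ∧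
    ContMDiffAt 𝓘(ℝ, E) (𝓘(ℝ, E).prod 𝓘(ℝ, F')) ∞ (fun y => TotalSpace.mk' F' y (s y).2) x := by
  rw [contMDiffAt_section, contMDiffAt_section, contMDiffAt_section]
  exact contMDiffAt_prod_module_iff _

/-- The family `s` of vectors `s x ∈ V (f x)` is a smooth section of the pullback bundle iff it
is smooth as a map into the total space of `V`. -/
theorem contMDiffAt_pullback_section_iff {EB : Type*} [NormedAddCommGroup EB] [NormedSpace ℝ EB]
    {B : Type*} [TopologicalSpace B] [ChartedSpace EB B] (f : C^∞⟮𝓘(ℝ, EB), B; 𝓘(ℝ, E), M⟯)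
    {s : ∀ x, ((f : B → M) *ᵖ V) x} {x : B} :
    ContMDiffAt 𝓘(ℝ, EB) (𝓘(ℝ, EB).prod 𝓘(ℝ, F)) ∞
      (fun y => TotalSpace.mk' F (E := (f : B → M) *ᵖ V) y (s y)) x ↔
    ContMDiffAt 𝓘(ℝ, EB) (𝓘(ℝ, E).prod 𝓘(ℝ, F)) ∞
      (fun y => TotalSpace.mk' F (E := V) (f y) (s y)) x := by
  refine (contMDiffAt_section (E := (f : B → M) *ᵖ V) x).trans ?_
  rw [contMDiffAt_totalSpace]
  exact ⟨fun h => ⟨f.contMDiff.contMDiffAt, h⟩, fun h => h.2⟩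

variable (E) in
theorem exists_bump [FiniteDimensional ℝ E] [T2Space M] [IsManifold 𝓘(ℝ, E) ∞ M]
    {U : Set M} {x : M} (hU : U ∈ 𝓝 x) :
    ∃ g : C^∞⟮𝓘(ℝ, E), M; 𝓘(ℝ, ℝ), ℝ⟯, (∀ᶠ y in 𝓝 x, g y = 1) ∧ tsupport g ⊆ U := by
  obtain ⟨b, -, hb⟩ := (SmoothBumpFunction.nhds_basis_tsupport (I := 𝓘(ℝ, E)) x).mem_iff.1 hU
  exact ⟨⟨b, b.contMDiff⟩, b.eventuallyEq_one, hb⟩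

end Product

/-- The Lie bracket lemmas ask for regularity `minSmoothness ℝ n`, which over `ℝ` is just `n`; this
instance and the next supply `n = 2` and `n = 3`. -/
theorem isManifold_minSmoothness_two {E : Type*} [NormedAddCommGroup E] [NormedSpace ℝ E]
    {M : Type*} [TopologicalSpace M] [ChartedSpace E M] [IsManifold 𝓘(ℝ, E) ∞ M] :
    IsManifold 𝓘(ℝ, E) (minSmoothness ℝ 2) M := by
  rw [minSmoothness_of_isRCLikeNormedField]
  infer_instance

theorem isManifold_minSmoothness_three {E : Type*} [NormedAddCommGroup E] [NormedSpace ℝ E]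
    {M : Type*} [TopologicalSpace M] [ChartedSpace E M] [IsManifold 𝓘(ℝ, E) ∞ M] :
    IsManifold 𝓘(ℝ, E) (minSmoothness ℝ 3) M := by
  rw [minSmoothness_of_isRCLikeNormedField]
  exact .of_le (n := ∞) ENat.LEInfty.out

attribute [local instance] isManifold_minSmoothness_two isManifold_minSmoothness_three

/-! ### The Courant bracket tested on vector fields. -/

section Courant

variable {E : Type*} [NormedAddCommGroup E] [NormedSpace ℝ E] [FiniteDimensional ℝ E]
  {M : Type*} [TopologicalSpace M] [ChartedSpace E M] [IsManifold 𝓘(ℝ, E) ∞ M]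

/-- The section `σ` of `TM ⊕ T^*M` is smooth at `x`. -/
abbrev SmoothGenAt (σ : ∀ x : M, GenTangent E x) (x : M) : Prop :=
  ContMDiffAt 𝓘(ℝ, E) (𝓘(ℝ, E).prod 𝓘(ℝ, E × (E →L[ℝ] ℝ))) ∞
    (fun y => TotalSpace.mk' (E × (E →L[ℝ] ℝ)) (E := fun y : M => GenTangent E y) y (σ y)) x

theorem smoothGenAt_iff {σ : ∀ x : M, GenTangent E x} {x : M} :
    SmoothGenAt σ x ↔ SmoothFieldAt (fun y => (σ y).1) x ∧ SmoothFormAt (fun y => (σ y).2) x :=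
  contMDiffAt_prod_section_iff

theorem SmoothFieldAt.mlieBracket {X Y : ∀ x : M, TangentSpace 𝓘(ℝ, E) x} {x : M}
    (hX : SmoothFieldAt X x) (hY : SmoothFieldAt Y x) :
    SmoothFieldAt (VectorField.mlieBracket 𝓘(ℝ, E) X Y) x :=
  have : IsManifold 𝓘(ℝ, E) (((⊤ : ℕ∞) : ℕ∞ω) + 1) M := inferInstanceAs (IsManifold 𝓘(ℝ, E) ∞ M)
  ContMDiffAt.mlieBracket_vectorField (m := ⊤) (n := ⊤) hX hY (by simp)

theorem lieDerivOneForm_apply {X W : ∀ x : M, TangentSpace 𝓘(ℝ, E) x}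
    {ξ : ∀ x : M, CotangentFiber E x} {x : M} (hX : SmoothFieldAt X x) (hξ : SmoothFormAt ξ x)
    (hW : SmoothFieldAt W x) :
    lieDerivOneForm X ξ x (W x) =
      fieldDeriv X (fun y => ξ y (W y)) x - ξ x (VectorField.mlieBracket 𝓘(ℝ, E) X W x) := by
  have : lieDerivOneForm X ξ x (W x) =
    extDerivOneForm ξ x (X x) (W x) + fieldDeriv W (fun y => ξ y (X y)) x := rfl
  rw [this, extDerivOneForm_apply_fields hξ hX hW]
  ring

/-- From here on charts can be avoided when computing with the covector part: it is expressed
through derivatives of functions along fields and Lie brackets only. -/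
theorem courantBracket_snd_apply {σ τ : ∀ x : M, GenTangent E x}
    {W : ∀ x : M, TangentSpace 𝓘(ℝ, E) x} {x : M}
    (hσ : SmoothGenAt σ x) (hτ : SmoothGenAt τ x) (hW : SmoothFieldAt W x) :
    (courantBracket σ τ x).2 (W x) =
      fieldDeriv (fun y => (σ y).1) (fun y => (τ y).2 (W y)) x -
        (τ x).2 (VectorField.mlieBracket 𝓘(ℝ, E) (fun y => (σ y).1) W x) -
      fieldDeriv (fun y => (τ y).1) (fun y => (σ y).2 (W y)) x +
        (σ x).2 (VectorField.mlieBracket 𝓘(ℝ, E) (fun y => (τ y).1) W x) +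
      fieldDeriv W (fun y => (σ y).2 (τ y).1) x := by
  obtain ⟨hX, hξ⟩ := smoothGenAt_iff.1 hσ
  obtain ⟨hY, hη⟩ := smoothGenAt_iff.1 hτ
  have : (courantBracket σ τ x).2 (W x) =
    lieDerivOneForm (fun y => (σ y).1) (fun y => (τ y).2) x (W x) -
      extDerivOneForm (fun y => (σ y).2) x (τ x).1 (W x) := rfl
  rw [this, lieDerivOneForm_apply hX hη hW, extDerivOneForm_apply_fields hξ hY hW]
  ring

/-- Tested on a field, the covector part is a sum of five smooth functions. The formula giving this
sum must hold near `x`, hence smoothness is assumed on a neighbourhood. -/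
theorem SmoothGenAt.courantBracket {σ τ : ∀ x : M, GenTangent E x} {x : M}
    (hσ : ∀ᶠ y in 𝓝 x, SmoothGenAt σ y) (hτ : ∀ᶠ y in 𝓝 x, SmoothGenAt τ y) :
    SmoothGenAt (courantBracket σ τ) x := by
  obtain ⟨hX, hξ⟩ := smoothGenAt_iff.1 hσ.self_of_nhds
  obtain ⟨hY, hη⟩ := smoothGenAt_iff.1 hτ.self_of_nhds
  refine smoothGenAt_iff.2 ⟨hX.mlieBracket hY, smoothFormAt_iff.2 fun W hW => ?_⟩
  have hWx : SmoothFieldAt W x := hW.contMDiffAt (chart_source_mem_nhds _ _)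
  refine ContMDiffAt.congr_of_eventuallyEq
    (((((hη.cotangent_apply hWx).funDifferential_apply hX).sub
    (hη.cotangent_apply (hX.mlieBracket hWx))).sub
    ((hξ.cotangent_apply hWx).funDifferential_apply hY)).add
      (hξ.cotangent_apply (hY.mlieBracket hWx)) |>.add
      ((hξ.cotangent_apply hY).funDifferential_apply hWx)) ?_
  filter_upwards [hσ, hτ, (chartAt E x).open_source.mem_nhds (mem_chart_source E x)] with y h1 h2 h3
  exact courantBracket_snd_apply h1 h2 (hW.contMDiffAt ((chartAt E x).open_source.mem_nhds h3))

theorem smoothGenAt_section {L : ∀ x : M, Submodule ℝ (GenTangent E x)}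
    (σ : SubbundleSection E (E × (E →L[ℝ] ℝ)) L) (x : M) : SmoothGenAt (fun y => σ.1 y) x :=
  σ.1.contMDiff x

end Courant

/-! ### The Jacobi identity for the Courant bracket, as algebra. -/

section Jacobi

variable {𝔤 C : Type*} [LieRing 𝔤] [AddCommGroup C] [LieRingModule 𝔤 C]

/-- The `1`-form part of the Courant bracket in terms of the action of the Lie algebra `𝔤` of
vector fields on the functions `C`. -/
def dorfman (X : 𝔤) (α : 𝔤 → C) (Y : 𝔤) (β : 𝔤 → C) (W : 𝔤) : C :=
  ⁅X, β W⁆ - β ⁅X, W⁆ - ⁅Y, α W⁆ + α ⁅Y, W⁆ + ⁅W, α Y⁆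

/-- Expanding everything with the Lie module law makes all terms cancel. Only additivity of the
forms is used, not linearity over functions, so an abstract Lie ring acting on an abelian group
suffices; isotropy plays no role. -/
theorem dorfman_jacobi (X Y Z : 𝔤) (α β γ : 𝔤 →+ C) (W : 𝔤) :
    dorfman X α ⁅Y, Z⁆ (dorfman Y β Z γ) W =
      dorfman ⁅X, Y⁆ (dorfman X α Y β) Z γ W + dorfman Y β ⁅X, Z⁆ (dorfman X α Z γ) W := by
  simp only [dorfman, lie_add, lie_sub, lie_lie, map_sub]
  abel

end Jacobi

/-! ### Leibniz rule, additivity, skew-symmetry and locality of the Courant bracket. -/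

section Bilinear

variable {E : Type*} [NormedAddCommGroup E] [NormedSpace ℝ E] [FiniteDimensional ℝ E]
  {M : Type*} [TopologicalSpace M] [ChartedSpace E M] [IsManifold 𝓘(ℝ, E) ∞ M]

theorem SmoothFieldAt.mdifferentiableAt {X : ∀ x : M, TangentSpace 𝓘(ℝ, E) x} {x : M}
    (h : SmoothFieldAt X x) :
    MDifferentiableAt 𝓘(ℝ, E) (𝓘(ℝ, E).prod 𝓘(ℝ, E)) (fun y => TotalSpace.mk' E y (X y)) x :=
  ContMDiffAt.mdifferentiableAt h (by simp)

theorem mlieBracket_funSmul_right {g : M → ℝ} {X Y : ∀ x : M, TangentSpace 𝓘(ℝ, E) x} {x : M}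
    (hg : MDifferentiableAt 𝓘(ℝ, E) 𝓘(ℝ, ℝ) g x) (hY : SmoothFieldAt Y x) :
    VectorField.mlieBracket 𝓘(ℝ, E) X (fun y => g y • Y y) x =
      fieldDeriv X g x • Y x + g x • VectorField.mlieBracket 𝓘(ℝ, E) X Y x :=
  VectorField.mlieBracket_smul_right hg hY.mdifferentiableAt

theorem mlieBracket_funSmul_left {g : M → ℝ} {X Y : ∀ x : M, TangentSpace 𝓘(ℝ, E) x} {x : M}
    (hg : MDifferentiableAt 𝓘(ℝ, E) 𝓘(ℝ, ℝ) g x) (hX : SmoothFieldAt X x) :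
    VectorField.mlieBracket 𝓘(ℝ, E) (fun y => g y • X y) Y x =
      -fieldDeriv Y g x • X x + g x • VectorField.mlieBracket 𝓘(ℝ, E) X Y x :=
  VectorField.mlieBracket_smul_left hg hX.mdifferentiableAt

/-- Reduces an identity of covectors to smooth test fields, which is the form in which
`courantBracket_snd_apply` can be applied. -/
theorem genTangent_ext {x : M} {p q : GenTangent E x} (h1 : p.1 = q.1)
    (h2 : ∀ W : ∀ x : M, TangentSpace 𝓘(ℝ, E) x, SmoothFieldAt W x → p.2 (W x) = q.2 (W x)) :
    p = q := by
  refine Prod.ext h1 (VectorBundle.injective_eval_contMDiffAt_sec 𝓘(ℝ, E) E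
    (TangentSpace 𝓘(ℝ, E)) (n := ∞) _ x ?_)
  funext W hW
  exact h2 W hW

variable {σ σ' τ τ' : ∀ x : M, GenTangent E x} {x : M}

/-- Write `σ = (X, ξ)` and `τ = (Y, η)`. The only derivatives of `g` along the test field `W` are
`-W(g) ξ(Y)`, from `ξ([gY, W])`, and `W(g) ξ(Y)`, from `W(ξ(gY))`; they cancel, and what remains is
the Leibniz rule. -/
theorem courantBracket_funSmul_right {g : M → ℝ} (hg : ContMDiffAt 𝓘(ℝ, E) 𝓘(ℝ, ℝ) ∞ g x)
    (hσ : SmoothGenAt σ x) (hτ : SmoothGenAt τ x) :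
    courantBracket σ (fun y => g y • τ y) x =
      funDifferential g x (σ x).1 • τ x + g x • courantBracket σ τ x := by
  have hg' := hg.mdifferentiableAt (by simp)
  obtain ⟨hX, hξ⟩ := smoothGenAt_iff.1 hσ
  obtain ⟨hY, hη⟩ := smoothGenAt_iff.1 hτ
  refine genTangent_ext (mlieBracket_funSmul_right hg' hY) fun W hW => ?_
  have hgτ : SmoothGenAt (fun y => g y • τ y) x := hg.smul_section hτ
  refine (courantBracket_snd_apply hσ hgτ hW).trans ?_
  simp only [Prod.smul_fst, Prod.smul_snd]
  rw [mlieBracket_funSmul_left hg' hY]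
  have e1 := courantBracket_snd_apply hσ hτ hW
  have e2 : (funDifferential g x (σ x).1 • τ x + g x • courantBracket σ τ x).2 (W x) =
    funDifferential g x (σ x).1 * (τ x).2 (W x) + g x * (courantBracket σ τ x).2 (W x) := rfl
  have e3 := funDifferential_mul hg' ((hη.cotangent_apply hW).mdifferentiableAt (by simp)) (σ x).1
  have e4 := funDifferential_mul hg' ((hξ.cotangent_apply hY).mdifferentiableAt (by simp)) (W x)
  have e5 : fieldDeriv (fun y => g y • (τ y).1) (fun y => (σ y).2 (W y)) x =
    g x * fieldDeriv (fun y => (τ y).1) (fun y => (σ y).2 (W y)) x :=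
     (funDifferential (fun y => (σ y).2 (W y)) x).map_smul _ _
  have e6 : fieldDeriv (fun y => (σ y).1) (fun y => (g y • (τ y).2) (W y)) x =
    funDifferential (fun y => g y * (τ y).2 (W y)) x (σ x).1 := rfl
  have e7 : fieldDeriv W (fun y => (σ y).2 (g y • (τ y).1)) x =
    funDifferential (fun y => g y * (σ y).2 (τ y).1) x (W x) :=
    fieldDeriv_congr (.of_forall fun y => ((σ y).2).map_smul _ _)
  rw [e2, e1, e5, e6, e7, e3, e4, map_add, map_smul, map_smul]
  simp only [smul_eq_mul, smul_apply]
  ring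

theorem courantBracket_add_right
    (hσ : SmoothGenAt σ x) (hτ : SmoothGenAt τ x) (hτ' : SmoothGenAt τ' x) :
    courantBracket σ (fun y => τ y + τ' y) x =
      courantBracket σ τ x + courantBracket σ τ' x := by
  obtain ⟨hX, hξ⟩ := smoothGenAt_iff.1 hσ
  obtain ⟨hY, hη⟩ := smoothGenAt_iff.1 hτ
  obtain ⟨hY', hη'⟩ := smoothGenAt_iff.1 hτ'
  refine genTangent_ext (VectorField.mlieBracket_add_right hY.mdifferentiableAt
    hY'.mdifferentiableAt) fun W hW => ?_
  have ht : SmoothGenAt (fun y => τ y + τ' y) x := hτ.add_section hτ'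
  refine (courantBracket_snd_apply hσ ht hW).trans ?_
  have e1 := courantBracket_snd_apply hσ hτ hW
  have e1' := courantBracket_snd_apply hσ hτ' hW
  have e2 : (courantBracket σ τ x + courantBracket σ τ' x).2 (W x) =
    (courantBracket σ τ x).2 (W x) + (courantBracket σ τ' x).2 (W x) := rfl
  have e3 := funDifferential_add ((hη.cotangent_apply hW).mdifferentiableAt (by simp))
    ((hη'.cotangent_apply hW).mdifferentiableAt (by simp)) (σ x).1
  have e4 := funDifferential_add ((hξ.cotangent_apply hY).mdifferentiableAt (by simp))
    ((hξ.cotangent_apply hY').mdifferentiableAt (by simp)) (W x)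
  have e5 := (funDifferential (fun y => (σ y).2 (W y)) x).map_add (τ x).1 (τ' x).1
  have e6 : fieldDeriv (fun y => (σ y).1) (fun y => (τ y + τ' y).2 (W y)) x =
    funDifferential (fun y => (τ y).2 (W y) + (τ' y).2 (W y)) x (σ x).1 := rfl
  have e7 : fieldDeriv W (fun y => (σ y).2 (τ y + τ' y).1) x =
    funDifferential (fun y => (σ y).2 (τ y).1 + (σ y).2 (τ' y).1) x (W x) :=
    fieldDeriv_congr (.of_forall fun y => ((σ y).2).map_add _ _)
  have e8 := VectorField.mlieBracket_add_left (W := W) hY.mdifferentiableAt hY'.mdifferentiableAt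
  have e9 : (τ x + τ' x).2 (VectorField.mlieBracket 𝓘(ℝ, E) (fun y => (σ y).1) W x) =
    (τ x).2 (VectorField.mlieBracket 𝓘(ℝ, E) (fun y => (σ y).1) W x) +
    (τ' x).2 (VectorField.mlieBracket 𝓘(ℝ, E) (fun y => (σ y).1) W x) := rfl
  have e10 := (σ x).2.map_add (VectorField.mlieBracket 𝓘(ℝ, E) (fun y => (τ y).1) W x)
    (VectorField.mlieBracket 𝓘(ℝ, E) (fun y => (τ' y).1) W x)
  rw [e2, e1, e1', e6, e7, e3, e4, e9]
  erw [e8, e10]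
  have e11 : fieldDeriv (fun y => (τ y + τ' y).1) (fun y => (σ y).2 (W y)) x =
    fieldDeriv (fun y => (τ y).1) (fun y => (σ y).2 (W y)) x +
     fieldDeriv (fun y => (τ' y).1) (fun y => (σ y).2 (W y)) x := e5
  rw [e11]
  ring

/-- The symmetric part of the bracket is `(0, d⟨σ, τ⟩)`, and the differential of a function
vanishing near `x` is zero at `x`. -/
theorem courantBracket_swap (hσ : SmoothGenAt σ x) (hτ : SmoothGenAt τ x)
    (h : ∀ᶠ y in 𝓝 x, genPairing (σ y) (τ y) = 0) :
    courantBracket τ σ x = -courantBracket σ τ x := by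
  obtain ⟨hX, hξ⟩ := smoothGenAt_iff.1 hσ
  obtain ⟨hY, hη⟩ := smoothGenAt_iff.1 hτ
  refine genTangent_ext VectorField.mlieBracket_swap_apply fun W hW => ?_
  refine (courantBracket_snd_apply hτ hσ hW).trans ?_
  have e1 := courantBracket_snd_apply hσ hτ hW
  have e2 : (-courantBracket σ τ x).2 (W x) = -(courantBracket σ τ x).2 (W x) := rfl
  have e3 : fieldDeriv W (fun y => (τ y).2 (σ y).1) x =
      - fieldDeriv W (fun y => (σ y).2 (τ y).1) x := by
    rw [← funDifferential_neg]
    refine fieldDeriv_congr ?_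
    filter_upwards [h] with y hy
    exact eq_neg_of_add_eq_zero_left hy
  rw [e2, e1, e3]
  ring

theorem courantBracket_self (hσ : SmoothGenAt σ x) (h : ∀ᶠ y in 𝓝 x, genPairing (σ y) (σ y) = 0) :
    courantBracket σ σ x = 0 := by
  have h1 := courantBracket_swap hσ hσ h
  have h2 : (2 : ℝ) • courantBracket σ σ x = 0 := by
    rw [two_smul]
    nth_rewrite 1 [h1]
    exact neg_add_cancel _
  rw [← inv_smul_smul₀ (two_ne_zero' ℝ) (courantBracket σ σ x), h2, smul_zero]

theorem extDerivOneForm_congr {ξ ξ' : ∀ x : M, CotangentFiber E x} {x : M}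
    (h : ∀ᶠ y in 𝓝 x, ξ y = ξ' y) : extDerivOneForm ξ x = extDerivOneForm ξ' x := by
  have hc : Filter.Tendsto (extChartAt 𝓘(ℝ, E) x).symm (𝓝 (extChartAt 𝓘(ℝ, E) x x)) (𝓝 x) := by
    have := continuousAt_extChartAt_symm (I := 𝓘(ℝ, E)) x
    rwa [ContinuousAt, extChartAt_to_inv x] at this
  have h1 : chartForm x ξ =ᶠ[𝓝 (extChartAt 𝓘(ℝ, E) x x)] chartForm x ξ' := by
    filter_upwards [hc.eventually h] with y hy
    rw [chartForm, chartForm, hy]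
  have h2 : ∀ u v : E, (extDerivOneForm ξ x : E →L[ℝ] E →L[ℝ] ℝ) u v =
      (extDerivOneForm ξ' x : E →L[ℝ] E →L[ℝ] ℝ) u v := fun u v => by
    refine (extDerivOneForm_apply ξ x u v).trans (Eq.trans ?_ (extDerivOneForm_apply ξ' x u v).symm)
    rw [h1.fderiv_eq]
  exact ContinuousLinearMap.ext fun u => ContinuousLinearMap.ext fun v => h2 u v

end Bilinear

/-! ### Extension of local data by bump functions. -/

section Extension

variable {E : Type*} [NormedAddCommGroup E] [NormedSpace ℝ E] [FiniteDimensional ℝ E]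
  {M : Type*} [TopologicalSpace M] [ChartedSpace E M] [IsManifold 𝓘(ℝ, E) ∞ M] [T2Space M]
  {F : Type*} [NormedAddCommGroup F] [NormedSpace ℝ F]
  {V : M → Type*} [TopologicalSpace (TotalSpace F V)]
  [∀ x, AddCommGroup (V x)] [∀ x, Module ℝ (V x)] [∀ x, TopologicalSpace (V x)]
  [FiberBundle F V] [VectorBundle ℝ F V]

/-- A local section multiplied by a bump function is a global section. -/
theorem exists_bump_smul {U : Set M} (hU : IsOpen U) {x : M} (hx : x ∈ U) :
    ∃ g : C^∞⟮𝓘(ℝ, E), M; 𝓘(ℝ, ℝ), ℝ⟯, (∀ᶠ y in 𝓝 x, g y = 1) ∧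
      (∀ h : M → ℝ, ContMDiffOn 𝓘(ℝ, E) 𝓘(ℝ, ℝ) ∞ h U →
        ContMDiff 𝓘(ℝ, E) 𝓘(ℝ, ℝ) ∞ fun y => g y * h y) ∧
      ∀ s : ∀ y, V y,
        ContMDiffOn 𝓘(ℝ, E) (𝓘(ℝ, E).prod 𝓘(ℝ, F)) ∞ (fun y => TotalSpace.mk' F y (s y)) U →
        ContMDiff 𝓘(ℝ, E) (𝓘(ℝ, E).prod 𝓘(ℝ, F)) ∞ fun y => TotalSpace.mk' F y (g y • s y) := by
  obtain ⟨g, hg, hgU⟩ := exists_bump E (hU.mem_nhds hx)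
  refine ⟨g, hg, fun h hh => ?_, fun s hs =>
    ContMDiffOn.smul_section_of_tsupport g.contMDiff.contMDiffOn hU hgU hs⟩
  refine contMDiff_of_tsupport fun y hy => ?_
  have : y ∈ U := hgU (tsupport_mul_subset_left hy)
  exact g.contMDiff.contMDiffAt.mul (hh.contMDiffAt (hU.mem_nhds this))

variable [ContMDiffVectorBundle ∞ F V 𝓘(ℝ, E)]

theorem exists_section_apply_eq {x : M} (v : V x) : ∃ s : Cₛ^∞⟮𝓘(ℝ, E); F, V⟯, s x = v := by
  obtain ⟨u, hu, hs⟩ := FiberBundle.exists_contMDiffOn_extend (k := ∞) 𝓘(ℝ, E) F v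
  obtain ⟨U, hUu, hU, hx⟩ := mem_nhds_iff.1 hu
  obtain ⟨g, hg, -, h⟩ := exists_bump_smul (E := E) (F := F) (V := V) hU hx
  refine ⟨⟨_, h _ (hs.mono hUu)⟩, ?_⟩
  have : g x • FiberBundle.extend F v x = v := by simp [hg.self_of_nhds]
  exact this

end Extension

/-! ### Vector fields as a Lie ring acting on smooth functions, and the Jacobi identity. -/

section LieRing

variable {E : Type*} [NormedAddCommGroup E] [NormedSpace ℝ E] [FiniteDimensional ℝ E]
  {M : Type*} [TopologicalSpace M] [ChartedSpace E M] [IsManifold 𝓘(ℝ, E) ∞ M]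

variable (E M) in
/-- Smooth vector fields. -/
abbrev SmoothField := Cₛ^∞⟮𝓘(ℝ, E); E, fun x : M => TangentSpace 𝓘(ℝ, E) x⟯

instance : LieRing (SmoothField E M) where
  bracket X Y := ⟨VectorField.mlieBracket 𝓘(ℝ, E) X Y, fun x =>
    SmoothFieldAt.mlieBracket (X.contMDiff x) (Y.contMDiff x)⟩
  add_lie X Y Z := ContMDiffSection.ext fun _ =>
    VectorField.mlieBracket_add_left X.mdifferentiableAt Y.mdifferentiableAt
  lie_add X Y Z := ContMDiffSection.ext fun _ =>
    VectorField.mlieBracket_add_right Y.mdifferentiableAt Z.mdifferentiableAt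
  lie_self X := ContMDiffSection.ext fun _ => by
    exact congrFun VectorField.mlieBracket_self _
  leibniz_lie X Y Z := ContMDiffSection.ext fun x =>
    VectorField.leibniz_identity_mlieBracket_apply
      ((X.contMDiff x).of_le (by simpa using ENat.LEInfty.out))
      ((Y.contMDiff x).of_le (by simpa using ENat.LEInfty.out))
      ((Z.contMDiff x).of_le (by simpa using ENat.LEInfty.out))

/-- The module law is `fieldDeriv_mlieBracket`. With this structure `dorfman_jacobi` applies to
actual sections. -/
instance : LieRingModule (SmoothField E M) C^∞⟮𝓘(ℝ, E), M; 𝓘(ℝ, ℝ), ℝ⟯ where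
  bracket X g := ⟨fieldDeriv X g, fun x =>
    ContMDiffAt.funDifferential_apply g.contMDiff.contMDiffAt (X.contMDiff x)⟩
  add_lie X Y g := ContMDiffMap.ext fun x => (funDifferential g x).map_add _ _
  lie_add X g h := ContMDiffMap.ext fun x =>
    funDifferential_add g.mdifferentiableAt h.mdifferentiableAt (X x)
  leibniz_lie X Y g := ContMDiffMap.ext fun x => by
    have := fieldDeriv_mlieBracket g.contMDiff.contMDiffAt (X.contMDiff x) (Y.contMDiff x)
    exact (add_eq_of_eq_sub this).symm

/-- The pairing of a section of `TM ⊕ T^*M` with vector fields. -/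
def formPairing (σ : ∀ x : M, GenTangent E x) (hσ : ∀ x, SmoothGenAt σ x) :
    SmoothField E M →+ C^∞⟮𝓘(ℝ, E), M; 𝓘(ℝ, ℝ), ℝ⟯ where
  toFun W := ⟨fun x => (σ x).2 (W x), fun x =>
    (smoothGenAt_iff.1 (hσ x)).2.cotangent_apply (W.contMDiff x)⟩
  map_zero' := ContMDiffMap.ext fun x => (σ x).2.map_zero
  map_add' _ _ := ContMDiffMap.ext fun x => (σ x).2.map_add _ _

variable {σ τ υ : ∀ x : M, GenTangent E x}

theorem contMDiff_courantBracket (hσ : ∀ x, SmoothGenAt σ x) (hτ : ∀ x, SmoothGenAt τ x) (x : M) :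
    SmoothGenAt (courantBracket σ τ) x :=
  SmoothGenAt.courantBracket (.of_forall hσ) (.of_forall hτ)

/-- The vector field underlying a section of `TM ⊕ T^*M`. -/
def genField (σ : ∀ x : M, GenTangent E x) (hσ : ∀ x, SmoothGenAt σ x) : SmoothField E M :=
  ⟨fun x => (σ x).1, fun x => (smoothGenAt_iff.1 (hσ x)).1⟩

theorem formPairing_courantBracket (hσ : ∀ x, SmoothGenAt σ x) (hτ : ∀ x, SmoothGenAt τ x) :
    ⇑(formPairing (courantBracket σ τ) (contMDiff_courantBracket hσ hτ)) =
      dorfman (genField σ hσ) (formPairing σ hσ) (genField τ hτ) (formPairing τ hτ) := by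
  funext W
  refine ContMDiffMap.ext fun x => ?_
  exact courantBracket_snd_apply (hσ x) (hτ x) (W.contMDiff x)

/-- The vector part is the Jacobi identity of fields. For the covector part a tangent vector is
extended to a global field, which serves as the test argument in `dorfman_jacobi`. -/
theorem courantBracket_jacobi [T2Space M]
    (hσ : ∀ x, SmoothGenAt σ x) (hτ : ∀ x, SmoothGenAt τ x) (hυ : ∀ x, SmoothGenAt υ x) (x : M) :
    courantBracket σ (courantBracket τ υ) x =
      courantBracket (courantBracket σ τ) υ x + courantBracket τ (courantBracket σ υ) x := by
  have hστ := contMDiff_courantBracket hσ hτ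
  have hτυ := contMDiff_courantBracket hτ hυ
  have hσυ := contMDiff_courantBracket hσ hυ
  have h1 := leibniz_lie (genField σ hσ) (genField τ hτ) (genField υ hυ)
  refine Prod.ext (congrArg (fun X : SmoothField E M => X x) h1)
    (ContinuousLinearMap.ext fun v => ?_)
  obtain ⟨W, rfl⟩ := exists_section_apply_eq (E := E) (F := E) v
  have h2 := dorfman_jacobi (genField σ hσ) (genField τ hτ) (genField υ hυ) (formPairing σ hσ)
    (formPairing τ hτ) (formPairing υ hυ) W
  rw [← formPairing_courantBracket, ← formPairing_courantBracket,
    ← formPairing_courantBracket] at h2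
  have h3 := (congrFun (formPairing_courantBracket hσ hτυ) W).trans
    (h2.trans (congrArg₂ (· + ·) (congrFun (formPairing_courantBracket hστ hυ) W).symm
      (congrFun (formPairing_courantBracket hτ hσυ) W).symm))
  exact congrArg (fun g : C^∞⟮𝓘(ℝ, E), M; 𝓘(ℝ, ℝ), ℝ⟯ => g x) h3

end LieRing

/-! ### The Lie algebroid underlying a Dirac structure. -/

section DiracAlgebroid

variable {E : Type*} [NormedAddCommGroup E] [NormedSpace ℝ E] [FiniteDimensional ℝ E]
  {M : Type*} [TopologicalSpace M] [ChartedSpace E M] [IsManifold 𝓘(ℝ, E) ∞ M]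
  {L : ∀ x : M, Submodule ℝ (GenTangent E x)}

theorem isSmoothBundleMap_diracAnchor :
    IsSmoothBundleMap (V' := fun x : M => TangentSpace 𝓘(ℝ, E) x) E (E × (E →L[ℝ] ℝ)) E
      (diracAnchor L) := fun _ _ hU h _ hx =>
  (smoothGenAt_iff.1 (h.contMDiffAt (hU.mem_nhds hx))).1.contMDiffWithinAt

theorem IsDirac.genPairing_eq_zero (hL : IsDirac E L)
    (σ τ : SubbundleSection E (E × (E →L[ℝ] ℝ)) L) (x : M) :
    genPairing (σ.1 x) (τ.1 x) = 0 :=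
  (hL.maximal_isotropic x).1 _ (σ.2 x) _ (τ.2 x)

/-- The Courant bracket of two sections of a Dirac structure. -/
def IsDirac.bracket (hL : IsDirac E L) (σ τ : SubbundleSection E (E × (E →L[ℝ] ℝ)) L) :
    SubbundleSection E (E × (E →L[ℝ] ℝ)) L :=
  ⟨⟨courantBracket (fun y => σ.1 y) (fun y => τ.1 y),
    contMDiff_courantBracket (smoothGenAt_section σ) (smoothGenAt_section τ)⟩, hL.involutive σ τ⟩

theorem SubbundleSection.ext_apply {E : Type*} [NormedAddCommGroup E] [NormedSpace ℝ E]
    {M : Type*} [TopologicalSpace M] [ChartedSpace E M]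
    {F : Type*} [NormedAddCommGroup F] [NormedSpace ℝ F]
    {V : M → Type*} [TopologicalSpace (TotalSpace F V)]
    [∀ x, AddCommGroup (V x)] [∀ x, Module ℝ (V x)] [∀ x, TopologicalSpace (V x)]
    [FiberBundle F V] [VectorBundle ℝ F V] {S : ∀ x, Submodule ℝ (V x)}
    {σ τ : SubbundleSection E F S} (h : ∀ x, σ.1 x = τ.1 x) : σ = τ :=
  Subtype.ext (ContMDiffSection.ext h)

theorem IsDirac.bracket_swap (hL : IsDirac E L)
    (σ τ : SubbundleSection E (E × (E →L[ℝ] ℝ)) L) : hL.bracket τ σ = -hL.bracket σ τ :=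
  SubbundleSection.ext_apply fun x => courantBracket_swap (smoothGenAt_section σ x)
    (smoothGenAt_section τ x)
    (.of_forall (hL.genPairing_eq_zero σ τ))

theorem IsDirac.bracket_add_right (hL : IsDirac E L)
    (σ τ τ' : SubbundleSection E (E × (E →L[ℝ] ℝ)) L) :
    hL.bracket σ (τ + τ') = hL.bracket σ τ + hL.bracket σ τ' :=
  SubbundleSection.ext_apply fun x =>
    courantBracket_add_right (smoothGenAt_section σ x) (smoothGenAt_section τ x)
      (smoothGenAt_section τ' x)

theorem IsDirac.bracket_smul_right (hL : IsDirac E L) (c : ℝ)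
    (σ τ : SubbundleSection E (E × (E →L[ℝ] ℝ)) L) :
    hL.bracket σ (c • τ) = c • hL.bracket σ τ :=
  SubbundleSection.ext_apply fun x => by
    refine (courantBracket_funSmul_right (g := fun _ => c) contMDiffAt_const
      (smoothGenAt_section σ x)
      (smoothGenAt_section τ x)).trans ?_
    rw [funDifferential_const, zero_smul, zero_add]
    rfl

/-- The Lie algebroid underlying a Dirac structure. -/
def IsDirac.lieAlgebroid [T2Space M] (hL : IsDirac E L) :
    LieAlgebroid E (E × (E →L[ℝ] ℝ)) L (diracAnchor L) where
  isSubbundle := hL.isSubbundle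
  anchor_smooth := isSmoothBundleMap_diracAnchor
  -- Linearity in the first argument is deduced from linearity in the second by skew-symmetry.
  bracket := LinearMap.mk₂ ℝ hL.bracket
    (fun σ σ' τ => by
      rw [hL.bracket_swap τ, hL.bracket_add_right, hL.bracket_swap σ, hL.bracket_swap σ',
        neg_add, neg_neg, neg_neg])
    (fun c σ τ => by
      rw [hL.bracket_swap τ, hL.bracket_smul_right, hL.bracket_swap σ, smul_neg, neg_neg])
    hL.bracket_add_right hL.bracket_smul_right
  bracket_self σ := SubbundleSection.ext_apply fun x =>
    courantBracket_self (smoothGenAt_section σ x) (.of_forall (hL.genPairing_eq_zero σ σ))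
  jacobi σ τ υ := SubbundleSection.ext_apply fun x =>
    courantBracket_jacobi (smoothGenAt_section σ) (smoothGenAt_section τ) (smoothGenAt_section υ) x
  leibniz g σ τ _ := courantBracket_funSmul_right g.contMDiff.contMDiffAt (smoothGenAt_section σ _)
    (smoothGenAt_section τ _)

/-- Once bundle and anchor are fixed, the bracket is the only data; every other field is a
proposition. -/
theorem LieAlgebroid.ext_bracket {E : Type*} [NormedAddCommGroup E] [NormedSpace ℝ E]
    {M : Type*} [TopologicalSpace M] [ChartedSpace E M] [IsManifold 𝓘(ℝ, E) ∞ M]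
    {F : Type*} [NormedAddCommGroup F] [NormedSpace ℝ F]
    {V : M → Type*} [TopologicalSpace (TotalSpace F V)]
    [∀ x, AddCommGroup (V x)] [∀ x, Module ℝ (V x)] [∀ x, TopologicalSpace (V x)]
    [FiberBundle F V] [VectorBundle ℝ F V] {S : ∀ x, Submodule ℝ (V x)}
    {ρ : ∀ x, S x →ₗ[ℝ] TangentSpace 𝓘(ℝ, E) x} {A A' : LieAlgebroid E F S ρ}
    (h : ∀ σ τ x, (A.bracket σ τ).1 x = (A'.bracket σ τ).1 x) : A = A' :=
  LieAlgebroid.ext (LinearMap.ext₂ fun σ τ => SubbundleSection.ext_apply (h σ τ))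

theorem IsDirac.existsUnique_lieAlgebroid [T2Space M] (hL : IsDirac E L) :
    ∃! A : LieAlgebroid E (E × (E →L[ℝ] ℝ)) L (diracAnchor L), A.IsCourant :=
  ⟨hL.lieAlgebroid, fun _ _ _ => rfl, fun _ h =>
    LieAlgebroid.ext_bracket fun σ τ x => h σ τ x⟩

end DiracAlgebroid

/-! ### Smooth families of linear maps: coefficients in a frame, and kernels. -/

section Families

variable {E : Type*} [NormedAddCommGroup E] [NormedSpace ℝ E]
  {M : Type*} [TopologicalSpace M] [ChartedSpace E M]
  {W : Type*} [NormedAddCommGroup W] [NormedSpace ℝ W] [FiniteDimensional ℝ W]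
  {G : Type*} [NormedAddCommGroup G] [NormedSpace ℝ G] [FiniteDimensional ℝ G]

theorem ContMDiffAt.clm_inverse_apply {D : M → W →L[ℝ] G} {w : M → G} {x : M}
    (hD : ContMDiffAt 𝓘(ℝ, E) 𝓘(ℝ, W →L[ℝ] G) ∞ D x) (hx : (D x).IsInvertible)
    (hw : ContMDiffAt 𝓘(ℝ, E) 𝓘(ℝ, G) ∞ w x) :
    ContMDiffAt 𝓘(ℝ, E) 𝓘(ℝ, W) ∞ (fun y => (D y).inverse (w y)) x := by
  have : CompleteSpace W := FiniteDimensional.complete ℝ W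
  obtain ⟨e, he⟩ := hx
  have h1 : ContDiffAt ℝ ∞ (ContinuousLinearMap.inverse : (W →L[ℝ] G) → _) (D x) :=
    he ▸ contDiffAt_map_inverse e
  exact (h1.contMDiffAt.comp x hD).clm_apply hw

/-- The coefficients of a smooth section with respect to a smooth frame are smooth. -/
theorem contMDiffAt_of_linearIndependent {k : ℕ} {s : Fin k → M → G} {c : Fin k → M → ℝ} {x : M}
    (hs : ∀ i, ContMDiffAt 𝓘(ℝ, E) 𝓘(ℝ, G) ∞ (s i) x)
    (hli : LinearIndependent ℝ fun i => s i x)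
    (hc : ContMDiffAt 𝓘(ℝ, E) 𝓘(ℝ, G) ∞ (fun y => ∑ i, c i y • s i y) x) (i : Fin k) :
    ContMDiffAt 𝓘(ℝ, E) 𝓘(ℝ, ℝ) ∞ (c i) x := by
  let A : M → (Fin k → ℝ) →L[ℝ] G := fun y => ∑ i, (ContinuousLinearMap.proj i).smulRight (s i y)
  have hA : ∀ y a, A y a = ∑ i, a i • s i y := fun y a => by
    simp [A]
  have hinj : Function.Injective (A x) := by
    rw [injective_iff_map_eq_zero]
    intro a ha
    rw [hA] at ha
    exact funext (Fintype.linearIndependent_iff.1 hli a ha)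
  -- A left inverse of the frame map at the one point `x` turns the nearby frame maps into square
  -- matrices `D y` with `D x = 1`. They are invertible near `x`, and the coefficients are recovered
  -- as `(D y)⁻¹` applied to a smooth vector.
  obtain ⟨P, hP⟩ := (A x).toLinearMap.exists_leftInverse_of_injective (LinearMap.ker_eq_bot.2 hinj)
  let D : M → (Fin k → ℝ) →L[ℝ] (Fin k → ℝ) := fun y => P.toContinuousLinearMap.comp (A y)
  have hD : ContMDiffAt 𝓘(ℝ, E) 𝓘(ℝ, (Fin k → ℝ) →L[ℝ] (Fin k → ℝ)) ∞ D x := by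
    refine ContMDiffAt.of_clm_apply fun a => ?_
    have : (fun y => D y a) = fun y => P.toContinuousLinearMap (∑ i, a i • s i y) := by
      funext y
      simp [D, hA]
    rw [this]
    refine P.toContinuousLinearMap.contMDiff.contMDiffAt.comp x ?_
    refine contMDiffAt_finsetSum fun i _ => ?_
    exact (contMDiffAt_const (I := 𝓘(ℝ, E)) (I' := 𝓘(ℝ, ℝ)) (c := a i)).smul (hs i)
  have hDx : D x = ContinuousLinearMap.id ℝ _ :=
    ContinuousLinearMap.ext fun a => LinearMap.congr_fun hP a
  have hinv : (D x).IsInvertible := hDx ▸ ⟨.refl ℝ _, rfl⟩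
  have h1 := hD.clm_inverse_apply hinv (P.toContinuousLinearMap.contMDiff.contMDiffAt.comp x hc)
  have h2 : ∀ᶠ y in 𝓝 x, (D y).IsInvertible := by
    obtain ⟨e, he⟩ := hinv
    exact hD.continuousAt.eventually (he ▸ ContinuousLinearEquiv.nhds e)
  have h3 : ContMDiffAt 𝓘(ℝ, E) 𝓘(ℝ, Fin k → ℝ) ∞ (fun y i => c i y) x := by
    refine h1.congr_of_eventuallyEq ?_
    filter_upwards [h2] with y hy
    obtain ⟨e, he⟩ := hy
    have h4 : D y (fun i => c i y) = P.toContinuousLinearMap (∑ i, c i y • s i y) := by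
      simp [D, hA]
    rw [← he] at h4 ⊢
    simp only [Function.comp, ContinuousLinearMap.inverse_equiv]
    rw [← h4]
    exact (e.symm_apply_apply _).symm
  exact contMDiffAt_pi_space.1 h3 i

/-- The kernels of a smooth family of surjective linear maps have a smooth frame. -/
theorem exists_frame_ker {T : M → W →L[ℝ] G} {U : Set M} {x₀ : M} (hU : IsOpen U) (hx₀ : x₀ ∈ U)
    (hT : ContMDiffOn 𝓘(ℝ, E) 𝓘(ℝ, W →L[ℝ] G) ∞ T U) (hsurj : Function.Surjective (T x₀)) :
    ∃ U' ⊆ U, IsOpen U' ∧ x₀ ∈ U' ∧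
      ∃ v : Fin (Module.finrank ℝ W - Module.finrank ℝ G) → M → W,
      (∀ j, ContMDiffOn 𝓘(ℝ, E) 𝓘(ℝ, W) ∞ (v j) U') ∧
      ∀ x ∈ U', LinearIndependent ℝ (fun j => v j x) ∧
        Submodule.span ℝ (Set.range fun j => v j x) = LinearMap.ker (T x).toLinearMap := by
  have : CompleteSpace W := FiniteDimensional.complete ℝ W
  let K := LinearMap.ker (T x₀).toLinearMap
  have hK : Module.finrank ℝ K = Module.finrank ℝ W - Module.finrank ℝ G := by
    have h1 : Module.finrank ℝ G + Module.finrank ℝ K = Module.finrank ℝ W := by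
      rw [← (T x₀).toLinearMap.finrank_range_add_finrank_ker, LinearMap.range_eq_top.2 hsurj,
        finrank_top]
    omega
  let b := Module.finBasisOfFinrankEq ℝ K hK
  -- Adding to `T y` a fixed projection `q` onto the kernel at `x₀` gives a map `D y` which is
  -- bijective at `x₀`, hence invertible nearby. The kernel of `T y` is then the preimage of `0 ×
  -- K`, framed by the vectors `(D y)⁻¹ (0, b j)`.
  obtain ⟨q, hq⟩ := K.subtype.exists_leftInverse_of_injective K.ker_subtype
  let D : M → W →L[ℝ] (G × K) := fun y => (T y).prod q.toContinuousLinearMap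
  have hD : ContMDiffOn 𝓘(ℝ, E) 𝓘(ℝ, W →L[ℝ] (G × K)) ∞ D U := by
    intro y hy
    refine ContMDiffAt.contMDiffWithinAt (ContMDiffAt.of_clm_apply fun w => ?_)
    have h1 : ContMDiffAt 𝓘(ℝ, E) 𝓘(ℝ, G) ∞ (fun z => T z w) y :=
      (hT.contMDiffAt (hU.mem_nhds hy)).clm_apply contMDiffAt_const
    exact h1.prodMk_space contMDiffAt_const
  have hbij : Function.Bijective (D x₀) := by
    constructor
    · rw [injective_iff_map_eq_zero]
      intro w hw
      obtain ⟨h1, h2⟩ := Prod.ext_iff.1 hw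
      have h3 := LinearMap.congr_fun hq ⟨w, h1⟩
      exact congrArg Subtype.val (h3.symm.trans h2)
    · rintro ⟨g, κ⟩
      obtain ⟨w, rfl⟩ := hsurj g
      refine ⟨w + ((κ - q w : K) : W), Prod.ext ?_ ?_⟩
      · have : T x₀ ((κ - q w : K) : W) = 0 := (κ - q w : K).2
        simp [D]
      · have h3 := LinearMap.congr_fun hq (κ - q w)
        have h4 : q ((κ - q w : K) : W) = κ - q w := h3
        change q (w + ((κ - q w : K) : W)) = κ
        rw [map_add, h4]
        abel
  let U' := U ∩ D ⁻¹' {A | A.IsInvertible}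
  have hU' : IsOpen U' := hD.continuousOn.isOpen_inter_preimage hU ContinuousLinearEquiv.isOpen
  have hx₀' : x₀ ∈ U' := ⟨hx₀,
    (LinearEquiv.ofBijective (D x₀).toLinearMap hbij).toContinuousLinearEquiv,
    ContinuousLinearMap.ext fun _ => rfl⟩
  refine ⟨U', Set.inter_subset_left, hU', hx₀', fun j x => (D x).inverse (0, b j), fun j x hx => ?_,
    fun x hx => ?_⟩
  · exact ((hD.contMDiffAt (hU.mem_nhds hx.1)).clm_inverse_apply hx.2
      contMDiffAt_const).contMDiffWithinAt
  · obtain ⟨e, he⟩ := hx.2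
    have hT : ∀ w, T x w = (e w).1 := fun w => by rw [← e.coe_coe, he]; rfl
    simp only [← he, ContinuousLinearMap.inverse_equiv]
    constructor
    · have h1 : LinearIndependent ℝ fun j => ((0 : G), b j) :=
        b.linearIndependent.map' (LinearMap.inr ℝ G K)
          (LinearMap.ker_eq_bot.2 LinearMap.inr_injective)
      exact h1.map' e.symm.toLinearMap (LinearMap.ker_eq_bot.2 e.symm.injective)
    · apply le_antisymm
      · rw [Submodule.span_le]
        rintro _ ⟨j, rfl⟩
        change T x (e.symm (0, b j)) = 0
        rw [hT, e.apply_symm_apply]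
      · intro w hw
        have hw' : e w = (0, (e w).2) := Prod.ext ((hT w).symm.trans hw) rfl
        have h2 : w = ∑ j, b.repr (e w).2 j • e.symm ((0 : G), b j) := by
          apply e.injective
          rw [hw', map_sum]
          simp only [map_smul, e.apply_symm_apply]
          refine Prod.ext ?_ ?_
          · simp [Prod.fst_sum]
          · simp only [Prod.snd_sum, Prod.smul_snd]
            exact (b.sum_repr _).symm
        rw [h2]
        exact Submodule.sum_mem _ fun j _ => Submodule.smul_mem _ _ (Submodule.subset_span ⟨j, rfl⟩)

end Families

/-! ### Frames of subbundles and their behaviour under fibrewise bijective bundle maps. -/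

section Frames

variable {EB : Type*} [NormedAddCommGroup EB] [NormedSpace ℝ EB]
  {B : Type*} [TopologicalSpace B] [ChartedSpace EB B]
  {E : Type*} [NormedAddCommGroup E] [NormedSpace ℝ E]
  {M : Type*} [TopologicalSpace M] [ChartedSpace E M]
  {F : Type*} [NormedAddCommGroup F] [NormedSpace ℝ F] [FiniteDimensional ℝ F]
  {V : M → Type*} [TopologicalSpace (TotalSpace F V)]
  [∀ x, AddCommGroup (V x)] [∀ x, Module ℝ (V x)] [∀ x, TopologicalSpace (V x)]
  [FiberBundle F V] [VectorBundle ℝ F V]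
  {F' : Type*} [NormedAddCommGroup F'] [NormedSpace ℝ F'] [FiniteDimensional ℝ F']
  {V' : M → Type*} [TopologicalSpace (TotalSpace F' V')]
  [∀ x, AddCommGroup (V' x)] [∀ x, Module ℝ (V' x)] [∀ x, TopologicalSpace (V' x)]
  [FiberBundle F' V'] [VectorBundle ℝ F' V']

theorem contMDiffAt_prod_along_iff {b : B → M} {s : ∀ x, V (b x) × V' (b x)} {x : B} :
    ContMDiffAt 𝓘(ℝ, EB) (𝓘(ℝ, E).prod 𝓘(ℝ, F × F')) ∞
      (fun y => TotalSpace.mk' (F × F') (E := fun y => V y × V' y) (b y) (s y)) x ↔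
    ContMDiffAt 𝓘(ℝ, EB) (𝓘(ℝ, E).prod 𝓘(ℝ, F)) ∞ (fun y => TotalSpace.mk' F (b y) (s y).1) x ∧
    ContMDiffAt 𝓘(ℝ, EB) (𝓘(ℝ, E).prod 𝓘(ℝ, F')) ∞
      (fun y => TotalSpace.mk' F' (b y) (s y).2) x := by
  rw [contMDiffAt_totalSpace, contMDiffAt_totalSpace, contMDiffAt_totalSpace]
  refine (and_congr_right fun _ => contMDiffAt_prod_module_iff _).trans ?_
  exact ⟨fun h => ⟨⟨h.1, h.2.1⟩, h.1, h.2.2⟩, fun h => ⟨h.1.1, h.1.2, h.2.2⟩⟩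

/-- The coefficients of a smooth section with respect to a smooth frame are smooth. -/
theorem contMDiffAt_frame_coeff {b : B → M} {k : ℕ} {s : Fin k → ∀ x, V (b x)}
    {c : Fin k → B → ℝ} {x : B}
    (hs : ∀ i, ContMDiffAt 𝓘(ℝ, EB) (𝓘(ℝ, E).prod 𝓘(ℝ, F)) ∞
      (fun y => TotalSpace.mk' F (b y) (s i y)) x)
    (hli : LinearIndependent ℝ fun i => s i x)
    (hc : ContMDiffAt 𝓘(ℝ, EB) (𝓘(ℝ, E).prod 𝓘(ℝ, F)) ∞
      (fun y => TotalSpace.mk' F (b y) (∑ i, c i y • s i y)) x) (i : Fin k) :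
    ContMDiffAt 𝓘(ℝ, EB) 𝓘(ℝ, ℝ) ∞ (c i) x := by
  let e := trivializationAt F V (b x)
  have hb : ∀ᶠ y in 𝓝 x, b y ∈ e.baseSet :=
    (contMDiffAt_totalSpace.1 hc).1.continuousAt.eventually
      (e.open_baseSet.mem_nhds (FiberBundle.mem_baseSet_trivializationAt' _))
  have hmap : ∀ s : ∀ x, V (b x),
      ContMDiffAt 𝓘(ℝ, EB) (𝓘(ℝ, E).prod 𝓘(ℝ, F)) ∞ (fun y => TotalSpace.mk' F (b y) (s y)) x →
      ContMDiffAt 𝓘(ℝ, EB) 𝓘(ℝ, F) ∞ (fun y => e.linearMapAt ℝ (b y) (s y)) x := by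
    intro s hs
    refine (contMDiffAt_totalSpace.1 hs).2.congr_of_eventuallyEq ?_
    filter_upwards [hb] with y hy
    rw [e.coe_linearMapAt_of_mem hy]
  refine contMDiffAt_of_linearIndependent (s := fun i y => e.linearMapAt ℝ (b y) (s i y))
    (fun i => hmap _ (hs i)) ?_ ?_ i
  · have hx := hb.self_of_nhds
    refine hli.map' (e.linearMapAt ℝ (b x)) (LinearMap.ker_eq_bot.2 fun v w h => ?_)
    rw [← e.symmₗ_linearMapAt (R := ℝ) hx v, ← e.symmₗ_linearMapAt (R := ℝ) hx w, h]
  · refine (hmap _ hc).congr_of_eventuallyEq (.of_forall fun y => ?_)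
    simp only [map_sum, map_smul]

theorem contMDiffAt_sum_smul_along {b : B → M} {ι : Type*} {t : Finset ι} {s : ι → ∀ x, V (b x)}
    {c : ι → B → ℝ} {x : B} (hb : ContMDiffAt 𝓘(ℝ, EB) 𝓘(ℝ, E) ∞ b x)
    (hs : ∀ i ∈ t, ContMDiffAt 𝓘(ℝ, EB) (𝓘(ℝ, E).prod 𝓘(ℝ, F)) ∞
      (fun y => TotalSpace.mk' F (b y) (s i y)) x)
    (hc : ∀ i ∈ t, ContMDiffAt 𝓘(ℝ, EB) 𝓘(ℝ, ℝ) ∞ (c i) x) :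
    ContMDiffAt 𝓘(ℝ, EB) (𝓘(ℝ, E).prod 𝓘(ℝ, F)) ∞
      (fun y => TotalSpace.mk' F (b y) (∑ i ∈ t, c i y • s i y)) x := by
  let e := trivializationAt F V (b x)
  have hb' : ∀ᶠ y in 𝓝 x, b y ∈ e.baseSet :=
    hb.continuousAt.eventually
      (e.open_baseSet.mem_nhds (FiberBundle.mem_baseSet_trivializationAt' _))
  refine contMDiffAt_totalSpace.2 ⟨hb, ?_⟩
  have h1 : ContMDiffAt 𝓘(ℝ, EB) 𝓘(ℝ, F) ∞
      (fun y => ∑ i ∈ t, c i y • (e (TotalSpace.mk' F (b y) (s i y))).2) x :=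
    contMDiffAt_finsetSum fun i hi => (hc i hi).smul (contMDiffAt_totalSpace.1 (hs i hi)).2
  refine h1.congr_of_eventuallyEq ?_
  filter_upwards [hb'] with y hy
  have h2 : ∀ v, (e (TotalSpace.mk' F (b y) v)).2 = e.linearMapAt ℝ (b y) v := fun v => by
    rw [e.coe_linearMapAt_of_mem hy]
  change (e (TotalSpace.mk' F (b y) _)).2 = _
  simp only [h2, map_sum, map_smul]

/-- A smooth subbundle has smooth frames near every point; sections with values in it are smooth
combinations of them. -/
theorem IsSmoothSubbundle.exists_coeff {k : ℕ} {S : ∀ x, Submodule ℝ (V x)} {b : B → M} {U : Set M}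
    {s : Fin k → ∀ x, V x}
    (hU : IsOpen U) (hs : ∀ i, ContMDiffOn 𝓘(ℝ, E) (𝓘(ℝ, E).prod 𝓘(ℝ, F)) ∞
      (fun x => TotalSpace.mk' F x (s i x)) U)
    (hspan : ∀ x ∈ U, LinearIndependent ℝ (fun i => s i x) ∧
      Submodule.span ℝ (Set.range fun i => s i x) = S x)
    (σ : ∀ x, S (b x)) :
    ∃ c : Fin k → B → ℝ, (∀ x, b x ∈ U → (σ x : V (b x)) = ∑ i, c i x • s i (b x)) ∧
      ∀ x, b x ∈ U → ContMDiffAt 𝓘(ℝ, EB) (𝓘(ℝ, E).prod 𝓘(ℝ, F)) ∞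
        (fun y => TotalSpace.mk' F (b y) (σ y : V (b y))) x →
        ∀ i, ContMDiffAt 𝓘(ℝ, EB) 𝓘(ℝ, ℝ) ∞ (c i) x := by
  have h1 : ∀ x, ∃ c : Fin k → ℝ, b x ∈ U → (σ x : V (b x)) = ∑ i, c i • s i (b x) := by
    intro x
    by_cases hx : b x ∈ U
    · have h2 : (σ x : V (b x)) ∈ Submodule.span ℝ (Set.range fun i => s i (b x)) :=
        (hspan _ hx).2.symm ▸ (σ x).2
      obtain ⟨c, hc⟩ := (Submodule.mem_span_range_iff_exists_fun ℝ).1 h2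
      exact ⟨c, fun _ => hc.symm⟩
    · exact ⟨0, fun h => (hx h).elim⟩
  choose c hc using h1
  refine ⟨fun i x => c x i, hc, fun x hx hσ i => ?_⟩
  have hb := (contMDiffAt_totalSpace.1 hσ).1
  refine contMDiffAt_frame_coeff (E := E) (EB := EB) (F := F) (V := V) (b := b)
    (c := fun i x => c x i) (s := fun i x => s i (b x)) (fun i => ?_) (hspan _ hx).1 ?_ i
  · exact ((hs i).contMDiffAt (hU.mem_nhds hx)).comp x hb
  · refine hσ.congr_of_eventuallyEq ?_
    filter_upwards [hb.continuousAt.eventually (hU.mem_nhds hx)] with y hy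
    rw [hc y hy]

-- `IsSmoothBundleMap` speaks of sections with values in `S` everywhere, while a local frame lies in
-- `S` only on `U`. The value zero where `s x ∉ S x` bridges this and is never seen on `U`.
open Classical in
theorem IsSmoothBundleMap.contMDiffOn {S : ∀ x, Submodule ℝ (V x)} {φ : ∀ x, S x →ₗ[ℝ] V' x}
    (hφ : IsSmoothBundleMap E F F' φ) {U : Set M} (hU : IsOpen U) {s : ∀ x, V x}
    (hs : ContMDiffOn 𝓘(ℝ, E) (𝓘(ℝ, E).prod 𝓘(ℝ, F)) ∞ (fun x => TotalSpace.mk' F x (s x)) U)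
    (h : ∀ x ∈ U, s x ∈ S x) :
    ContMDiffOn 𝓘(ℝ, E) (𝓘(ℝ, E).prod 𝓘(ℝ, F')) ∞ (fun x => TotalSpace.mk' F' x
      (if hx : s x ∈ S x then φ x ⟨s x, hx⟩ else 0)) U := by
  have h1 := hφ U (fun x => if hx : s x ∈ S x then ⟨s x, hx⟩ else 0) hU
    (hs.congr fun x hx => by simp [h x hx])
  exact h1.congr fun x hx => by simp [h x hx]

/-- A fibrewise bijective smooth bundle map maps smooth subbundles to smooth subbundles. -/
theorem IsSmoothSubbundle.map {k : ℕ} {S : ∀ x, Submodule ℝ (V x)} {S' : ∀ x, Submodule ℝ (V' x)}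
    (hS : IsSmoothSubbundle E F k S) {φ : ∀ x, S x →ₗ[ℝ] S' x}
    (hφ : IsSmoothBundleMap E F F' (fun x => (S' x).subtype ∘ₗ φ x))
    (hbij : ∀ x, Function.Bijective (φ x)) : IsSmoothSubbundle E F' k S' := by
  classical
  intro x₀
  obtain ⟨U, hU, hx₀, s, hs, hspan⟩ := hS x₀
  have hmem : ∀ i, ∀ x ∈ U, s i x ∈ S x := fun i x hx =>
    (hspan x hx).2 ▸ Submodule.subset_span ⟨i, rfl⟩
  refine ⟨U, hU, hx₀, _, fun i => hφ.contMDiffOn hU (hs i) (hmem i), fun x hx => ?_⟩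
  have h1 : (fun i => if h : s i x ∈ S x then ((S' x).subtype ∘ₗ φ x) ⟨s i x, h⟩ else 0) =
      ((S' x).subtype ∘ₗ φ x) ∘ fun i => (⟨s i x, hmem i x hx⟩ : S x) := by
    funext i
    simp [hmem i x hx]
  have h2 : LinearIndependent ℝ fun i => (⟨s i x, hmem i x hx⟩ : S x) :=
    LinearIndependent.of_comp (S x).subtype (hspan x hx).1
  have h3 : Submodule.span ℝ (Set.range fun i => (⟨s i x, hmem i x hx⟩ : S x)) = ⊤ := by
    apply Submodule.map_injective_of_injective (S x).injective_subtype
    rw [Submodule.map_span, ← Set.range_comp, Submodule.map_top, Submodule.range_subtype]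
    exact (hspan x hx).2
  rw [h1]
  constructor
  · exact h2.map' _ (LinearMap.ker_eq_bot.2 ((S' x).injective_subtype.comp (hbij x).1))
  · rw [Set.range_comp, ← Submodule.map_span, h3, Submodule.map_top, LinearMap.range_comp,
      LinearMap.range_eq_top.2 (hbij x).2, Submodule.map_top, Submodule.range_subtype]

/-- The inverse of a fibrewise bijective smooth bundle map between subbundles is smooth. -/
theorem IsSmoothSubbundle.isSmoothBundleMap_symm {k : ℕ} {S : ∀ x, Submodule ℝ (V x)}
    {S' : ∀ x, Submodule ℝ (V' x)}
    (hS : IsSmoothSubbundle E F k S) {φ : ∀ x, S x ≃ₗ[ℝ] S' x}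
    (hφ : IsSmoothBundleMap E F F' (fun x => (S' x).subtype ∘ₗ (φ x).toLinearMap)) :
    IsSmoothBundleMap E F' F (fun x => (S x).subtype ∘ₗ (φ x).symm.toLinearMap) := by
  classical
  intro W σ hW hσ x₀ hx₀
  obtain ⟨U, hU, hx₀', s, hs, hspan⟩ := hS x₀
  have hmem : ∀ i, ∀ x ∈ U, s i x ∈ S x := fun i x hx =>
    (hspan x hx).2 ▸ Submodule.subset_span ⟨i, rfl⟩
  obtain ⟨c, hc, -⟩ := IsSmoothSubbundle.exists_coeff (EB := E) (b := id) hU hs hspan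
    (fun x => (φ x).symm (σ x))
  -- The image frame `φ ∘ s`, with value `0` where `s` leaves `S`, which does not happen on `U`.
  let s' : Fin k → ∀ x, V' x := fun i x => if h : s i x ∈ S x then φ x ⟨s i x, h⟩ else 0
  have hs'x : ∀ i, ∀ x ∈ U, ∃ h : s i x ∈ S x, s' i x = φ x ⟨s i x, h⟩ := fun i x hx =>
    ⟨hmem i x hx, dif_pos (hmem i x hx)⟩
  have hs' : ∀ i, ContMDiffAt 𝓘(ℝ, E) (𝓘(ℝ, E).prod 𝓘(ℝ, F')) ∞
      (fun x => TotalSpace.mk' F' x (s' i x)) x₀ := fun i =>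
    (hφ.contMDiffOn hU (hs i) (hmem i)).contMDiffAt (hU.mem_nhds hx₀')
  have hli : LinearIndependent ℝ fun i => s' i x₀ := by
    have h2 : LinearIndependent ℝ fun i => (⟨s i x₀, hmem i x₀ hx₀'⟩ : S x₀) :=
      LinearIndependent.of_comp (S x₀).subtype (hspan x₀ hx₀').1
    have h3 := h2.map' ((S' x₀).subtype ∘ₗ (φ x₀).toLinearMap)
      (LinearMap.ker_eq_bot.2 ((S' x₀).injective_subtype.comp (φ x₀).injective))
    have h4 : (fun i => s' i x₀) = ((S' x₀).subtype ∘ₗ (φ x₀).toLinearMap) ∘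
        fun i => (⟨s i x₀, hmem i x₀ hx₀'⟩ : S x₀) := funext fun i => (hs'x i x₀ hx₀').2
    rw [h4]
    exact h3
  -- By linearity of `φ`, the coefficients of `φ⁻¹ σ` in the frame `s` are those of `σ` in the frame
  -- `s'`. The latter are smooth at `x₀` because `σ` and `s'` are.
  have hc' : ∀ i, ContMDiffAt 𝓘(ℝ, E) 𝓘(ℝ, ℝ) ∞ (c i) x₀ := by
    refine contMDiffAt_frame_coeff (b := id) hs' hli ?_
    refine (hσ.contMDiffAt (hW.mem_nhds hx₀)).congr_of_eventuallyEq ?_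
    filter_upwards [hU.mem_nhds hx₀'] with x hx
    have h1 : (φ x).symm (σ x) = ∑ i, c i x • (⟨s i x, hmem i x hx⟩ : S x) := by
      apply Subtype.ext
      rw [hc x hx]
      simp
    have h2 : σ x = ∑ i, c i x • φ x ⟨s i x, hmem i x hx⟩ := by
      rw [← (φ x).apply_symm_apply (σ x), h1]
      simp only [map_sum, map_smul]
    rw [h2]
    simp only [id, Submodule.coe_sum, Submodule.coe_smul]
    congr 1
    exact Finset.sum_congr rfl fun i _ => by rw [(hs'x i x hx).2]
  refine ContMDiffAt.contMDiffWithinAt ?_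
  refine (contMDiffAt_sum_smul_along (b := id) (t := Finset.univ) contMDiffAt_id
    (fun i _ => (hs i).contMDiffAt (hU.mem_nhds hx₀')) (fun i _ => hc' i)).congr_of_eventuallyEq ?_
  filter_upwards [hU.mem_nhds hx₀'] with x hx
  exact congrArg (TotalSpace.mk' F x) (hc x hx)

end Frames

/-! ### Transversality makes the fibre product a smooth subbundle. -/

section PullbackSubbundle

variable {EB : Type*} [NormedAddCommGroup EB] [NormedSpace ℝ EB] [FiniteDimensional ℝ EB]
  {B : Type*} [TopologicalSpace B] [ChartedSpace EB B] [IsManifold 𝓘(ℝ, EB) ∞ B]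
  {EM : Type*} [NormedAddCommGroup EM] [NormedSpace ℝ EM] [FiniteDimensional ℝ EM]
  {M : Type*} [TopologicalSpace M] [ChartedSpace EM M] [IsManifold 𝓘(ℝ, EM) ∞ M]
  {F : Type*} [NormedAddCommGroup F] [NormedSpace ℝ F] [FiniteDimensional ℝ F]
  {V : M → Type*} [TopologicalSpace (TotalSpace F V)]
  [∀ x, AddCommGroup (V x)] [∀ x, Module ℝ (V x)] [∀ x, TopologicalSpace (V x)]
  [FiberBundle F V] [VectorBundle ℝ F V]

theorem contMDiffOn_symm_const {x : M} (v : EM) :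
    ContMDiffOn 𝓘(ℝ, EM) (𝓘(ℝ, EM).prod 𝓘(ℝ, EM)) ∞ (fun y => TotalSpace.mk' EM y
      ((trivializationAt EM (TangentSpace 𝓘(ℝ, EM)) x).symmₗ ℝ y v))
      (trivializationAt EM (TangentSpace 𝓘(ℝ, EM)) x).baseSet := by
  intro y hy
  refine (Trivialization.contMDiffWithinAt_section (n := ∞) _ hy).2 ?_
  refine (contMDiffWithinAt_const (c := v)).congr_of_mem (fun z hz => ?_) hy
  rw [Trivialization.coe_symmₗ, Trivialization.apply_mk_symm _ hz]
  exact hz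

/-- If the anchored bundle `(S, ρ)` is transverse to `f`, then `f^!S` is a smooth subbundle of
`f^*V ⊕ TB`. -/
theorem isSmoothSubbundle_pullbackFiber {k : ℕ} {S : ∀ y, Submodule ℝ (V y)}
    {ρ : ∀ y, S y →ₗ[ℝ] TangentSpace 𝓘(ℝ, EM) y} (hS : IsSmoothSubbundle EM F k S)
    (hρ : IsSmoothBundleMap (V' := fun x : M => TangentSpace 𝓘(ℝ, EM) x) EM F EM ρ)
    (f : C^∞⟮𝓘(ℝ, EB), B; 𝓘(ℝ, EM), M⟯) (hf : IsTransverse f ρ) :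
    IsSmoothSubbundle EB (F × EB)
      (Module.finrank ℝ ((Fin k → ℝ) × EB) - Module.finrank ℝ EM) (pullbackFiber f ρ) := by
  classical
  intro x₀
  obtain ⟨U, hU, hx₀, s, hs, hspan⟩ := hS (f x₀)
  have hmem : ∀ i, ∀ y ∈ U, s i y ∈ S y := fun i y hy =>
    (hspan y hy).2 ▸ Submodule.subset_span ⟨i, rfl⟩
  let r : Fin k → ∀ y, TangentSpace 𝓘(ℝ, EM) y := fun i y =>
    if h : s i y ∈ S y then ρ y ⟨s i y, h⟩ else 0
  have hr : ∀ i, ContMDiffOn 𝓘(ℝ, EM) (𝓘(ℝ, EM).prod 𝓘(ℝ, EM)) ∞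
      (fun y => TotalSpace.mk' EM y (r i y)) U := fun i =>
    hρ.contMDiffOn hU (hs i) (hmem i)
  have hrx : ∀ i, ∀ y (hy : y ∈ U), r i y = ρ y ⟨s i y, hmem i y hy⟩ := fun i y hy =>
    dif_pos (hmem i y hy)
  let eM := trivializationAt EM (TangentSpace 𝓘(ℝ, EM)) (f x₀)
  let eB := trivializationAt EB (TangentSpace 𝓘(ℝ, EB)) x₀
  -- the fibrewise linear maps
  let N : ∀ x, (Fin k → ℝ) × EB →ₗ[ℝ] PullbackAmbient f V x := fun x =>
    LinearMap.prodMap (Fintype.linearCombination ℝ (fun i => s i (f x)) :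
      (Fin k → ℝ) →ₗ[ℝ] V (f x)) (eB.symmₗ ℝ x)
  -- In the frame of `S` and a trivialization of `TB`, `R` is `(a, X) ↦ ρ(a) - f_*X`. Over `U₁` the
  -- injective map `N` carries its kernel onto `f^!S`, so a frame of `ker R` becomes a frame of
  -- `f^!S`. `T` is `R` read in a trivialization of `TM`, which puts it in a fixed space of linear
  -- maps.
  let R : ∀ x, (Fin k → ℝ) × EB →ₗ[ℝ] TangentSpace 𝓘(ℝ, EM) (f x) := fun x =>
    (Fintype.linearCombination ℝ (fun i => r i (f x))) ∘ₗ LinearMap.fst ℝ _ _ -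
      (mfderiv 𝓘(ℝ, EB) 𝓘(ℝ, EM) f x).toLinearMap ∘ₗ (eB.symmₗ ℝ x) ∘ₗ LinearMap.snd ℝ _ _
  have hR : ∀ x w, R x w = ∑ i, w.1 i • r i (f x) -
      mfderiv 𝓘(ℝ, EB) 𝓘(ℝ, EM) f x (eB.symmₗ ℝ x w.2) := fun x w => by
    rw [LinearMap.sub_apply]
    rfl
  let T : B → ((Fin k → ℝ) × EB) →L[ℝ] EM := fun x =>
    LinearMap.toContinuousLinearMap ((eM.linearMapAt ℝ (f x)) ∘ₗ R x)
  let U₁ : Set B := (f ⁻¹' (U ∩ eM.baseSet)) ∩ eB.baseSet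
  have hU₁ : IsOpen U₁ :=
    ((hU.inter eM.open_baseSet).preimage f.contMDiff.continuous).inter eB.open_baseSet
  have hx₁ : x₀ ∈ U₁ := ⟨⟨hx₀, FiberBundle.mem_baseSet_trivializationAt' _⟩,
    FiberBundle.mem_baseSet_trivializationAt' _⟩
  have hT : ContMDiffOn 𝓘(ℝ, EB) 𝓘(ℝ, ((Fin k → ℝ) × EB) →L[ℝ] EM) ∞ T U₁ := by
    intro x hx
    refine ContMDiffAt.contMDiffWithinAt (ContMDiffAt.of_clm_apply fun w => ?_)
    have h1 : ∀ X : ∀ x : B, TangentSpace 𝓘(ℝ, EM) (f x),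
        ContMDiffAt 𝓘(ℝ, EB) (𝓘(ℝ, EM).prod 𝓘(ℝ, EM)) ∞
          (fun y => TotalSpace.mk' EM (E := fun y : M => TangentSpace 𝓘(ℝ, EM) y) (f y) (X y)) x →
        ContMDiffAt 𝓘(ℝ, EB) 𝓘(ℝ, EM) ∞ (fun y => eM.linearMapAt ℝ (f y) (X y)) x := by
      intro X hX
      refine ((eM.contMDiffAt_iff (eM.mem_source.2 hx.1.2)).1 hX).2.congr_of_eventuallyEq ?_
      filter_upwards [hU₁.mem_nhds hx] with y hy
      rw [eM.coe_linearMapAt_of_mem hy.1.2]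
    have h2 := ContMDiffAt.mfderiv_apply_field f.contMDiff.contMDiffAt
      ((contMDiffOn_symm_const (x := x₀) w.2).contMDiffAt (eB.open_baseSet.mem_nhds hx.2))
    have h3 : ContMDiffAt 𝓘(ℝ, EB) 𝓘(ℝ, EM) ∞
        (fun y => ∑ i, w.1 i • eM.linearMapAt ℝ (f y) (r i (f y))) x :=
      contMDiffAt_finsetSum fun i _ =>
        (contMDiffAt_const (I := 𝓘(ℝ, EB)) (I' := 𝓘(ℝ, ℝ)) (c := w.1 i)).smul
          (h1 _ (((hr i).contMDiffAt (hU.mem_nhds hx.1.1)).comp x f.contMDiff.contMDiffAt))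
    refine (h3.sub (h1 _ h2)).congr_of_eventuallyEq (.of_forall fun y => ?_)
    change eM.linearMapAt ℝ (f y) (R y w) = _
    rw [hR, map_sub, map_sum]
    simp only [map_smul]
    rfl
  have hker : ∀ x ∈ U₁, ∀ w, T x w = 0 ↔ N x w ∈ pullbackFiber f ρ x := by
    intro x hx w
    have h1 : T x w = 0 ↔ R x w = 0 := by
      refine ⟨fun h => ?_, fun h => ?_⟩
      · rw [← eM.symmₗ_linearMapAt (R := ℝ) hx.1.2 (R x w)]
        exact (congrArg (eM.symmₗ ℝ (f x)) h).trans (map_zero _)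
      · exact (congrArg (eM.linearMapAt ℝ (f x)) h).trans (map_zero _)
    have h2 : ∑ i, w.1 i • s i (f x) ∈ S (f x) :=
      Submodule.sum_mem _ fun i _ => Submodule.smul_mem _ _ (hmem i _ hx.1.1)
    have h3 : ρ (f x) ⟨∑ i, w.1 i • s i (f x), h2⟩ = ∑ i, w.1 i • r i (f x) := by
      have h4 : (⟨∑ i, w.1 i • s i (f x), h2⟩ : S (f x)) =
          ∑ i, w.1 i • (⟨s i (f x), hmem i _ hx.1.1⟩ : S (f x)) := by
        apply Subtype.ext
        rw [Submodule.coe_sum]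
        rfl
      rw [h4, map_sum]
      simp only [map_smul, hrx _ _ hx.1.1]
    rw [h1, hR, sub_eq_zero, ← h3]
    exact ⟨fun h => ⟨h2, h⟩, fun ⟨_, h⟩ => h⟩
  have hNinj : ∀ x ∈ U₁, Function.Injective (N x) := by
    intro x hx
    rw [injective_iff_map_eq_zero]
    intro w hw
    obtain ⟨hw1, hw2⟩ := Prod.ext_iff.1 hw
    refine Prod.ext ?_ ?_
    · exact funext (Fintype.linearIndependent_iff.1 (hspan _ hx.1.1).1 w.1 hw1)
    · rw [← eB.linearMapAt_symmₗ (R := ℝ) hx.2 w.2]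
      exact (congrArg (eB.linearMapAt ℝ x) hw2).trans (map_zero _)
  have hNsurj : ∀ x ∈ U₁, ∀ p ∈ pullbackFiber f ρ x, ∃ w, N x w = p := by
    rintro x hx p ⟨hp, -⟩
    have h2 : (show V (f x) from p.1) ∈ Submodule.span ℝ (Set.range fun i => s i (f x)) :=
      (hspan _ hx.1.1).2.symm ▸ hp
    obtain ⟨c, hc⟩ := (Submodule.mem_span_range_iff_exists_fun ℝ).1 h2
    exact ⟨(c, eB.linearMapAt ℝ x p.2), Prod.ext hc (eB.symmₗ_linearMapAt hx.2 p.2)⟩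
  -- This is where transversality enters. Since `R` subtracts `f_*X`, the decomposition `g = ρ(ℓ) +
  -- f_*X` is realized by the vector `-X`.
  have hTsurj : Function.Surjective (T x₀) := by
    intro g
    obtain ⟨a, ⟨ℓ, rfl⟩, b, ⟨X, rfl⟩, hab⟩ := Submodule.mem_sup.1
      (hf x₀ ▸ Submodule.mem_top : eM.symmₗ ℝ (f x₀) g ∈ _)
    have h2 : (ℓ : V (f x₀)) ∈ Submodule.span ℝ (Set.range fun i => s i (f x₀)) :=
      (hspan _ hx₀).2.symm ▸ ℓ.2
    obtain ⟨c, hc⟩ := (Submodule.mem_span_range_iff_exists_fun ℝ).1 h2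
    refine ⟨(c, - eB.linearMapAt ℝ x₀ X), ?_⟩
    have h4 : ℓ = ∑ i, c i • (⟨s i (f x₀), hmem i _ hx₀⟩ : S (f x₀)) := by
      apply Subtype.ext
      rw [← hc, Submodule.coe_sum]
      rfl
    have h3 : R x₀ (c, - eB.linearMapAt ℝ x₀ X) = eM.symmₗ ℝ (f x₀) g := by
      rw [← hab, h4, map_sum]
      simp only [map_smul, ← hrx _ _ hx₀]
      rw [hR, map_neg, eB.symmₗ_linearMapAt hx₁.2, map_neg, sub_neg_eq_add]
      rfl
    change eM.linearMapAt ℝ (f x₀) (R x₀ _) = g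
    rw [h3, eM.linearMapAt_symmₗ hx₁.1.2]
  obtain ⟨U', hU'₁, hU', hx', v, hv, hvspan⟩ := exists_frame_ker hU₁ hx₁ hT hTsurj
  refine ⟨U', hU', hx', fun j x => N x (v j x), fun j x hx => ?_, fun x hx => ?_⟩
  · refine ContMDiffAt.contMDiffWithinAt ?_
    have hvx := (hv j).contMDiffAt (hU'.mem_nhds hx)
    refine contMDiffAt_prod_section_iff.2 ⟨(contMDiffAt_pullback_section_iff f).2 ?_, ?_⟩
    · have h5 : ∀ i, ContMDiffAt 𝓘(ℝ, EB) 𝓘(ℝ, ℝ) ∞ (fun y => (v j y).1 i) x := fun i =>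
        ((ContinuousLinearMap.proj (R := ℝ) (φ := fun _ : Fin k => ℝ) i).comp
          (ContinuousLinearMap.fst ℝ (Fin k → ℝ) EB)).contMDiff.contMDiffAt.comp x hvx
      exact contMDiffAt_sum_smul_along (V := V) (b := f) (t := Finset.univ)
        (s := fun i y => s i (f y)) f.contMDiff.contMDiffAt (fun i _ =>
        ((hs i).contMDiffAt (hU.mem_nhds (hU'₁ hx).1.1)).comp x f.contMDiff.contMDiffAt)
        (fun i _ => h5 i)
    · have h6 : ContMDiffAt 𝓘(ℝ, EB) 𝓘(ℝ, EB) ∞ (fun y => (v j y).2) x :=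
        (ContinuousLinearMap.snd ℝ (Fin k → ℝ) EB).contMDiff.contMDiffAt.comp x hvx
      refine (Trivialization.contMDiffAt_section_iff (n := ∞) eB (hU'₁ hx).2).2 ?_
      refine h6.congr_of_eventuallyEq ?_
      filter_upwards [hU'.mem_nhds hx] with y hy
      change (eB (TotalSpace.mk' EB y (eB.symmₗ ℝ y (v j y).2))).2 = _
      rw [eB.coe_symmₗ, eB.apply_mk_symm (hU'₁ hy).2]
      exact (hU'₁ hy).2
  · have hx1 := hU'₁ hx
    constructor
    · exact (hvspan x hx).1.map' (N x) (LinearMap.ker_eq_bot.2 (hNinj x hx1))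
    · have h7 : Set.range (fun j => N x (v j x)) = N x '' Set.range fun j => v j x :=
        Set.range_comp (N x) _
      rw [h7, ← Submodule.map_span, (hvspan x hx).2]
      ext p
      refine ⟨?_, fun hp => ?_⟩
      · rintro ⟨w, hw, rfl⟩
        exact (hker x hx1 w).1 hw
      · obtain ⟨w, rfl⟩ := hNsurj x hx1 p hp
        exact ⟨w, (hker x hx1 w).2 hp, rfl⟩

end PullbackSubbundle

/-! ### Linear algebra of maximal isotropic subspaces. -/

section Isotropic

theorem LinearMap.exists_factor_of_surjective {K V W U : Type*} [Field K] [AddCommGroup V]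
    [Module K V] [AddCommGroup W] [Module K W] [AddCommGroup U] [Module K U] {T : V →ₗ[K] W}
    (hT : LinearMap.range T = ⊤) {φ : V →ₗ[K] U} (hφ : ∀ v, T v = 0 → φ v = 0) :
    ∃ η : W →ₗ[K] U, ∀ v, η (T v) = φ v := by
  obtain ⟨g, hg⟩ := T.exists_rightInverse_of_surjective hT
  refine ⟨φ ∘ₗ g, fun v => ?_⟩
  have h1 : T (g (T v) - v) = 0 := by
    rw [map_sub, sub_eq_zero]
    exact LinearMap.congr_fun hg (T v)
  have h2 := hφ _ h1
  rwa [map_sub, sub_eq_zero] at h2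

variable {E : Type*} [NormedAddCommGroup E] [NormedSpace ℝ E]
  {M : Type*} [TopologicalSpace M] [ChartedSpace E M] {x : M}

theorem genPairing_comm (p q : GenTangent E x) : genPairing p q = genPairing q p :=
  add_comm _ _

theorem genPairing_add_left (p p' q : GenTangent E x) :
    genPairing (p + p') q = genPairing p q + genPairing p' q := by
  have : q.2 (p.1 + p'.1) = q.2 p.1 + q.2 p'.1 := map_add q.2 _ _
  change q.2 (p.1 + p'.1) + (p.2 q.1 + p'.2 q.1) = q.2 p.1 + p.2 q.1 + (q.2 p'.1 + p'.2 q.1)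
  erw [this]
  abel

theorem genPairing_smul_left (c : ℝ) (p q : GenTangent E x) :
    genPairing (c • p) q = c * genPairing p q := by
  have : q.2 (c • p.1) = c * q.2 p.1 := map_smul q.2 _ _
  change q.2 (c • p.1) + c * p.2 q.1 = c * (q.2 p.1 + p.2 q.1)
  erw [this]
  exact (mul_add _ _ _).symm

/-- `W` together with the line through `p` is still isotropic, so maximality absorbs `p`. -/
theorem mem_of_maximal_of_genPairing_self {W : Submodule ℝ (GenTangent E x)}
    (hW : Maximal IsIsotropic W) {p : GenTangent E x} (hp : ∀ q ∈ W, genPairing p q = 0)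
    (hpp : genPairing p p = 0) : p ∈ W := by
  have hle : W ≤ W ⊔ Submodule.span ℝ {p} := le_sup_left
  refine hW.2 (y := W ⊔ Submodule.span ℝ {p}) ?_ hle
    (Submodule.mem_sup_right (Submodule.mem_span_singleton_self p))
  intro a ha b hb
  obtain ⟨u, hu, a', ha', rfl⟩ := Submodule.mem_sup.1 ha
  obtain ⟨v, hv, b', hb', rfl⟩ := Submodule.mem_sup.1 hb
  obtain ⟨c, rfl⟩ := Submodule.mem_span_singleton.1 ha'
  obtain ⟨d, rfl⟩ := Submodule.mem_span_singleton.1 hb'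
  have h1 : genPairing u p = 0 := (genPairing_comm _ _).trans (hp u hu)
  rw [genPairing_add_left, genPairing_smul_left, genPairing_comm, genPairing_comm p,
    genPairing_add_left, genPairing_smul_left, genPairing_add_left, genPairing_smul_left,
    hp u hu, hpp, genPairing_comm v p, hp v hv, genPairing_comm v u, hW.1 u hu v hv]
  ring

/-- A maximal isotropic subspace contains its orthogonal complement. -/
theorem mem_of_maximal_isotropic [FiniteDimensional ℝ E] {W : Submodule ℝ (GenTangent E x)}
    (hW : Maximal IsIsotropic W) {p : GenTangent E x} (hp : ∀ q ∈ W, genPairing p q = 0) :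
    p ∈ W := by
  have : FiniteDimensional ℝ (TangentSpace 𝓘(ℝ, E) x) := inferInstanceAs (FiniteDimensional ℝ E)
  have : T2Space (TangentSpace 𝓘(ℝ, E) x) := inferInstanceAs (T2Space E)
  -- If some `q ∈ W` has the same vector part as `p`, then `p - q` is a pure covector. It pairs to
  -- zero with itself, so the previous lemma applies.
  by_cases h : p.1 ∈ W.map (LinearMap.fst ℝ (TangentSpace 𝓘(ℝ, E) x) (CotangentFiber E x))
  · obtain ⟨q, hq, hqp⟩ := h
    have h1 : q.1 = p.1 := hqp
    have h2 : p + (-1 : ℝ) • q ∈ W := by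
      have h3 : ∀ r ∈ W, genPairing (p + (-1 : ℝ) • q) r = 0 := fun r hr => by
        rw [genPairing_add_left, genPairing_smul_left, hp r hr, hW.1 q hq r hr]
        ring
      refine mem_of_maximal_of_genPairing_self hW h3 ?_
      have h4 : (p + (-1 : ℝ) • q).1 = 0 := by
        change p.1 + (-1 : ℝ) • q.1 = 0
        rw [h1]
        simp
      change (p + (-1 : ℝ) • q).2 (p + (-1 : ℝ) • q).1 +
        (p + (-1 : ℝ) • q).2 (p + (-1 : ℝ) • q).1 = 0
      rw [h4]
      erw [map_zero]
      exact add_zero _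
    exact (W.add_mem_iff_left (W.smul_mem (-1) hq)).1 h2
  -- Otherwise a functional `ζ` kills the projection of `W` but not `p.1`. Then `(0, ζ)` belongs to
  -- `W` by the previous lemma, yet pairs nontrivially with `p`: a contradiction.
  · obtain ⟨ζ, hζ, hζW⟩ := Submodule.exists_le_ker_of_notMem h
    have h1 : ((0, LinearMap.toContinuousLinearMap ζ) : GenTangent E x) ∈ W := by
      have h2 : ∀ r ∈ W,
          genPairing ((0, LinearMap.toContinuousLinearMap ζ) : GenTangent E x) r = 0 := by
        intro r hr
        have h3 : ζ r.1 = 0 := hζW ⟨r, hr, rfl⟩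
        have h4 : r.2 0 = 0 := map_zero r.2
        change r.2 0 + ζ r.1 = 0
        rw [h3]
        erw [h4]
        exact add_zero _
      refine mem_of_maximal_of_genPairing_self hW h2 ?_
      have h3 : ζ 0 = 0 := map_zero ζ
      change ζ 0 + ζ 0 = 0
      rw [h3, add_zero]
    have h2 := hp _ h1
    have h3 : p.2 0 = 0 := map_zero p.2
    change ζ p.1 + p.2 0 = 0 at h2
    erw [h3] at h2
    exact (hζ ((add_zero _).symm.trans h2)).elim

end Isotropic

/-! ### Fibrewise comparison of `f^!L` and `𝔅L`. -/

section Backward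

variable {EB : Type*} [NormedAddCommGroup EB] [NormedSpace ℝ EB]
  {B : Type*} [TopologicalSpace B] [ChartedSpace EB B] [IsManifold 𝓘(ℝ, EB) ∞ B]
  {EM : Type*} [NormedAddCommGroup EM] [NormedSpace ℝ EM]
  {M : Type*} [TopologicalSpace M] [ChartedSpace EM M] [IsManifold 𝓘(ℝ, EM) ∞ M]
  {f : C^∞⟮𝓘(ℝ, EB), B; 𝓘(ℝ, EM), M⟯} {L : ∀ y : M, Submodule ℝ (GenTangent EM y)}

/-- An element of the kernel is `((0, η), 0)` with `f^*η = 0`. Such an `η` vanishes on `f_*(TB)`,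
and on `pr(L)` because `(0, η)` is orthogonal to `L`; by transversality these two spaces span. -/
theorem pullbackToBackward_bijective (hL : ∀ y, IsIsotropic (L y))
    (hf : IsTransverse f (diracAnchor L)) (x : B) :
    Function.Bijective (pullbackToBackward f L x) := by
  constructor
  · rw [injective_iff_map_eq_zero]
    rintro ⟨⟨⟨Y, η⟩, X⟩, h, h'⟩ hp
    change Y = mfderiv 𝓘(ℝ, EB) 𝓘(ℝ, EM) f x X at h'
    obtain ⟨h1, h2⟩ := Prod.ext_iff.1 (congrArg Subtype.val hp)
    change X = 0 at h1
    subst h1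
    rw [map_zero] at h'
    subst h'
    have h3 : η = 0 := by
      ext v
      obtain ⟨a, ⟨ℓ, rfl⟩, b, ⟨X, rfl⟩, rfl⟩ := Submodule.mem_sup.1
        (hf x ▸ Submodule.mem_top : v ∈ _)
      have h4 : η (mfderiv 𝓘(ℝ, EB) 𝓘(ℝ, EM) f x X) = 0 :=
        congrArg (fun T : EB →L[ℝ] ℝ => T X) h2
      have h5 : η ℓ.1.1 = 0 := by
        have h6 := hL _ _ h _ ℓ.2
        have h7 : ℓ.1.2 0 = 0 := map_zero ℓ.1.2
        change ℓ.1.2 0 + η ℓ.1.1 = 0 at h6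
        erw [h7] at h6
        exact (zero_add _).symm.trans h6
      refine (map_add η _ _).trans ?_
      change η ℓ.1.1 + η (mfderiv 𝓘(ℝ, EB) 𝓘(ℝ, EM) f x X) = 0
      rw [h4, h5]
      exact add_zero _
    subst h3
    rfl
  · rintro ⟨⟨X, θ⟩, η, hη, hθ⟩
    exact ⟨⟨((mfderiv 𝓘(ℝ, EB) 𝓘(ℝ, EM) f x X, η), X), hη, rfl⟩,
      Subtype.ext (Prod.ext rfl hθ.symm)⟩

variable [FiniteDimensional ℝ EB] [FiniteDimensional ℝ EM]

/-- Smoothness of `f^*η` is tested on fields `W`, where its value is `η(f_*W)`. -/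
theorem isSmoothBundleMap_pullbackToBackward :
    IsSmoothBundleMap EB ((EM × (EM →L[ℝ] ℝ)) × EB) (EB × (EB →L[ℝ] ℝ))
      (fun x => (backwardPullback f L x).subtype ∘ₗ pullbackToBackward f L x) := by
  intro U σ hU h x hx
  obtain ⟨h1, h2⟩ := contMDiffAt_prod_section_iff.1 (h.contMDiffAt (hU.mem_nhds hx))
  have h3 := (contMDiffAt_prod_along_iff.1 ((contMDiffAt_pullback_section_iff f).1 h1)).2
  refine ContMDiffAt.contMDiffWithinAt (smoothGenAt_iff.2 ⟨h2, smoothFormAt_iff.2 fun W hW => ?_⟩)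
  exact h3.cotangent_apply (ContMDiffAt.mfderiv_apply_field f.contMDiff.contMDiffAt
    (hW.contMDiffAt (chart_source_mem_nhds _ _)))

/-- Let `p = (X, θ)` lie in an isotropic `W` containing `𝔅L`. Membership in `𝔅L` needs a covector
`η` with `f^*η = θ` and `(f_*X, η)` orthogonal to `L`. These conditions prescribe `η` on `f_*(TB)`
and on `pr(L)`, which span by transversality. The prescriptions agree on the overlap exactly because
`p` is orthogonal to `𝔅L`. Finally, `L` contains its own orthogonal complement. -/
theorem maximal_isotropic_backwardPullback (hL : ∀ y, Maximal IsIsotropic (L y))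
    (hf : IsTransverse f (diracAnchor L)) (x : B) :
    Maximal IsIsotropic (backwardPullback f L x) := by
  refine ⟨?_, fun W hW hle p hp => ?_⟩
  · rintro ⟨X, _⟩ ⟨η, hη, rfl⟩ ⟨X', _⟩ ⟨η', hη', rfl⟩
    exact (hL (f x)).1 _ hη _ hη'
  have : FiniteDimensional ℝ (TangentSpace 𝓘(ℝ, EM) (f x)) :=
    inferInstanceAs (FiniteDimensional ℝ EM)
  have : T2Space (TangentSpace 𝓘(ℝ, EM) (f x)) := inferInstanceAs (T2Space EM)
  let D := mfderiv 𝓘(ℝ, EB) 𝓘(ℝ, EM) f x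
  -- `T (ℓ, X) = pr(ℓ) + f_*X` is onto, and `φ` is the value that `η` must take there; `φ` vanishing
  -- on `ker T` is the compatibility of the two prescriptions.
  let T : L (f x) × TangentSpace 𝓘(ℝ, EB) x →ₗ[ℝ] TangentSpace 𝓘(ℝ, EM) (f x) :=
    (diracAnchor L (f x)).coprod D.toLinearMap
  let ev : L (f x) →ₗ[ℝ] ℝ :=
    { toFun := fun ℓ => ℓ.1.2 (D p.1)
      map_add' := fun _ _ => rfl
      map_smul' := fun _ _ => rfl }
  let φ : L (f x) × TangentSpace 𝓘(ℝ, EB) x →ₗ[ℝ] ℝ := (-ev).coprod p.2.toLinearMap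
  have hφ : ∀ w, T w = 0 → φ w = 0 := by
    rintro ⟨⟨⟨Y, η⟩, hη⟩, X⟩ hw
    have h1 : Y + D X = 0 := hw
    have h2 : Y = D (-X) := (eq_neg_of_add_eq_zero_left h1).trans (map_neg D X).symm
    subst h2
    have h3 : ((-X, pullbackCovector f x η) : GenTangent EB x) ∈ backwardPullback f L x :=
      ⟨η, hη, rfl⟩
    have h4 := hW p hp _ (hle h3)
    change η (D p.1) + p.2 (-X) = 0 at h4
    have h5 : p.2 (-X) = - p.2 X := map_neg p.2 X
    erw [h5] at h4
    change -(η (D p.1)) + p.2 X = 0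
    have h6 : ∀ a b : ℝ, a + -b = 0 → -a + b = 0 := fun a b h => by linarith
    exact h6 _ _ h4
  have hT : LinearMap.range T = ⊤ := by
    rw [LinearMap.range_coprod]
    exact hf x
  obtain ⟨η', hη'⟩ := LinearMap.exists_factor_of_surjective (K := ℝ)
    (V := L (f x) × TangentSpace 𝓘(ℝ, EB) x) (W := TangentSpace 𝓘(ℝ, EM) (f x))
    (U := ℝ) (T := T) (φ := φ) hT hφ
  obtain ⟨η, hη⟩ : ∃ η : CotangentFiber EM (f x), ∀ w, η (T w) = φ w :=
    ⟨LinearMap.toContinuousLinearMap η', hη'⟩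
  refine ⟨η, mem_of_maximal_isotropic (hL (f x)) fun ℓ hℓ => ?_, ?_⟩
  · have h1 := hη (⟨ℓ, hℓ⟩, 0)
    have h2 : T (⟨ℓ, hℓ⟩, 0) = ℓ.1 := by
      change ℓ.1 + D 0 = ℓ.1
      rw [map_zero, add_zero]
    have h3 : φ (⟨ℓ, hℓ⟩, 0) = -(ℓ.2 (D p.1)) := by
      have : p.2 0 = 0 := map_zero p.2
      change -(ℓ.2 (D p.1)) + p.2 0 = _
      erw [this]
      exact add_zero _
    rw [h2, h3] at h1
    change ℓ.2 (D p.1) + η ℓ.1 = 0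
    erw [h1]
    exact add_neg_cancel _
  · ext v
    have h1 := hη (0, v)
    have h2 : T (0, v) = D v := zero_add _
    have h3 : φ (0, v) = p.2 v := by
      change -(0 : ℝ) + p.2 v = _
      rw [neg_zero]
      exact zero_add _
    rw [h2, h3] at h1
    exact h1.symm

end Backward

/-! ### The exterior derivative: products, sums and pullbacks. -/

section ExteriorDerivative

variable {E : Type*} [NormedAddCommGroup E] [NormedSpace ℝ E]
  {M : Type*} [TopologicalSpace M] [ChartedSpace E M] [IsManifold 𝓘(ℝ, E) ∞ M]

theorem extDerivOneForm_apply_tangent (ξ : ∀ x : M, CotangentFiber E x) (x : M)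
    (u v : TangentSpace 𝓘(ℝ, E) x) :
    extDerivOneForm ξ x u v =
      fderiv ℝ (chartForm x ξ) (extChartAt 𝓘(ℝ, E) x x) u v
       - fderiv ℝ (chartForm x ξ) (extChartAt 𝓘(ℝ, E) x x) v u :=
  extDerivOneForm_apply ξ x u v

theorem extDerivOneForm_funSmul {h : M → ℝ} {ξ : ∀ x : M, CotangentFiber E x} {x : M}
    (hh : MDifferentiableAt 𝓘(ℝ, E) 𝓘(ℝ, ℝ) h x) (hξ : SmoothFormAt ξ x)
    (u v : TangentSpace 𝓘(ℝ, E) x) :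
    extDerivOneForm (fun y => h y • ξ y) x u v =
      h x * extDerivOneForm ξ x u v + funDifferential h x u * ξ x v -
        funDifferential h x v * ξ x u := by
  have h1 : chartForm x (fun y => h y • ξ y) =
      fun z => h ((extChartAt 𝓘(ℝ, E) x).symm z) • chartForm x ξ z := rfl
  have hh' := differentiableAt_comp_extChartAt_symm hh
  have h2 := (hh'.hasFDerivAt.fun_smul (differentiableAt_chartForm hξ).hasFDerivAt).fderiv
  have h3 : ∀ w : E, funDifferential h x w =
      fderiv ℝ (fun z => h ((extChartAt 𝓘(ℝ, E) x).symm z)) (extChartAt 𝓘(ℝ, E) x x) w := fun w =>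
    congrArg (fun T : E →L[ℝ] ℝ => T w) (funDifferential_eq_fderiv hh)
  rw [extDerivOneForm_apply_tangent, extDerivOneForm_apply_tangent, h1, h2]
  erw [h3, h3]
  have h6 : ∀ (a b : ℝ) (D : E →L[ℝ] E →L[ℝ] ℝ) (d : E →L[ℝ] ℝ) (χ χ' : E →L[ℝ] ℝ) (u v : E),
      b = a → χ' = χ →
      (b • D + d.smulRight χ') u v - (b • D + d.smulRight χ') v u =
        a * (D u v - D v u) + d u * χ v - d v * χ u := by
    rintro a _ D d χ _ u v rfl rfl
    simp only [add_apply, smul_apply,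
      ContinuousLinearMap.smulRight_apply, smul_eq_mul]
    ring
  exact h6 _ _ _ _ _ _ _ _ (by rw [extChartAt_to_inv x]) (chartForm_self ξ x)

theorem extDerivOneForm_sum {ι : Type*} (s : Finset ι) {ξ : ι → ∀ x : M, CotangentFiber E x} {x : M}
    (hξ : ∀ i, SmoothFormAt (ξ i) x) (u v : TangentSpace 𝓘(ℝ, E) x) :
    extDerivOneForm (fun y => ∑ i ∈ s, ξ i y) x u v = ∑ i ∈ s, extDerivOneForm (ξ i) x u v := by
  have h1 : chartForm x (fun y => ∑ i ∈ s, ξ i y) = fun z => ∑ i ∈ s, chartForm x (ξ i) z := by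
    funext z
    ext w
    simp only [chartForm]
    have h : ∀ (D : ι → E →L[ℝ] ℝ) (w : E), (∑ i ∈ s, D i) w = ∑ i ∈ s, D i w := by simp
    exact (h _ _).trans (h (fun i => chartForm x (ξ i) z) w).symm
  have h2 := fderiv_fun_sum (u := s) fun i _ => differentiableAt_chartForm (hξ i)
  have h3 : ∀ (D : ι → E →L[ℝ] E →L[ℝ] ℝ) (v w : E),
      (∑ i ∈ s, D i) v w = ∑ i ∈ s, D i v w := by simp
  simp only [extDerivOneForm_apply_tangent]
  rw [h1, h2, Finset.sum_sub_distrib]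
  erw [h3, h3]

variable {EB : Type*} [NormedAddCommGroup EB] [NormedSpace ℝ EB]
  {B : Type*} [TopologicalSpace B] [ChartedSpace EB B] [IsManifold 𝓘(ℝ, EB) ∞ B]

/-- Reduces pullback on manifolds to pullback under the coordinate expression of `f`. The identity
holds near the base point, not merely at it, because it is to be differentiated. -/
theorem chartForm_pullback (f : C^∞⟮𝓘(ℝ, EB), B; 𝓘(ℝ, E), M⟯) (η : ∀ y : M, CotangentFiber E y)
    (x : B) :
    ∀ᶠ z in 𝓝 (extChartAt 𝓘(ℝ, EB) x x),
      chartForm x (fun y => pullbackCovector f y (η (f y))) z =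
        (chartForm (f x) η (writtenInExtChartAt 𝓘(ℝ, EB) 𝓘(ℝ, E) x f z)).comp
          (fderiv ℝ (writtenInExtChartAt 𝓘(ℝ, EB) 𝓘(ℝ, E) x f) z) := by
  let cB := extChartAt 𝓘(ℝ, EB) x
  let cM := extChartAt 𝓘(ℝ, E) (f x)
  let F := writtenInExtChartAt 𝓘(ℝ, EB) 𝓘(ℝ, E) x f
  have hc : ContinuousAt (fun z => f (cB.symm z)) (cB x) :=
    f.contMDiff.continuous.continuousAt.comp (continuousAt_extChartAt_symm x)
  have h1 : ∀ᶠ z in 𝓝 (cB x), f (cB.symm z) ∈ cM.source := by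
    refine hc.eventually ?_
    change ∀ᶠ y in 𝓝 (f ((extChartAt 𝓘(ℝ, EB) x).symm (extChartAt 𝓘(ℝ, EB) x x))), _
    rw [extChartAt_to_inv x]
    exact extChartAt_source_mem_nhds (I := 𝓘(ℝ, E)) (f x)
  filter_upwards [h1.eventually_nhds, extChartAt_target_mem_nhds x] with z hz hzt
  have hz0 := hz.self_of_nhds
  have hF : cM.symm (F z) = f (cB.symm z) := cM.left_inv hz0
  have hFz : F z ∈ cM.target := cM.map_source hz0
  have hsB := mdifferentiableAt_extChartAt_symm hzt
  have hsM := mdifferentiableAt_extChartAt_symm hFz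
  have hf : MDifferentiableAt 𝓘(ℝ, EB) 𝓘(ℝ, E) f (cB.symm z) := f.mdifferentiableAt
  have hcM : MDifferentiableAt 𝓘(ℝ, E) 𝓘(ℝ, E) cM (f (cB.symm z)) := by
    refine mdifferentiableAt_extChartAt ?_
    rwa [extChartAt_source] at hz0
  have hFd : MDifferentiableAt 𝓘(ℝ, EB) 𝓘(ℝ, E) F z := hcM.comp z (hf.comp z hsB)
  have h2 : mfderiv 𝓘(ℝ, EB) 𝓘(ℝ, E) (fun w => f (cB.symm w)) z =
      (mfderiv 𝓘(ℝ, EB) 𝓘(ℝ, E) f (cB.symm z)).comp (mfderiv 𝓘(ℝ, EB) 𝓘(ℝ, EB) cB.symm z) :=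
    mfderiv_comp z hf hsB
  have h3 : mfderiv 𝓘(ℝ, EB) 𝓘(ℝ, E) (fun w => cM.symm (F w)) z =
      (mfderiv 𝓘(ℝ, E) 𝓘(ℝ, E) cM.symm (F z)).comp (mfderiv 𝓘(ℝ, EB) 𝓘(ℝ, E) F z) :=
    mfderiv_comp z hsM hFd
  have h4 : (fun w => cM.symm (F w)) =ᶠ[𝓝 z] fun w => f (cB.symm w) := by
    filter_upwards [hz] with w hw
    exact cM.left_inv hw
  have h5 : (show EB →L[ℝ] E from mfderiv 𝓘(ℝ, EB) 𝓘(ℝ, E) f (cB.symm z)).comp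
      (chartSymmDeriv x z) =
      (chartSymmDeriv (f x) (F z)).comp (fderiv ℝ F z) := by
    rw [← mfderiv_eq_fderiv]
    exact h2.symm.trans ((h4.mfderiv_eq).symm.trans h3)
  have h6 : (show E →L[ℝ] ℝ from η (cM.symm (F z))) = (show E →L[ℝ] ℝ from η (f (cB.symm z))) :=
    congrArg (fun p => (show E →L[ℝ] ℝ from η p)) hF
  have h7 : chartForm x (fun y => pullbackCovector f y (η (f y))) z =
    (show E →L[ℝ] ℝ from η (f (cB.symm z))).comp
      ((show EB →L[ℝ] E from mfderiv 𝓘(ℝ, EB) 𝓘(ℝ, E) f (cB.symm z)).comp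
        (chartSymmDeriv x z)) := rfl
  rw [h7, h5, ← h6]
  rfl

/-- The exterior derivative commutes with pullbacks. -/
theorem extDerivOneForm_pullback (f : C^∞⟮𝓘(ℝ, EB), B; 𝓘(ℝ, E), M⟯)
    {η : ∀ y : M, CotangentFiber E y} {x : B} (hη : SmoothFormAt η (f x))
    (u v : TangentSpace 𝓘(ℝ, EB) x) :
    extDerivOneForm (fun y => pullbackCovector f y (η (f y))) x u v =
      extDerivOneForm η (f x) (mfderiv 𝓘(ℝ, EB) 𝓘(ℝ, E) f x u)
        (mfderiv 𝓘(ℝ, EB) 𝓘(ℝ, E) f x v) := by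
  let z₀ := extChartAt 𝓘(ℝ, EB) x x
  let F := writtenInExtChartAt 𝓘(ℝ, EB) 𝓘(ℝ, E) x f
  have hF0 : F z₀ = extChartAt 𝓘(ℝ, E) (f x) (f x) := by
    change extChartAt 𝓘(ℝ, E) (f x) (f ((extChartAt 𝓘(ℝ, EB) x).symm z₀)) = _
    rw [extChartAt_to_inv x]
  have hF : ContDiffAt ℝ ∞ F z₀ := by
    have := (contMDiffAt_iff.1 (f.contMDiff x)).2
    rwa [modelWithCornersSelf_coe, Set.range_id, contDiffWithinAt_univ] at this
  have hD : (mfderiv 𝓘(ℝ, EB) 𝓘(ℝ, E) f x : EB →L[ℝ] E) = fderiv ℝ F z₀ := by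
    have : MDifferentiableAt 𝓘(ℝ, EB) 𝓘(ℝ, E) f x := f.mdifferentiableAt
    have h1 := this.mfderiv
    rwa [modelWithCornersSelf_coe, Set.range_id, fderivWithin_univ] at h1
  have hη' : DifferentiableAt ℝ (chartForm (f x) η) (F z₀) := hF0 ▸ differentiableAt_chartForm hη
  have hF' : DifferentiableAt ℝ (fderiv ℝ F) z₀ :=
    (hF.fderiv_right (m := 1) (by
      rw [one_add_one_eq_two]
      exact ENat.LEInfty.out)).differentiableAt (by simp)
  have h1 := (Filter.EventuallyEq.fderiv_eq (𝕜 := ℝ) (chartForm_pullback f η x)).trans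
    ((hη'.hasFDerivAt.comp z₀ (hF.differentiableAt (by simp)).hasFDerivAt).clm_comp
      hF'.hasFDerivAt).fderiv
  -- Differentiating the pulled back form produces an extra term with the second derivative of `F`;
  -- its symmetry removes that term from the antisymmetrization.
  have hsymm : ∀ a b : EB, fderiv ℝ (fderiv ℝ F) z₀ a b = fderiv ℝ (fderiv ℝ F) z₀ b a :=
    hF.isSymmSndFDerivAt (by rw [minSmoothness_of_isRCLikeNormedField]; exact ENat.LEInfty.out)
  have h2 : ∀ a b : EB, fderiv ℝ (chartForm x fun y => pullbackCovector f y (η (f y))) z₀ a b =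
      chartForm (f x) η (F z₀) (fderiv ℝ (fderiv ℝ F) z₀ a b) +
        fderiv ℝ (chartForm (f x) η) (F z₀) (fderiv ℝ F z₀ a) (fderiv ℝ F z₀ b) := by
    intro a b
    rw [h1]
    rfl
  rw [extDerivOneForm_apply_tangent, extDerivOneForm_apply_tangent]
  have h3 : ∀ w : EB, (mfderiv 𝓘(ℝ, EB) 𝓘(ℝ, E) f x : EB →L[ℝ] E) w = fderiv ℝ F z₀ w := fun w =>
    congrArg (fun T : EB →L[ℝ] E => T w) hD
  erw [h2, h2, h3, h3, hF0, hsymm v u]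
  ring

theorem SmoothFormAt.pullback [FiniteDimensional ℝ EB] (f : C^∞⟮𝓘(ℝ, EB), B; 𝓘(ℝ, E), M⟯)
    {η : ∀ y : M, CotangentFiber E y} {x : B} (hη : SmoothFormAt η (f x)) :
    SmoothFormAt (fun y => pullbackCovector f y (η (f y))) x :=
  smoothFormAt_iff.2 fun _ hW => ContMDiffAt.cotangent_apply (b := f) (ξ := fun y => η (f y))
    (hη.comp x f.contMDiff.contMDiffAt)
    (ContMDiffAt.mfderiv_apply_field f.contMDiff.contMDiffAt
      (hW.contMDiffAt (chart_source_mem_nhds _ _)))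

theorem SmoothFormAt.funSmul {h : M → ℝ} {ξ : ∀ x : M, CotangentFiber E x} {x : M}
    (hh : ContMDiffAt 𝓘(ℝ, E) 𝓘(ℝ, ℝ) ∞ h x) (hξ : SmoothFormAt ξ x) :
    SmoothFormAt (fun y => h y • ξ y) x :=
  hh.smul_section hξ

end ExteriorDerivative

/-! ### Brackets of fields which `f` pushes to combinations of fields on `M`. -/

section Expansion

variable {EB : Type*} [NormedAddCommGroup EB] [NormedSpace ℝ EB] [FiniteDimensional ℝ EB]
  {B : Type*} [TopologicalSpace B] [ChartedSpace EB B] [IsManifold 𝓘(ℝ, EB) ∞ B]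
  {EM : Type*} [NormedAddCommGroup EM] [NormedSpace ℝ EM] [FiniteDimensional ℝ EM]
  {M : Type*} [TopologicalSpace M] [ChartedSpace EM M] [IsManifold 𝓘(ℝ, EM) ∞ M]

/-- Tangent vectors are determined by their action on functions. -/
theorem tangent_ext {y : M} {v w : TangentSpace 𝓘(ℝ, EM) y}
    (h : ∀ g : M → ℝ, (∀ᶠ z in 𝓝 y, ContMDiffAt 𝓘(ℝ, EM) 𝓘(ℝ, ℝ) ∞ g z) →
      funDifferential g y v = funDifferential g y w) : v = w := by
  have h1 : ∀ ℓ : EM →L[ℝ] ℝ, ℓ v = ℓ w := by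
    intro ℓ
    let g : M → ℝ := fun z => ℓ (extChartAt 𝓘(ℝ, EM) y z)
    have hg : ∀ z ∈ (chartAt EM y).source, ContMDiffAt 𝓘(ℝ, EM) 𝓘(ℝ, ℝ) ∞ g z := fun z hz =>
      ℓ.contMDiff.contMDiffAt.comp z (contMDiffAt_extChartAt' hz)
    have h2 := h g (Filter.mem_of_superset (chart_source_mem_nhds EM y) hg)
    have h3 : (funDifferential (E := EM) g y : EM →L[ℝ] ℝ) = ℓ := by
      rw [funDifferential_eq_fderiv
        ((hg y (mem_chart_source EM y)).mdifferentiableAt (by simp))]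
      have h4 : g ∘ (extChartAt 𝓘(ℝ, EM) y).symm =ᶠ[𝓝 (extChartAt 𝓘(ℝ, EM) y y)] ℓ := by
        filter_upwards [extChartAt_target_mem_nhds y] with z hz
        exact congrArg ℓ ((extChartAt 𝓘(ℝ, EM) y).right_inv hz)
      rw [h4.fderiv_eq, ℓ.fderiv]
    have h5 : ∀ u : EM, funDifferential g y u = ℓ u := fun u =>
      congrArg (fun T : EM →L[ℝ] ℝ => T u) h3
    exact (h5 v).symm.trans (h2.trans (h5 w))
  have h2 : (show EM from v) = w := by
    by_contra hne
    obtain ⟨ℓ, hℓ⟩ := SeparatingDual.exists_separating_of_ne (R := ℝ) hne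
    exact hℓ (h1 ℓ)
  exact h2

variable (f : C^∞⟮𝓘(ℝ, EB), B; 𝓘(ℝ, EM), M⟯) {m n : ℕ}
  {h : Fin m → B → ℝ} {h' : Fin n → B → ℝ} {x : B}

theorem funDifferential_sum_mul_comp {ι : Type*} [Fintype ι] {h : ι → B → ℝ} {u : ι → M → ℝ}
    (hh : ∀ i, ContMDiffAt 𝓘(ℝ, EB) 𝓘(ℝ, ℝ) ∞ (h i) x)
    (hu : ∀ i, ContMDiffAt 𝓘(ℝ, EM) 𝓘(ℝ, ℝ) ∞ (u i) (f x)) (v : TangentSpace 𝓘(ℝ, EB) x) :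
    funDifferential (fun y => ∑ i, h i y * u i (f y)) x v =
      ∑ i, (h i x * funDifferential (u i) (f x) (mfderiv 𝓘(ℝ, EB) 𝓘(ℝ, EM) f x v) +
        u i (f x) * funDifferential (h i) x v) := by
  have hh' : ∀ i, MDifferentiableAt 𝓘(ℝ, EB) 𝓘(ℝ, ℝ) (h i) x := fun i =>
    (hh i).mdifferentiableAt (by simp)
  have hu' : ∀ i, MDifferentiableAt 𝓘(ℝ, EM) 𝓘(ℝ, ℝ) (u i) (f x) := fun i =>
    (hu i).mdifferentiableAt (by simp)
  have huf : ∀ i, MDifferentiableAt 𝓘(ℝ, EB) 𝓘(ℝ, ℝ) (fun y => u i (f y)) x := fun i =>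
    (hu' i).comp x f.mdifferentiableAt
  rw [funDifferential_sum Finset.univ (g := fun i y => h i y * u i (f y))
    (fun i => ((hh' i).mul (huf i)))]
  refine Finset.sum_congr rfl fun i _ => ?_
  rw [funDifferential_mul (hh' i) (huf i), funDifferential_comp (hu' i) f.mdifferentiableAt]

/-- Both sides are tested on a function `g` on `M`. Since `X'(g ∘ f) = ∑ h'_j · (Y'_j g) ∘ f` near
`x`, a further derivative along `X` falls either on `h'_j` or on `Y'_j g`, where it acts through
`f_*X = ∑ h_i Y_i`. The commutator of second derivatives then gives the brackets `[Y_i, Y'_j]`. -/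
theorem mfderiv_mlieBracket_eq_sum {X X' : ∀ y : B, TangentSpace 𝓘(ℝ, EB) y}
    {Y : Fin m → ∀ z : M, TangentSpace 𝓘(ℝ, EM) z} {Y' : Fin n → ∀ z : M, TangentSpace 𝓘(ℝ, EM) z}
    (hh : ∀ i, ContMDiffAt 𝓘(ℝ, EB) 𝓘(ℝ, ℝ) ∞ (h i) x)
    (hh' : ∀ j, ContMDiffAt 𝓘(ℝ, EB) 𝓘(ℝ, ℝ) ∞ (h' j) x)
    (hX : SmoothFieldAt X x) (hX' : SmoothFieldAt X' x)
    (hY : ∀ i, SmoothFieldAt (Y i) (f x)) (hY' : ∀ j, SmoothFieldAt (Y' j) (f x))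
    (e : ∀ᶠ y in 𝓝 x, mfderiv 𝓘(ℝ, EB) 𝓘(ℝ, EM) f y (X y) = ∑ i, h i y • Y i (f y))
    (e' : ∀ᶠ y in 𝓝 x, mfderiv 𝓘(ℝ, EB) 𝓘(ℝ, EM) f y (X' y) = ∑ j, h' j y • Y' j (f y)) :
    mfderiv 𝓘(ℝ, EB) 𝓘(ℝ, EM) f x (VectorField.mlieBracket 𝓘(ℝ, EB) X X' x) =
      (∑ i, ∑ j, (h i x * h' j x) • VectorField.mlieBracket 𝓘(ℝ, EM) (Y i) (Y' j) (f x)) +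
      (∑ j, funDifferential (h' j) x (X x) • Y' j (f x)) -
      (∑ i, funDifferential (h i) x (X' x) • Y i (f x)) := by
  refine tangent_ext fun g hg => ?_
  have hgx := hg.self_of_nhds
  have hgf : ContMDiffAt 𝓘(ℝ, EB) 𝓘(ℝ, ℝ) ∞ (fun y => g (f y)) x :=
    hgx.comp x f.contMDiff.contMDiffAt
  have key : ∀ {k : ℕ} {c : Fin k → B → ℝ} {Z : ∀ y : B, TangentSpace 𝓘(ℝ, EB) y}
      {U : Fin k → ∀ z : M, TangentSpace 𝓘(ℝ, EM) z} (X : ∀ y : B, TangentSpace 𝓘(ℝ, EB) y),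
      (∀ i, ContMDiffAt 𝓘(ℝ, EB) 𝓘(ℝ, ℝ) ∞ (c i) x) → (∀ i, SmoothFieldAt (U i) (f x)) →
      (∀ᶠ y in 𝓝 x, mfderiv 𝓘(ℝ, EB) 𝓘(ℝ, EM) f y (Z y) = ∑ i, c i y • U i (f y)) →
      fieldDeriv X (fieldDeriv Z fun y => g (f y)) x =
        ∑ j, (c j x * funDifferential (fieldDeriv (U j) g) (f x)
          (mfderiv 𝓘(ℝ, EB) 𝓘(ℝ, EM) f x (X x)) +
          funDifferential g (f x) (U j (f x)) * funDifferential (c j) x (X x)) := by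
    intro k c Z U X hc hU hZ
    rw [← funDifferential_sum_mul_comp f (u := fun j => fieldDeriv (U j) g) hc
      fun i => ContMDiffAt.funDifferential_apply hgx (hU i)]
    refine fieldDeriv_congr ?_
    filter_upwards [hZ, f.contMDiff.continuous.continuousAt.eventually hg] with y hy hgy
    change funDifferential (fun y => g (f y)) y (Z y) = _
    rw [funDifferential_comp (hgy.mdifferentiableAt (by simp)) f.mdifferentiableAt, hy]
    erw [map_sum]
    refine Finset.sum_congr rfl fun i _ => ?_
    exact map_smul (funDifferential g (f y)) _ _
  rw [← funDifferential_comp (hgx.mdifferentiableAt (by simp)) f.mdifferentiableAt]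
  have h1 := fieldDeriv_mlieBracket hgf hX hX'
  rw [key X hh' hY' e', key X' hh hY e, e.self_of_nhds, e'.self_of_nhds] at h1
  refine h1.trans ?_
  have hbr : ∀ i j, funDifferential g (f x) (VectorField.mlieBracket 𝓘(ℝ, EM) (Y i) (Y' j) (f x)) =
      funDifferential (fieldDeriv (Y' j) g) (f x) (Y i (f x)) -
        funDifferential (fieldDeriv (Y i) g) (f x) (Y' j (f x)) := fun i j =>
    fieldDeriv_mlieBracket hgx (hY i) (hY' j)
  have lin : ∀ (u : M → ℝ) {k : ℕ} (c : Fin k → ℝ) (V : Fin k → TangentSpace 𝓘(ℝ, EM) (f x)),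
      funDifferential u (f x) (∑ i, c i • V i) = ∑ i, c i * funDifferential u (f x) (V i) := by
    intro u k c V
    erw [map_sum]
    exact Finset.sum_congr rfl fun i _ => map_smul (funDifferential u (f x)) _ _
  erw [map_sub, map_add, map_sum]
  simp only [lin, hbr]
  have a1 : ∑ j, (h' j x * ∑ i, h i x * funDifferential (fieldDeriv (Y' j) g) (f x) (Y i (f x)) +
      funDifferential g (f x) (Y' j (f x)) * funDifferential (h' j) x (X x)) =
      ∑ i, ∑ j, h i x * h' j x * funDifferential (fieldDeriv (Y' j) g) (f x) (Y i (f x)) +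
      ∑ j, funDifferential (h' j) x (X x) * funDifferential g (f x) (Y' j (f x)) := by
    rw [Finset.sum_add_distrib, Finset.sum_comm]
    congr 1
    · refine Finset.sum_congr rfl fun j _ => ?_
      rw [Finset.mul_sum]
      exact Finset.sum_congr rfl fun i _ => by ring
    · exact Finset.sum_congr rfl fun j _ => by ring
  have a2 : ∑ i, (h i x * ∑ j, h' j x * funDifferential (fieldDeriv (Y i) g) (f x) (Y' j (f x)) +
      funDifferential g (f x) (Y i (f x)) * funDifferential (h i) x (X' x)) =
      ∑ i, ∑ j, h i x * h' j x * funDifferential (fieldDeriv (Y i) g) (f x) (Y' j (f x)) +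
      ∑ i, funDifferential (h i) x (X' x) * funDifferential g (f x) (Y i (f x)) := by
    rw [Finset.sum_add_distrib]
    congr 1
    · refine Finset.sum_congr rfl fun j _ => ?_
      rw [Finset.mul_sum]
      exact Finset.sum_congr rfl fun i _ => by ring
    · exact Finset.sum_congr rfl fun j _ => by ring
  rw [a1, a2]
  simp only [mul_sub, Finset.sum_sub_distrib]
  ring

theorem extDerivOneForm_sum_smul_pullback {η : Fin m → ∀ z : M, CotangentFiber EM z}
    (hh : ∀ i, ContMDiffAt 𝓘(ℝ, EB) 𝓘(ℝ, ℝ) ∞ (h i) x) (hη : ∀ i, SmoothFormAt (η i) (f x))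
    (u v : TangentSpace 𝓘(ℝ, EB) x) :
    extDerivOneForm (fun y => ∑ i, h i y • pullbackCovector f y (η i (f y))) x u v =
      ∑ i, (h i x * extDerivOneForm (η i) (f x) (mfderiv 𝓘(ℝ, EB) 𝓘(ℝ, EM) f x u)
          (mfderiv 𝓘(ℝ, EB) 𝓘(ℝ, EM) f x v) +
        funDifferential (h i) x u * η i (f x) (mfderiv 𝓘(ℝ, EB) 𝓘(ℝ, EM) f x v) -
        funDifferential (h i) x v * η i (f x) (mfderiv 𝓘(ℝ, EB) 𝓘(ℝ, EM) f x u)) := by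
  rw [extDerivOneForm_sum Finset.univ fun i => SmoothFormAt.funSmul (hh i) ((hη i).pullback f)]
  refine Finset.sum_congr rfl fun i _ => ?_
  rw [extDerivOneForm_funSmul ((hh i).mdifferentiableAt (by simp)) ((hη i).pullback f),
    extDerivOneForm_pullback f (hη i)]
  rfl

end Expansion

/-! ### The covector part of the Courant bracket in terms of an expansion. -/

section Expansion

variable {EB : Type*} [NormedAddCommGroup EB] [NormedSpace ℝ EB] [FiniteDimensional ℝ EB]
  {B : Type*} [TopologicalSpace B] [ChartedSpace EB B] [IsManifold 𝓘(ℝ, EB) ∞ B]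
  {EM : Type*} [NormedAddCommGroup EM] [NormedSpace ℝ EM] [FiniteDimensional ℝ EM]
  {M : Type*} [TopologicalSpace M] [ChartedSpace EM M] [IsManifold 𝓘(ℝ, EM) ∞ M]
  (f : C^∞⟮𝓘(ℝ, EB), B; 𝓘(ℝ, EM), M⟯) {m n : ℕ}
  {h : Fin m → B → ℝ} {h' : Fin n → B → ℝ} {x : B}

theorem cotangent_apply_sum_smul {y : M} (η : CotangentFiber EM y) (c : Fin m → ℝ)
    (V : Fin m → TangentSpace 𝓘(ℝ, EM) y) : η (∑ i, c i • V i) = ∑ i, c i * η (V i) := by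
  have : ∀ (T : EM →L[ℝ] ℝ) (V : Fin m → EM), T (∑ i, c i • V i) = ∑ i, c i * T (V i) := by simp
  exact this η V

theorem cotangent_sum_smul_apply {y : M} (η : Fin m → CotangentFiber EM y) (c : Fin m → ℝ)
    (v : TangentSpace 𝓘(ℝ, EM) y) :
    (∑ i, c i • η i : CotangentFiber EM y) v = ∑ i, c i * η i v := by
  have : ∀ (T : Fin m → EM →L[ℝ] ℝ) (v : EM), (∑ i, c i • T i) v = ∑ i, c i * T i v := by simp
  exact this η v

theorem cotangent_combination_apply {y : M} (T : Fin m → Fin n → CotangentFiber EM y)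
    (c : Fin m → Fin n → ℝ) (T₂ : Fin n → CotangentFiber EM y) (c₂ : Fin n → ℝ)
    (T₃ : Fin m → CotangentFiber EM y) (c₃ : Fin m → ℝ) (v : TangentSpace 𝓘(ℝ, EM) y) :
    ((∑ i, ∑ j, c i j • T i j) + (∑ j, c₂ j • T₂ j) - (∑ i, c₃ i • T₃ i) : CotangentFiber EM y) v =
      (∑ i, ∑ j, c i j * T i j v) + (∑ j, c₂ j * T₂ j v) - (∑ i, c₃ i * T₃ i v) := by
  have : ∀ (T : Fin m → Fin n → EM →L[ℝ] ℝ) (T₂ : Fin n → EM →L[ℝ] ℝ) (T₃ : Fin m → EM →L[ℝ] ℝ)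
    (v : EM), ((∑ i, ∑ j, c i j • T i j) + (∑ j, c₂ j • T₂ j) - (∑ i, c₃ i • T₃ i)) v =
      (∑ i, ∑ j, c i j * T i j v) + (∑ j, c₂ j * T₂ j v) - (∑ i, c₃ i * T₃ i v) := by simp
  exact this T T₂ T₃ v

theorem extDerivOneForm_apply_sum_smul {y : M} (ξ : ∀ z : M, CotangentFiber EM z) (c : Fin m → ℝ)
    (V : Fin m → TangentSpace 𝓘(ℝ, EM) y) (v : TangentSpace 𝓘(ℝ, EM) y) :
    extDerivOneForm ξ y (∑ i, c i • V i) v = ∑ i, c i * extDerivOneForm ξ y (V i) v := by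
  have : ∀ (T : EM →L[ℝ] EM →L[ℝ] ℝ) (V : Fin m → EM) (v : EM),
    T (∑ i, c i • V i) v = ∑ i, c i * T (V i) v := by simp
  exact this (extDerivOneForm ξ y) V v

theorem extDerivOneForm_sum_smul_pullback_of_eq {ξ : ∀ y : B, CotangentFiber EB y}
    {η : Fin m → ∀ z : M, CotangentFiber EM z}
    (hh : ∀ i, ContMDiffAt 𝓘(ℝ, EB) 𝓘(ℝ, ℝ) ∞ (h i) x) (hη : ∀ i, SmoothFormAt (η i) (f x))
    (e : ∀ᶠ y in 𝓝 x, ξ y = ∑ i, h i y • pullbackCovector f y (η i (f y)))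
    {u : TangentSpace 𝓘(ℝ, EB) x} {c : Fin n → ℝ} {V : Fin n → TangentSpace 𝓘(ℝ, EM) (f x)}
    (hu : mfderiv 𝓘(ℝ, EB) 𝓘(ℝ, EM) f x u = ∑ j, c j • V j) (w : TangentSpace 𝓘(ℝ, EB) x) :
    extDerivOneForm ξ x u w =
      ∑ i, (h i x * ∑ j, c j * extDerivOneForm (η i) (f x) (V j)
          (mfderiv 𝓘(ℝ, EB) 𝓘(ℝ, EM) f x w) +
        funDifferential (h i) x u * η i (f x) (mfderiv 𝓘(ℝ, EB) 𝓘(ℝ, EM) f x w) -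
        funDifferential (h i) x w * ∑ j, c j * η i (f x) (V j)) := by
  rw [extDerivOneForm_congr e, extDerivOneForm_sum_smul_pullback f hh hη, hu]
  simp only [extDerivOneForm_apply_sum_smul, cotangent_apply_sum_smul]

theorem funDifferential_pairing_of_eq {ξ : ∀ y : B, CotangentFiber EB y}
    {X : ∀ y : B, TangentSpace 𝓘(ℝ, EB) y}
    {Y : Fin m → ∀ z : M, TangentSpace 𝓘(ℝ, EM) z} {η : Fin n → ∀ z : M, CotangentFiber EM z}
    (hh : ∀ i, ContMDiffAt 𝓘(ℝ, EB) 𝓘(ℝ, ℝ) ∞ (h i) x)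
    (hh' : ∀ j, ContMDiffAt 𝓘(ℝ, EB) 𝓘(ℝ, ℝ) ∞ (h' j) x)
    (hY : ∀ i, SmoothFieldAt (Y i) (f x)) (hη : ∀ j, SmoothFormAt (η j) (f x))
    (e : ∀ᶠ y in 𝓝 x, mfderiv 𝓘(ℝ, EB) 𝓘(ℝ, EM) f y (X y) = ∑ i, h i y • Y i (f y))
    (e' : ∀ᶠ y in 𝓝 x, ξ y = ∑ j, h' j y • pullbackCovector f y (η j (f y)))
    (w : TangentSpace 𝓘(ℝ, EB) x) :
    funDifferential (fun y => ξ y (X y)) x w =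
      ∑ i, ∑ j, (h i x * h' j x * funDifferential (fun z => η j z (Y i z)) (f x)
          (mfderiv 𝓘(ℝ, EB) 𝓘(ℝ, EM) f x w) +
        η j (f x) (Y i (f x)) *
          (h i x * funDifferential (h' j) x w + h' j x * funDifferential (h i) x w)) := by
  have h1 : (fun y => ξ y (X y)) =ᶠ[𝓝 x] fun y =>
      ∑ p : Fin m × Fin n, (h p.1 y * h' p.2 y) * η p.2 (f y) (Y p.1 (f y)) := by
    filter_upwards [e, e'] with y hy hy'
    rw [Fintype.sum_prod_type, Finset.sum_comm, hy', cotangent_sum_smul_apply]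
    refine Finset.sum_congr rfl fun j _ => ?_
    change h' j y * η j (f y) (mfderiv 𝓘(ℝ, EB) 𝓘(ℝ, EM) f y (X y)) = _
    rw [hy, cotangent_apply_sum_smul, Finset.mul_sum]
    exact Finset.sum_congr rfl fun i _ => by ring
  have h2 : funDifferential (fun y => ξ y (X y)) x w = _ :=
    congrArg (fun T : EB →L[ℝ] ℝ => T w) h1.mfderiv_eq
  rw [h2]
  refine (funDifferential_sum_mul_comp f (u := fun (p : Fin m × Fin n) z => η p.2 z (Y p.1 z))
    (fun p => (hh p.1).mul (hh' p.2)) (fun p => (hη p.2).cotangent_apply (hY p.1)) w).trans ?_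
  rw [Fintype.sum_prod_type]
  refine Finset.sum_congr rfl fun i _ => Finset.sum_congr rfl fun j _ => ?_
  have h3 : funDifferential (h i * h' j) x w = _ := funDifferential_mul
    ((hh i).mdifferentiableAt (by simp)) ((hh' j).mdifferentiableAt (by simp)) w
  rw [h3]
  rfl

/-- The scalar content of `courantBracket_snd_eq_sum`. Here `b`, `b'` stand for the derivatives of
the coefficients along the test vector, and `p` for the values `η'_j(Y_i)`. The sign in `-p i j`
encodes isotropy and is what makes all terms with `b` cancel; those with `b'` cancel in any case. -/
theorem sum_courant_identity (c u b v : Fin m → ℝ) (c' u' b' v' : Fin n → ℝ)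
    (d p q r : Fin m → Fin n → ℝ) :
    ∑ j, (c' j * ∑ i, c i * d i j + u' j * v' j - b' j * ∑ i, c i * p i j) +
      ∑ i, ∑ j, (c i * c' j * q i j + p i j * (c i * b' j + c' j * b i)) -
      ∑ i, (c i * ∑ j, c' j * r i j + u i * v i - b i * ∑ j, c' j * -p i j) =
    ∑ i, ∑ j, c i * c' j * (d i j + q i j - r i j) + ∑ j, u' j * v' j - ∑ i, u i * v i := by
  simp only [Finset.sum_add_distrib, Finset.sum_sub_distrib, Finset.mul_sum]
  rw [Finset.sum_comm (f := fun j i => c' j * (c i * d i j)),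
    Finset.sum_comm (f := fun j i => b' j * (c i * p i j))]
  have h1 : ∑ i, ∑ j, c i * c' j * (d i j + q i j - r i j) = ∑ i, ∑ j, c' j * (c i * d i j) -
      ∑ i, ∑ j, b' j * (c i * p i j) + (∑ i, ∑ j, c i * c' j * q i j +
      ∑ i, ∑ j, p i j * (c i * b' j + c' j * b i)) - (∑ i, ∑ j, c i * (c' j * r i j) -
      ∑ i, ∑ j, b i * (c' j * -p i j)) := by
    simp only [← Finset.sum_add_distrib, ← Finset.sum_sub_distrib]
    exact Finset.sum_congr rfl fun i _ => Finset.sum_congr rfl fun j _ => by ring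
  rw [h1]
  ring

/-- The covector counterpart of `mfderiv_mlieBracket_eq_sum`: the bracket is written as `ι_X dξ' +
d(ξ'(X)) - ι_{X'} dξ`, the expansions are inserted, and `d` is commuted with `f^*`. -/
theorem courantBracket_snd_eq_sum {σ τ : ∀ y : B, GenTangent EB y}
    {a : Fin m → ∀ z : M, GenTangent EM z} {a' : Fin n → ∀ z : M, GenTangent EM z}
    (hh : ∀ i, ContMDiffAt 𝓘(ℝ, EB) 𝓘(ℝ, ℝ) ∞ (h i) x)
    (hh' : ∀ j, ContMDiffAt 𝓘(ℝ, EB) 𝓘(ℝ, ℝ) ∞ (h' j) x)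
    (ha : ∀ i, SmoothGenAt (a i) (f x)) (ha' : ∀ j, SmoothGenAt (a' j) (f x))
    (hiso : ∀ i j, genPairing (a i (f x)) (a' j (f x)) = 0)
    (e : ∀ᶠ y in 𝓝 x, mfderiv 𝓘(ℝ, EB) 𝓘(ℝ, EM) f y (σ y).1 = ∑ i, h i y • (a i (f y)).1 ∧
      (σ y).2 = ∑ i, h i y • pullbackCovector f y (a i (f y)).2)
    (e' : ∀ᶠ y in 𝓝 x, mfderiv 𝓘(ℝ, EB) 𝓘(ℝ, EM) f y (τ y).1 = ∑ j, h' j y • (a' j (f y)).1 ∧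
      (τ y).2 = ∑ j, h' j y • pullbackCovector f y (a' j (f y)).2) :
    (courantBracket σ τ x).2 =
      (∑ i, ∑ j, (h i x * h' j x) • pullbackCovector f x (courantBracket (a i) (a' j) (f x)).2) +
      (∑ j, funDifferential (h' j) x (σ x).1 • pullbackCovector f x (a' j (f x)).2) -
      (∑ i, funDifferential (h i) x (τ x).1 • pullbackCovector f x (a i (f x)).2) := by
  ext w
  have hη := fun i => (smoothGenAt_iff.1 (ha i)).2
  have hη' := fun j => (smoothGenAt_iff.1 (ha' j)).2
  let D := mfderiv 𝓘(ℝ, EB) 𝓘(ℝ, EM) f x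
  have t1 := extDerivOneForm_sum_smul_pullback_of_eq f hh' hη' (e'.mono fun y hy => hy.2)
    e.self_of_nhds.1 w
  have t2 := funDifferential_pairing_of_eq f hh hh' (fun i => (smoothGenAt_iff.1 (ha i)).1) hη'
    (e.mono fun y hy => hy.1) (e'.mono fun y hy => hy.2) w
  have t3 := extDerivOneForm_sum_smul_pullback_of_eq f hh hη (e.mono fun y hy => hy.2)
    e'.self_of_nhds.1 w
  have t5 : (courantBracket σ τ x).2 w = extDerivOneForm (fun y => (τ y).2) x (σ x).1 w +
    funDifferential (fun y => (τ y).2 (σ y).1) x w -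
    extDerivOneForm (fun y => (σ y).2) x (τ x).1 w := rfl
  have t9 : ∀ i j, (a i (f x)).2 (a' j (f x)).1 = -(a' j (f x)).2 (a i (f x)).1 := fun i j =>
    (eq_neg_of_add_eq_zero_right (hiso i j))
  rw [t5, t1, t2, t3, cotangent_combination_apply]
  simp only [t9]
  exact sum_courant_identity (fun i => h i x) (fun i => funDifferential (h i) x (τ x).1)
    (fun i => funDifferential (h i) x w) (fun i => (a i (f x)).2 (D w)) (fun j => h' j x)
    (fun j => funDifferential (h' j) x (σ x).1) (fun j => funDifferential (h' j) x w)
    (fun j => (a' j (f x)).2 (D w))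
    (fun i j => extDerivOneForm (fun z => (a' j z).2) (f x) (a i (f x)).1 (D w))
    (fun i j => (a' j (f x)).2 (a i (f x)).1)
    (fun i j => funDifferential (fun z => (a' j z).2 (a i z).1) (f x) (D w))
    (fun i j => extDerivOneForm (fun z => (a i z).2) (f x) (a' j (f x)).1 (D w))

end Expansion

/-! ### Transport of Lie algebroids along bundle isomorphisms, and locality of brackets. -/

section Transport

variable {E : Type*} [NormedAddCommGroup E] [NormedSpace ℝ E]
  {M : Type*} [TopologicalSpace M] [ChartedSpace E M]
  {F : Type*} [NormedAddCommGroup F] [NormedSpace ℝ F]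
  {V : M → Type*} [TopologicalSpace (TotalSpace F V)]
  [∀ x, AddCommGroup (V x)] [∀ x, Module ℝ (V x)] [∀ x, TopologicalSpace (V x)]
  [FiberBundle F V] [VectorBundle ℝ F V]
  {F' : Type*} [NormedAddCommGroup F'] [NormedSpace ℝ F']
  {V' : M → Type*} [TopologicalSpace (TotalSpace F' V')]
  [∀ x, AddCommGroup (V' x)] [∀ x, Module ℝ (V' x)] [∀ x, TopologicalSpace (V' x)]
  [FiberBundle F' V'] [VectorBundle ℝ F' V']
  {S : ∀ x, Submodule ℝ (V x)} {S' : ∀ x, Submodule ℝ (V' x)}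

/-- The map on sections induced by a smooth bundle map. -/
def SubbundleSection.map {φ : ∀ x, S x →ₗ[ℝ] S' x}
    (hφ : IsSmoothBundleMap E F F' fun x => (S' x).subtype ∘ₗ φ x) :
    SubbundleSection E F S →ₗ[ℝ] SubbundleSection E F' S' where
  toFun σ := ⟨⟨fun x => φ x ⟨σ.1 x, σ.2 x⟩, contMDiffOn_univ.1
    (hφ Set.univ (fun x => ⟨σ.1 x, σ.2 x⟩) isOpen_univ σ.1.contMDiff.contMDiffOn)⟩,
    fun x => (φ x ⟨σ.1 x, σ.2 x⟩).2⟩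
  map_add' σ τ := SubbundleSection.ext_apply fun x =>
    congrArg Subtype.val ((φ x).map_add ⟨σ.1 x, σ.2 x⟩ ⟨τ.1 x, τ.2 x⟩)
  map_smul' c σ := SubbundleSection.ext_apply fun x =>
    congrArg Subtype.val ((φ x).map_smul c ⟨σ.1 x, σ.2 x⟩)

/-- The linear equivalence of the spaces of sections induced by an isomorphism of bundles. -/
def SubbundleSection.mapEquiv {φ : ∀ x, S x ≃ₗ[ℝ] S' x}
    (hφ : IsSmoothBundleMap E F F' fun x => (S' x).subtype ∘ₗ (φ x).toLinearMap)
    (hψ : IsSmoothBundleMap E F' F fun x => (S x).subtype ∘ₗ (φ x).symm.toLinearMap) :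
    SubbundleSection E F S ≃ₗ[ℝ] SubbundleSection E F' S' :=
  LinearEquiv.ofLinearMap (SubbundleSection.map hφ) (SubbundleSection.map hψ)
    (LinearMap.ext fun σ => SubbundleSection.ext_apply fun x =>
      congrArg Subtype.val ((φ x).apply_symm_apply ⟨σ.1 x, σ.2 x⟩))
    (LinearMap.ext fun σ => SubbundleSection.ext_apply fun x =>
      congrArg Subtype.val ((φ x).symm_apply_apply ⟨σ.1 x, σ.2 x⟩))

variable [IsManifold 𝓘(ℝ, E) ∞ M]
  {ρ : ∀ x, S x →ₗ[ℝ] TangentSpace 𝓘(ℝ, E) x} {ρ' : ∀ x, S' x →ₗ[ℝ] TangentSpace 𝓘(ℝ, E) x}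

/-- The Lie algebroid structure transported along an isomorphism of vector bundles. -/
def LieAlgebroid.transport (A' : LieAlgebroid E F' S' ρ') {φ : ∀ x, S x ≃ₗ[ℝ] S' x}
    (hφ : IsSmoothBundleMap E F F' fun x => (S' x).subtype ∘ₗ (φ x).toLinearMap)
    (hψ : IsSmoothBundleMap E F' F fun x => (S x).subtype ∘ₗ (φ x).symm.toLinearMap)
    (hS : ∃ k, IsSmoothSubbundle E F k S)
    (hρ : IsSmoothBundleMap (V' := fun x : M => TangentSpace 𝓘(ℝ, E) x) E F E ρ)
    (hρφ : ∀ x, ρ' x ∘ₗ (φ x).toLinearMap = ρ x) : LieAlgebroid E F S ρ where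
  isSubbundle := hS
  anchor_smooth := hρ
  bracket := (A'.bracket.compl₁₂ (SubbundleSection.mapEquiv hφ hψ).toLinearMap
    (SubbundleSection.mapEquiv hφ hψ).toLinearMap).compr₂
      (SubbundleSection.mapEquiv hφ hψ).symm.toLinearMap
  bracket_self a := by
    change (SubbundleSection.mapEquiv hφ hψ).symm (A'.bracket _ _) = 0
    rw [A'.bracket_self, map_zero]
  jacobi a b c := by
    let Ψ := SubbundleSection.mapEquiv hφ hψ
    change Ψ.symm (A'.bracket (Ψ a) (Ψ (Ψ.symm (A'.bracket (Ψ b) (Ψ c))))) =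
      Ψ.symm (A'.bracket (Ψ (Ψ.symm (A'.bracket (Ψ a) (Ψ b)))) (Ψ c)) +
      Ψ.symm (A'.bracket (Ψ b) (Ψ (Ψ.symm (A'.bracket (Ψ a) (Ψ c)))))
    simp only [LinearEquiv.apply_symm_apply]
    rw [A'.jacobi, map_add]
  leibniz g a b x := by
    let Ψ := SubbundleSection.mapEquiv hφ hψ
    have h1 : Ψ (SubbundleSection.funSmul g b) = SubbundleSection.funSmul g (Ψ b) :=
      SubbundleSection.ext_apply fun y => congrArg Subtype.val ((φ y).map_smul (g y) ⟨b.1 y, b.2 y⟩)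
    have h2 : ∀ c : SubbundleSection E F' S', (Ψ.symm c).1 x = (φ x).symm ⟨c.1 x, c.2 x⟩ :=
      fun c => rfl
    change (Ψ.symm (A'.bracket (Ψ a) (Ψ (SubbundleSection.funSmul g b)))).1 x =
      funDifferential g x (ρ x ⟨a.1 x, a.2 x⟩) • b.1 x +
        g x • (Ψ.symm (A'.bracket (Ψ a) (Ψ b))).1 x
    rw [h2, h2]
    have h3 : (⟨(A'.bracket (Ψ a) (Ψ (SubbundleSection.funSmul g b))).1 x,
        (A'.bracket (Ψ a) (Ψ (SubbundleSection.funSmul g b))).2 x⟩ : S' x) =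
        funDifferential g x (ρ x ⟨a.1 x, a.2 x⟩) • φ x ⟨b.1 x, b.2 x⟩ +
          g x • (⟨(A'.bracket (Ψ a) (Ψ b)).1 x, (A'.bracket (Ψ a) (Ψ b)).2 x⟩ : S' x) := by
      apply Subtype.ext
      rw [← hρφ]
      refine Eq.trans ?_ (A'.leibniz g (Ψ a) (Ψ b) x)
      rw [← h1]
    rw [h3, map_add, map_smul, map_smul, LinearEquiv.symm_apply_apply]
    rfl

theorem LieAlgebroid.transport_bracket (A' : LieAlgebroid E F' S' ρ') {φ : ∀ x, S x ≃ₗ[ℝ] S' x}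
    (hφ : IsSmoothBundleMap E F F' fun x => (S' x).subtype ∘ₗ (φ x).toLinearMap)
    (hψ : IsSmoothBundleMap E F' F fun x => (S x).subtype ∘ₗ (φ x).symm.toLinearMap)
    (hS : ∃ k, IsSmoothSubbundle E F k S)
    (hρ : IsSmoothBundleMap (V' := fun x : M => TangentSpace 𝓘(ℝ, E) x) E F E ρ)
    (hρφ : ∀ x, ρ' x ∘ₗ (φ x).toLinearMap = ρ x) (σ τ : SubbundleSection E F S) (x : M) :
    φ x ⟨((A'.transport hφ hψ hS hρ hρφ).bracket σ τ).1 x,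
      ((A'.transport hφ hψ hS hρ hρφ).bracket σ τ).2 x⟩ =
    ⟨(A'.bracket (SubbundleSection.map hφ σ) (SubbundleSection.map hφ τ)).1 x,
      (A'.bracket (SubbundleSection.map hφ σ) (SubbundleSection.map hφ τ)).2 x⟩ :=
  (φ x).apply_symm_apply _

theorem LieAlgebroid.isLieAlgebroidIso_transport (A' : LieAlgebroid E F' S' ρ')
    {φ : ∀ x, S x ≃ₗ[ℝ] S' x}
    (hφ : IsSmoothBundleMap E F F' fun x => (S' x).subtype ∘ₗ (φ x).toLinearMap)
    (hψ : IsSmoothBundleMap E F' F fun x => (S x).subtype ∘ₗ (φ x).symm.toLinearMap)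
    (hS : ∃ k, IsSmoothSubbundle E F k S)
    (hρ : IsSmoothBundleMap (V' := fun x : M => TangentSpace 𝓘(ℝ, E) x) E F E ρ)
    (hρφ : ∀ x, ρ' x ∘ₗ (φ x).toLinearMap = ρ x) :
    IsLieAlgebroidIso (A'.transport hφ hψ hS hρ hρφ) A' fun x => (φ x).toLinearMap where
  smooth := hφ
  exists_inverse := ⟨fun x => (φ x).symm.toLinearMap, hψ, fun x =>
    ⟨LinearMap.ext (φ x).symm_apply_apply, LinearMap.ext (φ x).apply_symm_apply⟩⟩
  anchor := hρφ
  bracket σ τ σ' τ' hσ hτ x := by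
    have h1 : σ' = SubbundleSection.map hφ σ := SubbundleSection.ext_apply hσ
    have h2 : τ' = SubbundleSection.map hφ τ := SubbundleSection.ext_apply hτ
    rw [h1, h2]
    exact (congrArg Subtype.val (A'.transport_bracket hφ hψ hS hρ hρφ σ τ x)).symm

theorem LieAlgebroid.bracket_swap (A : LieAlgebroid E F S ρ) (σ τ : SubbundleSection E F S) :
    A.bracket τ σ = -A.bracket σ τ := by
  have h := A.bracket_self (σ + τ)
  simp only [map_add, LinearMap.add_apply, A.bracket_self, zero_add, add_zero] at h
  exact eq_neg_of_add_eq_zero_left h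

variable [FiniteDimensional ℝ E] [T2Space M]

/-- The bracket of a Lie algebroid is local. -/
theorem LieAlgebroid.bracket_congr_right (A : LieAlgebroid E F S ρ)
    (σ : SubbundleSection E F S) {τ τ' : SubbundleSection E F S} {x : M}
    (h : ∀ᶠ y in 𝓝 x, τ.1 y = τ'.1 y) : (A.bracket σ τ).1 x = (A.bracket σ τ').1 x := by
  -- With `g` supported where `τ = τ'`, the section `g (τ - τ')` is zero globally. The Leibniz rule
  -- at `x`, where `g = 1` and `τ - τ'` vanishes, leaves only the bracket with `τ - τ'`.
  obtain ⟨g, hg, hgU⟩ := exists_bump E h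
  have h1 : SubbundleSection.funSmul g (τ - τ') = 0 := SubbundleSection.ext_apply fun y => by
    change g y • (τ.1 y - τ'.1 y) = 0
    by_cases hy : y ∈ tsupport g
    · have : τ.1 y = τ'.1 y := hgU hy
      rw [this, sub_self, smul_zero]
    · rw [image_eq_zero_of_notMem_tsupport hy, zero_smul]
  have h2 := A.leibniz g σ (τ - τ') x
  have h3 : (τ - τ').1 x = 0 := sub_eq_zero.2 h.self_of_nhds
  have h4 : (0 : SubbundleSection E F S).1 x = 0 := rfl
  rw [h1, map_zero, h3, smul_zero, zero_add, hg.self_of_nhds, one_smul, map_sub, h4] at h2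
  exact sub_eq_zero.1 h2.symm

theorem LieAlgebroid.bracket_congr (A : LieAlgebroid E F S ρ)
    {σ σ' τ τ' : SubbundleSection E F S} {x : M} (hσ : ∀ᶠ y in 𝓝 x, σ.1 y = σ'.1 y)
    (hτ : ∀ᶠ y in 𝓝 x, τ.1 y = τ'.1 y) : (A.bracket σ τ).1 x = (A.bracket σ' τ').1 x := by
  rw [A.bracket_congr_right σ hτ, A.bracket_swap, A.bracket_swap τ' σ']
  exact congrArg Neg.neg (A.bracket_congr_right τ' hσ)

end Transport

/-! ### Local expansions of sections and uniqueness of the pullback. -/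

section LocalExpansion

variable {EB : Type*} [NormedAddCommGroup EB] [NormedSpace ℝ EB] [FiniteDimensional ℝ EB]
  {B : Type*} [TopologicalSpace B] [T2Space B] [ChartedSpace EB B] [IsManifold 𝓘(ℝ, EB) ∞ B]
  {EM : Type*} [NormedAddCommGroup EM] [NormedSpace ℝ EM] [FiniteDimensional ℝ EM]
  {M : Type*} [TopologicalSpace M] [T2Space M] [ChartedSpace EM M] [IsManifold 𝓘(ℝ, EM) ∞ M]
  {F : Type*} [NormedAddCommGroup F] [NormedSpace ℝ F] [FiniteDimensional ℝ F]
  {V : M → Type*} [TopologicalSpace (TotalSpace F V)]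
  [∀ x, AddCommGroup (V x)] [∀ x, Module ℝ (V x)] [∀ x, TopologicalSpace (V x)]
  [FiberBundle F V] [VectorBundle ℝ F V]
  {S : ∀ y, Submodule ℝ (V y)} {ρ : ∀ y, S y →ₗ[ℝ] TangentSpace 𝓘(ℝ, EM) y}

/-- Near every point, a section along `f` of a subbundle `S` is a combination of global sections
of `S` with global smooth coefficients. -/
theorem IsSmoothSubbundle.exists_expansion {k : ℕ} (hS : IsSmoothSubbundle EM F k S)
    (f : C^∞⟮𝓘(ℝ, EB), B; 𝓘(ℝ, EM), M⟯) (σ : ∀ x, S (f x))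
    (hσ : ∀ x, ContMDiffAt 𝓘(ℝ, EB) (𝓘(ℝ, EM).prod 𝓘(ℝ, F)) ∞
      (fun y => TotalSpace.mk' F (f y) (σ y : V (f y))) x) (x : B) :
    ∃ (h : Fin k → C^∞⟮𝓘(ℝ, EB), B; 𝓘(ℝ, ℝ), ℝ⟯) (a : Fin k → SubbundleSection EM F S),
      ∀ᶠ y in 𝓝 x, (σ y : V (f y)) = ∑ i, h i y • ((a i).1 (f y) : V (f y)) := by
  obtain ⟨U, hU, hxU, s, hs, hspan⟩ := hS (f x)
  obtain ⟨c, hc, hcs⟩ := IsSmoothSubbundle.exists_coeff (EB := EB) (E := EM) (F := F) (V := V)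
    (b := f) hU hs hspan σ
  -- Two cutoffs are needed: `g` on `M` makes the frame of `S` global, and `g'` on `B` makes the
  -- coefficients global. Both equal `1` where the expansion is claimed.
  obtain ⟨g, hg, hgU⟩ := exists_bump EM (hU.mem_nhds hxU)
  have hfU : IsOpen (f ⁻¹' U) := hU.preimage f.contMDiff.continuous
  obtain ⟨g', hg', hg's, -⟩ := exists_bump_smul (E := EB) (F := EB)
    (V := fun y : B => TangentSpace 𝓘(ℝ, EB) y) hfU (show x ∈ f ⁻¹' U from hxU)
  have hmem : ∀ i y, g y • s i y ∈ S y := by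
    intro i y
    by_cases hy : y ∈ tsupport g
    · exact (S y).smul_mem _ ((hspan y (hgU hy)).2 ▸ Submodule.subset_span ⟨i, rfl⟩)
    · rw [image_eq_zero_of_notMem_tsupport hy, zero_smul]
      exact (S y).zero_mem
  refine ⟨fun i => ⟨fun y => g' y * c i y, hg's _ fun y hy =>
      (hcs y hy (hσ y) i).contMDiffWithinAt⟩,
    fun i => ⟨⟨fun y => g y • s i y, ContMDiffOn.smul_section_of_tsupport g.contMDiff.contMDiffOn
      hU hgU (hs i)⟩, hmem i⟩, ?_⟩
  filter_upwards [hg', f.contMDiff.continuous.continuousAt.eventually hg, hfU.mem_nhds hxU]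
    with y hy1 hy2 hy3
  rw [hc y hy3]
  refine Finset.sum_congr rfl fun i _ => ?_
  change c i y • s i (f y) = (g' y * c i y) • g (f y) • s i (f y)
  rw [hy1, hy2, one_mul, one_smul]

/-- `IsPullback` constrains only sections with an expansion valid on all of `B`. Cutting off `σ` and
its coefficients by the same bump function produces such a section without changing `σ` near `x`. -/
theorem exists_eventuallyEq_expansion {k : ℕ} (hS : IsSmoothSubbundle EM F k S)
    {f : C^∞⟮𝓘(ℝ, EB), B; 𝓘(ℝ, EM), M⟯}
    (σ : SubbundleSection EB (F × EB) (pullbackFiber f ρ)) (x : B) :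
    ∃ (h : Fin k → C^∞⟮𝓘(ℝ, EB), B; 𝓘(ℝ, ℝ), ℝ⟯) (a : Fin k → SubbundleSection EM F S)
      (σ' : SubbundleSection EB (F × EB) (pullbackFiber f ρ)),
      (∀ᶠ y in 𝓝 x, σ.1 y = σ'.1 y) ∧
      ∀ y, (σ'.1 y).1 = ∑ i, h i y • ((a i).1 (f y) : V (f y)) := by
  obtain ⟨h, a, ha⟩ := hS.exists_expansion f (fun y => ⟨(σ.1 y).1, (σ.2 y).1⟩) (fun y =>
    (contMDiffAt_pullback_section_iff f).1 (contMDiffAt_prod_section_iff.1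
      (σ.1.contMDiff y)).1) x
  obtain ⟨g, hg, hgU⟩ := exists_bump EB ha
  refine ⟨fun i => g * h i, a, SubbundleSection.funSmul g σ, ?_, fun y => ?_⟩
  · filter_upwards [hg] with y hy
    change σ.1 y = g y • σ.1 y
    rw [hy, one_smul]
  · change g y • (show V (f y) from (σ.1 y).1) = ∑ i, (g y * h i y) • ((a i).1 (f y) : V (f y))
    by_cases hy : y ∈ tsupport g
    · have h1 : (show V (f y) from (σ.1 y).1) = _ := hgU hy
      rw [h1, Finset.smul_sum]
      simp only [mul_smul]
    · rw [image_eq_zero_of_notMem_tsupport hy]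
      simp only [zero_mul, zero_smul, Finset.sum_const_zero]
      exact zero_smul ℝ (show V (f y) from (σ.1 y).1)

/-- A Lie algebroid has at most one pullback. -/
theorem LieAlgebroid.IsPullback.unique {f : C^∞⟮𝓘(ℝ, EB), B; 𝓘(ℝ, EM), M⟯}
    {A : LieAlgebroid EM F S ρ}
    {P P' : LieAlgebroid EB (F × EB) (pullbackFiber f ρ) (pullbackAnchor f ρ)}
    (hP : A.IsPullback f P) (hP' : A.IsPullback f P') : P = P' := by
  obtain ⟨k, hS⟩ := A.isSubbundle
  refine LieAlgebroid.ext_bracket fun σ τ x => ?_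
  obtain ⟨h, a, σ', hσ, ha⟩ := exists_eventuallyEq_expansion hS σ x
  obtain ⟨h', a', τ', hτ, ha'⟩ := exists_eventuallyEq_expansion hS τ x
  have h1 := hP _ _ h h' a a' σ' τ' ha ha' x
  have h3 := hP' _ _ h h' a a' σ' τ' ha ha' x
  have h5 : (P.bracket σ' τ').1 x = (P'.bracket σ' τ').1 x :=
    Prod.ext (h1.1.trans h3.1.symm) (h1.2.trans h3.2.symm)
  exact (P.bracket_congr hσ hτ).trans (h5.trans (P'.bracket_congr hσ hτ).symm)

end LocalExpansion

/-! ### Comparison of the brackets, and the pullback Lie algebroid. -/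

section Backward

variable {EB : Type*} [NormedAddCommGroup EB] [NormedSpace ℝ EB] [FiniteDimensional ℝ EB]
  {B : Type*} [TopologicalSpace B] [ChartedSpace EB B] [IsManifold 𝓘(ℝ, EB) ∞ B]
  {EM : Type*} [NormedAddCommGroup EM] [NormedSpace ℝ EM] [FiniteDimensional ℝ EM]
  {M : Type*} [TopologicalSpace M] [ChartedSpace EM M] [IsManifold 𝓘(ℝ, EM) ∞ M]
  {f : C^∞⟮𝓘(ℝ, EB), B; 𝓘(ℝ, EM), M⟯} {L : ∀ y : M, Submodule ℝ (GenTangent EM y)}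

/-- The bracket on `f^!L` corresponds to the Courant bracket on `𝔅L`. -/
theorem IsDirac.courantBracket_pullbackToBackward (hL : IsDirac EM L) {m n : ℕ}
    {h : Fin m → C^∞⟮𝓘(ℝ, EB), B; 𝓘(ℝ, ℝ), ℝ⟯} {h' : Fin n → C^∞⟮𝓘(ℝ, EB), B; 𝓘(ℝ, ℝ), ℝ⟯}
    {a : Fin m → SubbundleSection EM (EM × (EM →L[ℝ] ℝ)) L}
    {a' : Fin n → SubbundleSection EM (EM × (EM →L[ℝ] ℝ)) L}
    {σ τ : SubbundleSection EB ((EM × (EM →L[ℝ] ℝ)) × EB) (pullbackFiber f (diracAnchor L))} {x : B}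
    (ha : ∀ᶠ y in 𝓝 x, (σ.1 y).1 = ∑ i, h i y • ((a i).1 (f y) : GenTangent EM (f y)))
    (ha' : ∀ᶠ y in 𝓝 x, (τ.1 y).1 = ∑ j, h' j y • ((a' j).1 (f y) : GenTangent EM (f y))) :
    ∃ hR : (((∑ i, ∑ j, (h i x * h' j x) •
        courantBracket (fun z => (a i).1 z) (fun z => (a' j).1 z) (f x)) +
        (∑ j, funDifferential (h' j) x (σ.1 x).2 • ((a' j).1 (f x) : GenTangent EM (f x))) -
        (∑ i, funDifferential (h i) x (τ.1 x).2 • ((a i).1 (f x) : GenTangent EM (f x))),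
        VectorField.mlieBracket 𝓘(ℝ, EB) (fun y => (σ.1 y).2) (fun y => (τ.1 y).2) x) :
          PullbackAmbient f (GenTangent EM) x) ∈ pullbackFiber f (diracAnchor L) x,
      (pullbackToBackward f L x ⟨_, hR⟩ : GenTangent EB x) =
        courantBracket (fun y => (pullbackToBackward f L y ⟨σ.1 y, σ.2 y⟩).1)
          (fun y => (pullbackToBackward f L y ⟨τ.1 y, τ.2 y⟩).1) x := by
  have key : ∀ {k : ℕ} {c : Fin k → C^∞⟮𝓘(ℝ, EB), B; 𝓘(ℝ, ℝ), ℝ⟯}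
      {b : Fin k → SubbundleSection EM (EM × (EM →L[ℝ] ℝ)) L}
      {υ : SubbundleSection EB ((EM × (EM →L[ℝ] ℝ)) × EB) (pullbackFiber f (diracAnchor L))},
      (∀ᶠ y in 𝓝 x, (υ.1 y).1 = ∑ i, c i y • ((b i).1 (f y) : GenTangent EM (f y))) →
      ∀ᶠ y in 𝓝 x, mfderiv 𝓘(ℝ, EB) 𝓘(ℝ, EM) f y (pullbackToBackward f L y ⟨υ.1 y, υ.2 y⟩).1.1 =
          ∑ i, c i y • ((b i).1 (f y)).1 ∧
        (pullbackToBackward f L y ⟨υ.1 y, υ.2 y⟩).1.2 =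
          ∑ i, c i y • pullbackCovector f y ((b i).1 (f y)).2 := by
    intro k c b υ hυ
    filter_upwards [hυ] with y hy
    obtain ⟨h1, h2⟩ := υ.2 y
    have h3 : (show GenTangent EM (f y) from (υ.1 y).1).1 =
        mfderiv 𝓘(ℝ, EB) 𝓘(ℝ, EM) f y (υ.1 y).2 := h2
    constructor
    · refine h3.symm.trans ((congrArg Prod.fst hy).trans ?_)
      rw [Prod.fst_sum]
      rfl
    · have h4 : (show GenTangent EM (f y) from (υ.1 y).1).2 = _ := congrArg Prod.snd hy
      change pullbackCovector f y (show GenTangent EM (f y) from (υ.1 y).1).2 = _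
      rw [h4, Prod.snd_sum, map_sum]
      rfl
  have e := key ha
  have e' := key ha'
  have sm := fun (υ : SubbundleSection EB ((EM × (EM →L[ℝ] ℝ)) × EB)
      (pullbackFiber f (diracAnchor L))) =>
    (contMDiffAt_prod_section_iff.1 (υ.1.contMDiff x)).2
  have h1 := mfderiv_mlieBracket_eq_sum f (fun i => (h i).contMDiff.contMDiffAt)
    (fun j => (h' j).contMDiff.contMDiffAt) (sm σ) (sm τ)
    (fun i => (smoothGenAt_iff.1 (smoothGenAt_section (a i) (f x))).1)
    (fun j => (smoothGenAt_iff.1 (smoothGenAt_section (a' j) (f x))).1)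
    (e.mono fun y hy => hy.1) (e'.mono fun y hy => hy.1)
  have h2 := courantBracket_snd_eq_sum f (fun i => (h i).contMDiff.contMDiffAt)
    (fun j => (h' j).contMDiff.contMDiffAt) (fun i => smoothGenAt_section (a i) (f x))
    (fun j => smoothGenAt_section (a' j) (f x))
    (fun i j => hL.genPairing_eq_zero (a i) (a' j) (f x)) e e'
  -- Involutivity of `L` enters here; together with `h1` it shows that the displayed formula takes
  -- values in `f^!L` before any bracket on `f^!L` is available.
  have hmem : (∑ i, ∑ j, (h i x * h' j x) •
      courantBracket (fun z => (a i).1 z) (fun z => (a' j).1 z) (f x)) +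
      (∑ j, funDifferential (h' j) x (σ.1 x).2 • ((a' j).1 (f x) : GenTangent EM (f x))) -
      (∑ i, funDifferential (h i) x (τ.1 x).2 • ((a i).1 (f x) : GenTangent EM (f x))) ∈
        L (f x) := by
    refine (L (f x)).sub_mem ((L (f x)).add_mem ?_ ?_) ?_
    · exact Submodule.sum_mem _ fun i _ => Submodule.sum_mem _ fun j _ =>
        (L (f x)).smul_mem _ (hL.involutive (a i) (a' j) (f x))
    · exact Submodule.sum_mem _ fun j _ => (L (f x)).smul_mem _ ((a' j).2 (f x))
    · exact Submodule.sum_mem _ fun i _ => (L (f x)).smul_mem _ ((a i).2 (f x))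
  refine ⟨⟨hmem, Eq.trans ?_ h1.symm⟩, Prod.ext rfl (Eq.trans ?_ h2.symm)⟩
  · change Prod.fst (_ + _ - _ : GenTangent EM (f x)) = _
    simp only [Prod.fst_sub, Prod.fst_add, Prod.fst_sum]
    rfl
  · change pullbackCovector f x (Prod.snd (_ + _ - _ : GenTangent EM (f x))) = _
    simp only [Prod.snd_sub, Prod.snd_add, Prod.snd_sum, map_sub, map_add, map_sum]
    rfl

theorem IsDirac.exists_isSmoothSubbundle_pullbackFiber (hL : IsDirac EM L)
    (hf : IsTransverse f (diracAnchor L)) :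
    ∃ k, IsSmoothSubbundle EB ((EM × (EM →L[ℝ] ℝ)) × EB) k (pullbackFiber f (diracAnchor L)) :=
  let ⟨_, hk⟩ := hL.isSubbundle
  ⟨_, isSmoothSubbundle_pullbackFiber hk isSmoothBundleMap_diracAnchor f hf⟩

/-- The isomorphism of vector bundles `f^!L ≃ 𝔅L`. -/
def IsDirac.backwardEquiv (hL : IsDirac EM L) (hf : IsTransverse f (diracAnchor L)) (x : B) :
    pullbackFiber f (diracAnchor L) x ≃ₗ[ℝ] backwardPullback f L x :=
  LinearEquiv.ofBijective (pullbackToBackward f L x)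
    (pullbackToBackward_bijective (fun y => (hL.maximal_isotropic y).1) hf x)

theorem IsDirac.isSmoothBundleMap_backwardEquiv (hL : IsDirac EM L)
    (hf : IsTransverse f (diracAnchor L)) :
    IsSmoothBundleMap EB ((EM × (EM →L[ℝ] ℝ)) × EB) (EB × (EB →L[ℝ] ℝ))
      fun x => (backwardPullback f L x).subtype ∘ₗ (hL.backwardEquiv hf x).toLinearMap :=
  isSmoothBundleMap_pullbackToBackward

theorem IsDirac.isSmoothBundleMap_backwardEquiv_symm (hL : IsDirac EM L)
    (hf : IsTransverse f (diracAnchor L)) :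
    IsSmoothBundleMap EB (EB × (EB →L[ℝ] ℝ)) ((EM × (EM →L[ℝ] ℝ)) × EB)
      fun x => (pullbackFiber f (diracAnchor L) x).subtype ∘ₗ
        (hL.backwardEquiv hf x).symm.toLinearMap :=
  let ⟨_, hk⟩ := hL.exists_isSmoothSubbundle_pullbackFiber hf
  hk.isSmoothBundleMap_symm (hL.isSmoothBundleMap_backwardEquiv hf)

variable [T2Space B] [T2Space M]

/-- The backward pullback of a Dirac structure along a transverse map is a Dirac structure. -/
theorem IsDirac.backwardPullback (hL : IsDirac EM L) (hf : IsTransverse f (diracAnchor L)) :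
    IsDirac EB (_root_.backwardPullback f L) where
  isSubbundle :=
    let ⟨k, hk⟩ := hL.exists_isSmoothSubbundle_pullbackFiber hf
    ⟨k, hk.map isSmoothBundleMap_pullbackToBackward fun x => (hL.backwardEquiv hf x).bijective⟩
  maximal_isotropic := maximal_isotropic_backwardPullback hL.maximal_isotropic hf
  involutive σ' τ' x := by
    obtain ⟨k, hk⟩ := hL.isSubbundle
    let Ψ := SubbundleSection.mapEquiv (hL.isSmoothBundleMap_backwardEquiv hf)
      (hL.isSmoothBundleMap_backwardEquiv_symm hf)
    -- Sections of `𝔅L` are images of sections of `f^!L`, and these have expansions near `x`. The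
    -- bracket at `x` is therefore the image of an element of `f^!L`, so it lies in `𝔅L`.
    obtain ⟨σ, rfl⟩ := Ψ.surjective σ'
    obtain ⟨τ, rfl⟩ := Ψ.surjective τ'
    have ex := fun υ : SubbundleSection EB ((EM × (EM →L[ℝ] ℝ)) × EB)
      (pullbackFiber f (diracAnchor L)) =>
      hk.exists_expansion f (fun y => ⟨(υ.1 y).1, (υ.2 y).1⟩) (fun y =>
        (contMDiffAt_pullback_section_iff f).1 (contMDiffAt_prod_section_iff.1
          (υ.1.contMDiff y)).1) x
    obtain ⟨h, a, ha⟩ := ex σ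
    obtain ⟨h', a', ha'⟩ := ex τ
    obtain ⟨hR, hR'⟩ := hL.courantBracket_pullbackToBackward ha ha'
    exact hR' ▸ (pullbackToBackward f L x ⟨_, hR⟩).2

theorem isSmoothBundleMap_pullbackAnchor :
    IsSmoothBundleMap (V' := fun x : B => TangentSpace 𝓘(ℝ, EB) x) EB
      ((EM × (EM →L[ℝ] ℝ)) × EB) EB (pullbackAnchor f (diracAnchor L)) := fun _ _ hU h _ hx =>
  (contMDiffAt_prod_section_iff.1 (h.contMDiffAt (hU.mem_nhds hx))).2.contMDiffWithinAt

/-- The Lie algebroid pullback of a Dirac structure. -/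
def IsDirac.pullbackLieAlgebroid (hL : IsDirac EM L) (hf : IsTransverse f (diracAnchor L)) :
    LieAlgebroid EB ((EM × (EM →L[ℝ] ℝ)) × EB) (pullbackFiber f (diracAnchor L))
      (pullbackAnchor f (diracAnchor L)) :=
  -- Transporting the bracket from `𝔅L` makes its axioms automatic and avoids choosing expansions.
  (hL.backwardPullback hf).lieAlgebroid.transport (hL.isSmoothBundleMap_backwardEquiv hf)
    (hL.isSmoothBundleMap_backwardEquiv_symm hf) (hL.exists_isSmoothSubbundle_pullbackFiber hf)
    isSmoothBundleMap_pullbackAnchor fun _ => rfl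

/-- The transported bracket and the displayed formula have the same image in `𝔅L`, and the
comparison map is injective on fibres. -/
theorem IsDirac.isPullback_pullbackLieAlgebroid (hL : IsDirac EM L)
    (hf : IsTransverse f (diracAnchor L))
    {A : LieAlgebroid EM (EM × (EM →L[ℝ] ℝ)) L (diracAnchor L)} (hA : A.IsCourant) :
    A.IsPullback f (hL.pullbackLieAlgebroid hf) := by
  intro m n h h' a a' σ τ ha ha' x
  obtain ⟨hR, hR'⟩ := hL.courantBracket_pullbackToBackward (.of_forall ha) (.of_forall ha') (x := x)
  have h1 := (hL.backwardPullback hf).lieAlgebroid.transport_bracket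
    (hL.isSmoothBundleMap_backwardEquiv hf) (hL.isSmoothBundleMap_backwardEquiv_symm hf)
    (hL.exists_isSmoothSubbundle_pullbackFiber hf) isSmoothBundleMap_pullbackAnchor
    (fun _ => rfl) σ τ x
  have h2 : ((hL.pullbackLieAlgebroid hf).bracket σ τ).1 x = _ :=
    congrArg Subtype.val ((hL.backwardEquiv hf x).injective (h1.trans (Subtype.ext hR'.symm)))
  rw [h2]
  refine ⟨?_, rfl⟩
  simp only [hA _ _ _]
  rfl

end Backward

end

/-! ### The main theorem. -/

theorem proposition4p1
    {EB : Type*} [NormedAddCommGroup EB] [NormedSpace ℝ EB] [FiniteDimensional ℝ EB]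
    {B : Type*} [TopologicalSpace B] [T2Space B] [SecondCountableTopology B]
    [ChartedSpace EB B] [IsManifold 𝓘(ℝ, EB) ∞ B]
    {EM : Type*} [NormedAddCommGroup EM] [NormedSpace ℝ EM] [FiniteDimensional ℝ EM]
    {M : Type*} [TopologicalSpace M] [T2Space M] [SecondCountableTopology M]
    [ChartedSpace EM M] [IsManifold 𝓘(ℝ, EM) ∞ M]
    (f : C^∞⟮𝓘(ℝ, EB), B; 𝓘(ℝ, EM), M⟯)
    (L : ∀ y : M, Submodule ℝ (GenTangent EM y))
    (hL : IsDirac EM L) (hf : IsTransverse f (diracAnchor L)) :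
    -- `L` has an underlying Lie algebroid
    (∃! A : LieAlgebroid EM (EM × (EM →L[ℝ] ℝ)) L (diracAnchor L), A.IsCourant) ∧
    -- `𝔅L` is a Dirac structure, with an underlying Lie algebroid
    IsDirac EB (backwardPullback f L) ∧
    (∃! A' : LieAlgebroid EB (EB × (EB →L[ℝ] ℝ)) (backwardPullback f L)
      (diracAnchor (backwardPullback f L)), A'.IsCourant) ∧
    ∀ (A : LieAlgebroid EM (EM × (EM →L[ℝ] ℝ)) L (diracAnchor L))
      (A' : LieAlgebroid EB (EB × (EB →L[ℝ] ℝ)) (backwardPullback f L)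
        (diracAnchor (backwardPullback f L))),
      A.IsCourant → A'.IsCourant →
      -- the Lie algebroid pullback `f^!L` exists and is isomorphic to `𝔅L`
      (∃! P : LieAlgebroid EB ((EM × (EM →L[ℝ] ℝ)) × EB) (pullbackFiber f (diracAnchor L))
        (pullbackAnchor f (diracAnchor L)), A.IsPullback f P) ∧
      ∀ P : LieAlgebroid EB ((EM × (EM →L[ℝ] ℝ)) × EB) (pullbackFiber f (diracAnchor L))
        (pullbackAnchor f (diracAnchor L)), A.IsPullback f P →
        IsLieAlgebroidIso P A' (pullbackToBackward f L) := by
  refine ⟨hL.existsUnique_lieAlgebroid, hL.backwardPullback hf,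
    (hL.backwardPullback hf).existsUnique_lieAlgebroid, fun A A' hA hA' => ?_⟩
  have hP := hL.isPullback_pullbackLieAlgebroid hf hA
  refine ⟨⟨_, hP, fun P' hP' => hP'.unique hP⟩, fun P hP' => ?_⟩
  have hPA : A' = (hL.backwardPullback hf).lieAlgebroid :=
    LieAlgebroid.ext_bracket fun σ τ x => hA' σ τ x
  -- By uniqueness both algebroids may be replaced by the constructed ones, for which the comparison
  -- map is an isomorphism by transport.
  rw [hP'.unique hP, hPA]
  exact (hL.backwardPullback hf).lieAlgebroid.isLieAlgebroidIso_transport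
    (hL.isSmoothBundleMap_backwardEquiv hf) (hL.isSmoothBundleMap_backwardEquiv_symm hf)
    (hL.exists_isSmoothSubbundle_pullbackFiber hf) isSmoothBundleMap_pullbackAnchor fun _ => rfl
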